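/- **Lemma (Density function of $A(\kappa)$).** Let $0<s<\tfrac12$. For a Schwartz function $q:\mathbb R\to\mathbb C$ put $r=-\bar q$, $\hat q(\xi)=\frac1{\sqrt{2\pi}}\int e^{-i\xi x}q(x)\,dx$ and $\|q\|_{H^s}^2=\int_{\mathbb R}(4+\xi^2)^s|\hat q(\xi)|^2\,d\xi$. For $\kappa\in\mathbb C\setminus\{0\}$ with $i\kappa^2\in\mathbb R$ let $$\Lambda=(\partial+i\kappa^2)^{-1/2}\,\kappa q\,(\partial-i\kappa^2)^{-1/2},\qquad \Gamma=(\partial-i\kappa^2)^{-1/2}\,\kappa r\,(\partial+i\kappa^2)^{-1/2}$$ on $L^2(\mathbb R)$, where $(\partial\pm i\kappa^2)^{-1/2}$ is the Fourier multiplier with symbol $(i\xi\pm i\kappa^2)^{-1/2}$ (principal branch), and $$A(\kappa)=-\operatorname{sgn}(i\kappa^2)\sum_{m=1}^\infty\tfrac1m\operatorname{tr}\{(\Lambda\Gamma)^m\}.$$ Let $L(\kappa)=\begin{bmatrix}\partial+i\kappa^2&-\kappa q\\-\kappa r&\partial-i\kappa^2\end{bmatrix}$ on $L^2(\mathbb R;\mathbb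 C^2)$ with domain $H^1(\mathbb R;\mathbb C^2)$, let $L_0(\kappa)$ be $L(\kappa)$ with $q=r=0$, and let $G_0(x,y;\kappa)$ be the explicit integral kernel of $L_0(\kappa)^{-1}$, namely $$G_0(x,y;\kappa)=e^{-i\kappa^2|x-y|}\begin{bmatrix}\mathbf 1_{\{y<x\}}&0\\0&-\mathbf 1_{\{x<y\}}\end{bmatrix}\ \text{ if } i\kappa^2>0,\qquad G_0(x,y;\kappa)=-G_0(y,x;-\bar\kappa)\ \text{ if } i\kappa^2<0,$$ where the indicator functions are given the value $\tfrac12$ on $x=y$. The Green's function $G(x,y;\kappa)$ is the integral kernel of $L(\kappa)^{-1}$ for which $G-G_0$ is continuous on $\mathbb R^2$. Put $$\gamma(x;\kappa)=\operatorname{sgn}(i\kappa^2)\,[G_{11}-G_{22}](x,x;\kappa)-1,\qquad g_{12}(x;\kappa)=\operatorname{sgn}(i\kappa^2)\,G_{12}(x,x;\kappa),\qquad g_{21}(x;\kappa)=\operatorname{sgn}(i\kappa^2)\,G_{21}(x,x;\kappa).$$ Then there is $\delta>0$, depending only on $s$, such that for every Schwartz function $q$ with $\|q\|_{H^s}\le\delta$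 and every $\kappa\in\mathbb C$ with $i\kappa^2\in\mathbb R$ and $|\kappa|\ge1$ the objects above are well defined ($L(\kappa)$ has a bounded inverse, $G(\cdot,\cdot;\kappa)$ exists and is unique, every $(\Lambda\Gamma)^m$ with $m\ge1$ is of trace class, and the series for $A(\kappa)$ converges absolutely), and: 1. $A(\kappa)=-\overline{A(-\bar\kappa)}$. 2. The function $2i\kappa\,\gamma(\kappa)-(q\,g_{21}(\kappa)+r\,g_{12}(\kappa))$ is integrable, and $$\frac{\partial}{\partial\kappa}A(\kappa)=\int_{\mathbb R}\bigl[2i\kappa\,\gamma(\kappa)-\bigl(q\,g_{21}(\kappa)+r\,g_{12}(\kappa)\bigr)\bigr]\,dx,$$ where the derivative at $\kappa$ is the limit of the difference quotients $\frac{A(\kappa')-A(\kappa)}{\kappa'-\kappa}$ as $\kappa'\to\kappa$ within the set $\{\kappa':i\kappa'^2\in\mathbb R\}$ on which $A$ is considered. 3. The function $2+\gamma(x;\kappa)$ vanishes for no $x\in\mathbb R$, the function $\rho(\kappa)=-\kappa\,\dfrac{q\,g_{21}(\kappa)+r\,g_{12}(\kappa)}{2+\gamma(\kappa)}$ is integrable,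 and $A(\kappa)=\int_{\mathbb R}\rho(\kappa)\,dx$. -/

import Mathlib

open MeasureTheory Complex
open scoped SchwartzMap FourierTransform ENNReal ComplexConjugate InnerProductSpace

noncomputable section

namespace DNLS

/-! ### Hilbert-Schmidt operators, trace class operators, trace -/

section Trace

variable {E : Type} [NormedAddCommGroup E] [InnerProductSpace ℂ E] [CompleteSpace E]

/-- `T` is Hilbert-Schmidt: `∑ ‖T eᵢ‖² < ∞` for an orthonormal basis `(eᵢ)`
(the sum does not depend on the basis). -/
def IsHilbertSchmidt (T : E →L[ℂ] E) : Prop :=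
  ∃ (ι : Type) (b : HilbertBasis ι ℂ E), Summable fun i => ‖T (b i)‖ ^ 2

/-- `T` is of trace class: it is a product of two Hilbert-Schmidt operators. -/
def IsTraceClass (T : E →L[ℂ] E) : Prop :=
  ∃ A B : E →L[ℂ] E, IsHilbertSchmidt A ∧ IsHilbertSchmidt B ∧ T = A ∘L B

variable (E) in
/-- The index set of a fixed orthonormal basis of `E`. -/
def basisSet : Set E := (exists_hilbertBasis ℂ E).choose

variable (E) in
/-- A fixed orthonormal basis of `E`. -/
def onBasis : HilbertBasis (basisSet E) ℂ E := (exists_hilbertBasis ℂ E).choose_spec.choose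

/-- The trace `∑ ⟨eᵢ, T eᵢ⟩`; for trace class `T` the sum converges absolutely and does not
depend on the orthonormal basis. -/
def trace (T : E →L[ℂ] E) : ℂ := ∑' i, ⟪onBasis E i, T (onBasis E i)⟫_ℂ

end Trace

/-! ### Operators on `L²(ℝ)` -/

/-- `L²(ℝ; ℂ)`. -/
abbrev L2 : Type := Lp ℂ 2 (volume : Measure ℝ)

open Classical in
/-- Multiplication by an essentially bounded function `f` on `L²(ℝ)` (and `0` if `f` is not
essentially bounded). -/
def mulOp (f : ℝ → ℂ) : L2 →L[ℂ] L2 :=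
  if hf : MemLp f ∞ (volume : Measure ℝ) then
    (ContinuousLinearMap.mul ℂ ℂ).holderL volume ∞ 2 2 (hf.toLp f)
  else 0

/-- The Fourier multiplier with symbol `m`, where `m` is a function of the angular frequency `ξ`,
so that `∂` has the symbol `iξ`. Mathlib's Fourier transform uses the frequency `ξ / 2π`. -/
def fourierMult (m : ℝ → ℂ) : L2 →L[ℂ] L2 :=
  ((Lp.fourierTransformₗᵢ ℝ ℂ).symm.toContinuousLinearEquiv : L2 →L[ℂ] L2) ∘L
    mulOp (fun η => m (2 * Real.pi * η)) ∘L
      ((Lp.fourierTransformₗᵢ ℝ ℂ).toContinuousLinearEquiv : L2 →L[ℂ] L2)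

/-- `(∂ + z)^{-1/2}`, the Fourier multiplier with symbol `(iξ + z)^{-1/2}`, principal branch. -/
def invSqrtD (z : ℂ) : L2 →L[ℂ] L2 :=
  fourierMult fun ξ => (I * (ξ : ℂ) + z) ^ (-(1 / 2) : ℂ)

/-- The second potential `r = -q̄`. -/
def rOf (q : 𝓢(ℝ, ℂ)) (x : ℝ) : ℂ := -conj (q x)

/-- `Λ = (∂ + iκ²)^{-1/2} κ q (∂ - iκ²)^{-1/2}`. -/
def Lam (κ : ℂ) (q : 𝓢(ℝ, ℂ)) : L2 →L[ℂ] L2 :=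
  invSqrtD (I * κ ^ 2) ∘L mulOp (fun x => κ * q x) ∘L invSqrtD (-(I * κ ^ 2))

/-- `Γ = (∂ - iκ²)^{-1/2} κ r (∂ + iκ²)^{-1/2}`. -/
def Gam (κ : ℂ) (q : 𝓢(ℝ, ℂ)) : L2 →L[ℂ] L2 :=
  invSqrtD (-(I * κ ^ 2)) ∘L mulOp (fun x => κ * rOf q x) ∘L invSqrtD (I * κ ^ 2)

/-- `sgn(iκ²)`, for `iκ²` real. -/
def sgn (κ : ℂ) : ℂ := (Real.sign (I * κ ^ 2).re : ℂ)

/-- The term `(1/m) tr((ΛΓ)^m)` of the logarithmic perturbation determinant. -/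
def detTerm (κ : ℂ) (q : 𝓢(ℝ, ℂ)) (m : ℕ) : ℂ :=
  (1 / (m : ℂ)) * trace ((Lam κ q * Gam κ q) ^ m)

/-- The logarithmic perturbation determinant
`A(κ) = -sgn(iκ²) ∑_{m ≥ 1} (1/m) tr((ΛΓ)^m)`. -/
def logDet (κ : ℂ) (q : 𝓢(ℝ, ℂ)) : ℂ := -sgn κ * ∑' m : ℕ, detTerm κ q (m + 1)

/-! ### The Lax operator and its Green's function -/

/-- `L(κ) u = f` for `u, f ∈ L²(ℝ; ℂ²)`, in the sense of tempered distributions, where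
`L(κ) = [[∂ + iκ², -κ q], [-κ r, ∂ - iκ²]]`. Such a `u` has its weak derivative in `L²`,
so it lies in the domain `H¹(ℝ; ℂ²)` of `L(κ)`. -/
def LaxEq (κ : ℂ) (q : 𝓢(ℝ, ℂ)) (u f : L2 × L2) : Prop :=
  ∀ φ : 𝓢(ℝ, ℂ),
    (∫ x, (-(u.1 x * deriv φ x) + (I * κ ^ 2 * u.1 x - κ * q x * u.2 x) * φ x)
      = ∫ x, f.1 x * φ x) ∧
    (∫ x, (-(u.2 x * deriv φ x) + (-(κ * rOf q x * u.1 x) - I * κ ^ 2 * u.2 x) * φ x)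
      = ∫ x, f.2 x * φ x)

/-- The indicator function of `{y < x}` with the value `1/2`, the mean of its one-sided limits,
at `x = y`. -/
def step (x y : ℝ) : ℂ := if y < x then 1 else if y = x then 1 / 2 else 0

/-- The integral kernel of `L₀(κ)⁻¹` for `iκ² > 0`. -/
def freeGreenPos (κ : ℂ) (x y : ℝ) : Matrix (Fin 2) (Fin 2) ℂ :=
  Complex.exp (-(I * κ ^ 2 * (|x - y| : ℝ))) • !![step x y, 0; 0, -step y x]

open Classical in
/-- The integral kernel `G₀(x, y; κ)` of `L₀(κ)⁻¹`, where `L₀(κ)` is `L(κ)` with `q = r = 0`,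
for real `iκ² ≠ 0`. -/
def freeGreen (κ : ℂ) (x y : ℝ) : Matrix (Fin 2) (Fin 2) ℂ :=
  if 0 < (I * κ ^ 2).re then freeGreenPos κ x y else -freeGreenPos (-conj κ) y x

/-- `G` is the Green's function of `L(κ)`: `L(κ)` has a bounded inverse `R` on `L²(ℝ; ℂ²)`,
`G` is the integral kernel of `R`, and `G - G₀` is continuous on `ℝ × ℝ`. The last condition
fixes the values of `G` everywhere; on the diagonal `G₀` is the mean of its one-sided limits. -/
def IsGreen (κ : ℂ) (q : 𝓢(ℝ, ℂ)) (G : ℝ → ℝ → Matrix (Fin 2) (Fin 2) ℂ) : Prop :=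
  Continuous (fun p : ℝ × ℝ => G p.1 p.2 - freeGreen κ p.1 p.2) ∧
  ∃ R : (L2 × L2) →L[ℂ] (L2 × L2),
    (∀ u f : L2 × L2, LaxEq κ q u f ↔ u = R f) ∧
    ∀ f : L2 × L2, ∀ᵐ x : ℝ,
      (∀ i, Integrable (fun y => G x y i 0 * f.1 y) ∧ Integrable (fun y => G x y i 1 * f.2 y)) ∧
      (R f).1 x = ∫ y, (G x y 0 0 * f.1 y + G x y 0 1 * f.2 y) ∧
      (R f).2 x = ∫ y, (G x y 1 0 * f.1 y + G x y 1 1 * f.2 y)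

open Classical in
/-- The Green's function `G(x, y; κ)` of `L(κ)`. -/
def green (κ : ℂ) (q : 𝓢(ℝ, ℂ)) : ℝ → ℝ → Matrix (Fin 2) (Fin 2) ℂ :=
  if h : ∃ G, IsGreen κ q G then h.choose else 0

/-- `γ(x; κ) = sgn(iκ²) [G₁₁(x,x;κ) - G₂₂(x,x;κ)] - 1`. -/
def gam (κ : ℂ) (q : 𝓢(ℝ, ℂ)) (x : ℝ) : ℂ :=
  sgn κ * (green κ q x x 0 0 - green κ q x x 1 1) - 1

/-- `g₁₂(x; κ) = sgn(iκ²) G₁₂(x,x;κ)`. -/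
def g12 (κ : ℂ) (q : 𝓢(ℝ, ℂ)) (x : ℝ) : ℂ := sgn κ * green κ q x x 0 1

/-- `g₂₁(x; κ) = sgn(iκ²) G₂₁(x,x;κ)`. -/
def g21 (κ : ℂ) (q : 𝓢(ℝ, ℂ)) (x : ℝ) : ℂ := sgn κ * green κ q x x 1 0

/-- The density `ρ(κ) = -κ (q g₂₁ + r g₁₂) / (2 + γ)`. -/
def rho (κ : ℂ) (q : 𝓢(ℝ, ℂ)) (x : ℝ) : ℂ :=
  -κ * ((q x * g21 κ q x + rOf q x * g12 κ q x) / (2 + gam κ q x))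

/-! ### Sobolev norm -/

/-- `q̂(ξ) = (2π)^{-1/2} ∫ e^{-iξx} q(x) dx`. -/
def hat (q : 𝓢(ℝ, ℂ)) (ξ : ℝ) : ℂ :=
  (1 / (Real.sqrt (2 * Real.pi) : ℂ)) * ∫ x : ℝ, Complex.exp (-(I * ξ * x)) * q x

/-- `‖q‖_{H^s}`, where `‖q‖²_{H^s} = ∫ (4 + ξ²)^s |q̂(ξ)|² dξ`. -/
def sobolevNorm (s : ℝ) (q : 𝓢(ℝ, ℂ)) : ℝ :=
  Real.sqrt (∫ ξ : ℝ, (4 + ξ ^ 2) ^ s * ‖hat q ξ‖ ^ 2)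

end DNLS

end

open MeasureTheory Complex
open scoped SchwartzMap FourierTransform ENNReal ComplexConjugate InnerProductSpace

noncomputable section

/-! Put h = |iκ²| = |κ|². If iκ² = h, let Q = κq and R = κr; if iκ² = -h, exchanging the two
components leads to the same system with Q = κr and R = κq. Everything concerns (∂ + h)u₁ = Qu₂, (∂
- h)u₂ = Ru₁ with h > 0. In L² one has ‖Q‖² = ‖R‖² = h‖q‖², and the H^s norm dominates the L² norm
because its weight is at least 1. A small H^s norm therefore makes the potentials small relative to
h for every admissible κ at once (`Small`, `small_of_norm_sq`).

The system has a Jost solution e^{hx}(c, b) at -∞ with b → 1 (`jc`, `jb`) and a Jost solution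
e^{-hx}(b₊, c₊) at +∞ with b₊ → 1 (`rb`, `rs`). The Wronskian b b₊ - c c₊ is a constant a, the
inverse transmission coefficient (`ja`, `wronskian_eq`). Smallness keeps b, b₊ and a within 1/3 of
1, so they do not vanish and the principal logarithm applies to them. The Green's function is an
explicit combination of these functions (`greenFun`), with γ = 2cc₊/a and 2 + γ = 2bb₊/a on the
diagonal.

The central fact is A = sgn(iκ²) log a (`logDet_pos`, `logDet_neg`). Cyclicity replaces tr((ΛΓ)^m)
by tr(B^m) for B = (∂ + h)⁻¹Q(∂ - h)⁻¹R (`trace_sandwich_pow`, and `trace_birman_neg_pow` for the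
other sign). Now replace R by tR with 0 ≤ t ≤ 1. The series ∑ t^m tr(B^m)/m has t-derivative tr((1 -
tB)⁻¹B), which the Green's function evaluates as an integral of Jost solutions (`traceMul_inverse`).
That integral is minus the derivative of log a, and both sides vanish at t = 0
(`tsum_trace_birman`).

Derivatives of a come from one exact identity: the Wronskian of the left Jost solution at one
parameter and the right Jost solution at another has a derivative in x containing only differences
of the parameters (`ja_sub_ja`). Dividing by the increment and using norm continuity of the Jost
solutions gives `hasDerivWithinAt_ja`. This serves both the homotopy in t and the derivative in κ,
which is the second claim.

The first claim holds because conjugation and κ ↦ -κ̄ together exchange κq and κr, while a is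
conjugated with its potentials (`ja_conjS`). For the third, the density is, up to the sign of iκ²,
half the difference of the logarithmic derivatives of b and b₊; b runs from 1 to a and b₊ from a to
1, so the integral is log a (`integral_density`). -/

namespace DNLS

/-! ### Hilbert-Schmidt operators, trace class operators and the trace -/

section TraceTheory

open ContinuousLinearMap

variable {E : Type} [NormedAddCommGroup E] [InnerProductSpace ℂ E] [CompleteSpace E]

/-- The square of the Hilbert-Schmidt norm, possibly infinite. -/
def hsSq (T : E →L[ℂ] E) : ℝ≥0∞ := ∑' i, ‖T (onBasis E i)‖ₑ ^ 2

/-- The Hilbert-Schmidt norm of a Hilbert-Schmidt operator. -/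
def hsNorm (T : E →L[ℂ] E) : ℝ := √(hsSq T).toReal

lemma enorm_sq_eq_ofReal {F : Type*} [NormedAddCommGroup F] (x : F) :
    ‖x‖ₑ ^ 2 = ENNReal.ofReal (‖x‖ ^ 2) := by
  rw [← ofReal_norm, ENNReal.ofReal_pow (norm_nonneg _)]

lemma hasSum_norm_inner_sq {ι : Type} (b : HilbertBasis ι ℂ E) (x : E) :
    HasSum (fun i => ‖⟪b i, x⟫_ℂ‖ ^ 2) (‖x‖ ^ 2) := by
  have h := b.hasSum_inner_mul_inner x x
  apply Complex.hasSum_ofReal.1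
  convert! h using 1
  · funext i
    rw [← inner_conj_symm x (b i), Complex.conj_mul']
    push_cast
    rfl
  · rw [inner_self_eq_norm_sq_to_K]
    norm_cast

lemma enorm_sq_eq_tsum {ι : Type} (b : HilbertBasis ι ℂ E) (x : E) :
    ‖x‖ₑ ^ 2 = ∑' i, ‖⟪b i, x⟫_ℂ‖ₑ ^ 2 := by
  have h := hasSum_norm_inner_sq b x
  simp_rw [enorm_sq_eq_ofReal]
  rw [← h.tsum_eq, ENNReal.ofReal_tsum_of_nonneg (fun _ => by positivity) h.summable]

/-- Parseval in the second basis and Tonelli in `ℝ≥0∞`. Allowing two different bases yields both the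
invariance under adjoints and the independence of the basis. -/
lemma tsum_enorm_sq_adjoint {ι ι' : Type} (b : HilbertBasis ι ℂ E) (b' : HilbertBasis ι' ℂ E)
    (T : E →L[ℂ] E) : ∑' i, ‖T (b i)‖ₑ ^ 2 = ∑' j, ‖adjoint T (b' j)‖ₑ ^ 2 := by
  simp_rw [enorm_sq_eq_tsum b' (T _), enorm_sq_eq_tsum b (adjoint T _)]
  rw [ENNReal.tsum_comm]
  refine tsum_congr fun j => tsum_congr fun i => ?_
  rw [adjoint_inner_right, ← inner_conj_symm, ← ofReal_norm, ← ofReal_norm,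
    RCLike.norm_conj]

lemma hsSq_adjoint (T : E →L[ℂ] E) : hsSq (adjoint T) = hsSq T :=
  (tsum_enorm_sq_adjoint _ _ _).symm

lemma tsum_enorm_sq_eq_hsSq {ι : Type} (b : HilbertBasis ι ℂ E) (T : E →L[ℂ] E) :
    ∑' i, ‖T (b i)‖ₑ ^ 2 = hsSq T := by
  rw [tsum_enorm_sq_adjoint b (onBasis E), ← hsSq_adjoint]
  rfl

lemma isHilbertSchmidt_iff (T : E →L[ℂ] E) : IsHilbertSchmidt T ↔ hsSq T ≠ ∞ := by
  have key : ∀ {ι : Type} (b : HilbertBasis ι ℂ E),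
      (Summable fun i => ‖T (b i)‖ ^ 2) ↔ hsSq T ≠ ∞ := by
    intro ι b
    rw [← tsum_enorm_sq_eq_hsSq b T]
    simp_rw [enorm_sq_eq_ofReal]
    constructor
    · intro h
      exact h.tsum_ofReal_ne_top
    · intro h
      have := ENNReal.summable_toReal h
      refine this.congr fun i => ?_
      rw [ENNReal.toReal_ofReal (by positivity)]
  constructor
  · rintro ⟨ι, b, h⟩
    exact (key b).1 h
  · intro h
    exact ⟨_, onBasis E, (key _).2 h⟩

lemma IsHilbertSchmidt.adjoint {T : E →L[ℂ] E} (h : IsHilbertSchmidt T) :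
    IsHilbertSchmidt (adjoint T) := by
  rw [isHilbertSchmidt_iff, hsSq_adjoint]
  exact (isHilbertSchmidt_iff T).1 h

lemma IsHilbertSchmidt.hasSum {T : E →L[ℂ] E} (h : IsHilbertSchmidt T) :
    HasSum (fun i => ‖T (onBasis E i)‖ ^ 2) (hsNorm T ^ 2) := by
  have h' := (isHilbertSchmidt_iff T).1 h
  rw [hsNorm, Real.sq_sqrt ENNReal.toReal_nonneg, hsSq, ENNReal.tsum_toReal_eq]
  · have hs := ENNReal.summable_toReal h'
    have h3 := hs.hasSum
    simpa using h3
  · intro i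
    simp

lemma hsNorm_nonneg (T : E →L[ℂ] E) : 0 ≤ hsNorm T := Real.sqrt_nonneg _

lemma hsNorm_adjoint (T : E →L[ℂ] E) : hsNorm (ContinuousLinearMap.adjoint T) = hsNorm T := by
  simp only [hsNorm, hsSq_adjoint]

lemma hsNorm_sq (T : E →L[ℂ] E) : hsNorm T ^ 2 = (hsSq T).toReal := by
  rw [hsNorm, Real.sq_sqrt ENNReal.toReal_nonneg]

lemma IsHilbertSchmidt.norm_le {T : E →L[ℂ] E} (h : IsHilbertSchmidt T) : ‖T‖ ≤ hsNorm T := by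
  refine T.opNorm_le_bound (hsNorm_nonneg _) fun x => ?_
  have h1 := hasSum_norm_inner_sq (onBasis E) (T x)
  have h2 := h.adjoint.hasSum.mul_right (‖x‖ ^ 2)
  rw [hsNorm_adjoint] at h2
  have : ‖T x‖ ^ 2 ≤ hsNorm T ^ 2 * ‖x‖ ^ 2 := by
    refine hasSum_le (fun i => ?_) h1 h2
    rw [← mul_pow, ← adjoint_inner_left]
    gcongr
    exact norm_inner_le_norm _ _
  rw [← mul_pow] at this
  exact le_of_sq_le_sq this (mul_nonneg (hsNorm_nonneg _) (norm_nonneg _))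

lemma hsSq_comp_left_le (X T : E →L[ℂ] E) : hsSq (X ∘L T) ≤ ‖X‖ₑ ^ 2 * hsSq T := by
  rw [hsSq, hsSq, ← ENNReal.tsum_mul_left]
  refine ENNReal.tsum_le_tsum fun i => ?_
  rw [← mul_pow]
  gcongr
  exact X.le_opENorm _

lemma hsSq_comp_right_le (T X : E →L[ℂ] E) : hsSq (T ∘L X) ≤ ‖X‖ₑ ^ 2 * hsSq T := by
  rw [← hsSq_adjoint, adjoint_comp, ← hsSq_adjoint T]
  refine (hsSq_comp_left_le _ _).trans_eq ?_
  rw [← ofReal_norm, LinearIsometryEquiv.norm_map, ofReal_norm]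

lemma IsHilbertSchmidt.comp_left {T : E →L[ℂ] E} (h : IsHilbertSchmidt T) (X : E →L[ℂ] E) :
    IsHilbertSchmidt (X ∘L T) := by
  rw [isHilbertSchmidt_iff] at h ⊢
  exact ne_top_of_le_ne_top (ENNReal.mul_ne_top (by simp) h) (hsSq_comp_left_le X T)

lemma IsHilbertSchmidt.comp_right {T : E →L[ℂ] E} (h : IsHilbertSchmidt T) (X : E →L[ℂ] E) :
    IsHilbertSchmidt (T ∘L X) := by
  rw [isHilbertSchmidt_iff] at h ⊢
  exact ne_top_of_le_ne_top (ENNReal.mul_ne_top (by simp) h) (hsSq_comp_right_le T X)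

lemma IsHilbertSchmidt.hsNorm_comp_left_le {T : E →L[ℂ] E} (h : IsHilbertSchmidt T)
    (X : E →L[ℂ] E) : hsNorm (X ∘L T) ≤ ‖X‖ * hsNorm T := by
  rw [isHilbertSchmidt_iff] at h
  rw [hsNorm, hsNorm, ← Real.sqrt_sq (norm_nonneg X), ← Real.sqrt_mul (by positivity)]
  gcongr
  have := ENNReal.toReal_mono (ENNReal.mul_ne_top (by simp) h) (hsSq_comp_left_le X T)
  simpa using this

lemma IsTraceClass.comp_left {T : E →L[ℂ] E} (h : IsTraceClass T) (X : E →L[ℂ] E) :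
    IsTraceClass (X ∘L T) := by
  obtain ⟨A, B, hA, hB, rfl⟩ := h
  exact ⟨X ∘L A, B, hA.comp_left X, hB, rfl⟩

lemma IsTraceClass.comp_right {T : E →L[ℂ] E} (h : IsTraceClass T) (X : E →L[ℂ] E) :
    IsTraceClass (T ∘L X) := by
  obtain ⟨A, B, hA, hB, rfl⟩ := h
  exact ⟨A, B ∘L X, hA, hB.comp_right X, rfl⟩

lemma summable_mul_norm {A B : E →L[ℂ] E} (hA : IsHilbertSchmidt A) (hB : IsHilbertSchmidt B) :
    Summable fun i => ‖A (onBasis E i)‖ * ‖B (onBasis E i)‖ := by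
  refine Summable.of_nonneg_of_le (fun i => by positivity) (fun i => ?_)
    (hA.hasSum.summable.add hB.hasSum.summable)
  nlinarith [sq_nonneg (‖A (onBasis E i)‖ - ‖B (onBasis E i)‖),
    sq_nonneg (‖A (onBasis E i)‖ + ‖B (onBasis E i)‖)]

lemma tsum_mul_norm_le {A B : E →L[ℂ] E} (hA : IsHilbertSchmidt A) (hB : IsHilbertSchmidt B) :
    ∑' i, ‖A (onBasis E i)‖ * ‖B (onBasis E i)‖ ≤ hsNorm A * hsNorm B := by
  have h := Real.inner_le_Lp_mul_Lq_tsum_of_nonneg (f := fun i => ‖A (onBasis E i)‖)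
    (g := fun i => ‖B (onBasis E i)‖) (p := 2) (q := 2) Real.HolderConjugate.two_two
    (fun _ => norm_nonneg _) (fun _ => norm_nonneg _)
    (by simpa using hA.hasSum.summable) (by simpa using hB.hasSum.summable)
  simp only [Real.rpow_two, hA.hasSum.tsum_eq, hB.hasSum.tsum_eq, ← Real.sqrt_eq_rpow,
    Real.sqrt_sq (hsNorm_nonneg _)] at h
  exact h

lemma norm_inner_comp_le (A B : E →L[ℂ] E) (x : E) :
    ‖⟪x, (A ∘L B) x⟫_ℂ‖ ≤ ‖adjoint A x‖ * ‖B x‖ := by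
  rw [comp_apply, ← adjoint_inner_left]
  exact norm_inner_le_norm _ _

lemma IsTraceClass.summable_norm {T : E →L[ℂ] E} (h : IsTraceClass T) :
    Summable fun i => ‖⟪onBasis E i, T (onBasis E i)⟫_ℂ‖ := by
  obtain ⟨A, B, hA, hB, rfl⟩ := h
  exact Summable.of_nonneg_of_le (fun i => norm_nonneg _) (fun i => norm_inner_comp_le A B _)
    (summable_mul_norm hA.adjoint hB)

lemma norm_trace_comp_le {A B : E →L[ℂ] E} (hA : IsHilbertSchmidt A) (hB : IsHilbertSchmidt B) :
    ‖trace (A ∘L B)‖ ≤ hsNorm A * hsNorm B := by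
  have hs := IsTraceClass.summable_norm ⟨A, B, hA, hB, rfl⟩
  refine (norm_tsum_le_tsum_norm hs).trans ?_
  refine (hs.tsum_le_tsum (fun i => norm_inner_comp_le A B _)
    (summable_mul_norm hA.adjoint hB)).trans ?_
  rw [← hsNorm_adjoint A]
  exact tsum_mul_norm_le hA.adjoint hB

lemma trace_add {S T : E →L[ℂ] E} (hS : IsTraceClass S) (hT : IsTraceClass T) :
    trace (S + T) = trace S + trace T := by
  rw [trace, trace, trace, ← hS.summable_norm.of_norm.tsum_add hT.summable_norm.of_norm]
  simp

lemma trace_smul (c : ℂ) (T : E →L[ℂ] E) : trace (c • T) = c * trace T := by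
  rw [trace, trace, ← tsum_mul_left]
  simp

lemma summable_inner_sq {A : E →L[ℂ] E} (hA : IsHilbertSchmidt A) :
    Summable fun p : basisSet E × basisSet E => ‖⟪onBasis E p.1, A (onBasis E p.2)⟫_ℂ‖ ^ 2 := by
  rw [← (Equiv.prodComm _ _).summable_iff]
  refine (summable_prod_of_nonneg fun _ => sq_nonneg _).2 ⟨fun j => ?_, ?_⟩
  · exact (hasSum_norm_inner_sq (onBasis E) (A (onBasis E j))).summable
  · refine hA.hasSum.summable.congr fun j => ?_
    exact (hasSum_norm_inner_sq (onBasis E) (A (onBasis E j))).tsum_eq.symm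

/-- The matrix entries of A and B are square summable families, so the double sum of their products
converges absolutely and the order of summation may be exchanged. -/
lemma trace_comp_comm {A B : E →L[ℂ] E} (hA : IsHilbertSchmidt A) (hB : IsHilbertSchmidt B) :
    trace (A ∘L B) = trace (B ∘L A) := by
  set b := onBasis E with hb
  let F : basisSet E → basisSet E → ℂ := fun i j => ⟪b i, A (b j)⟫_ℂ * ⟪b j, B (b i)⟫_ℂ
  have h1 : ∀ i, HasSum (F i) ⟪b i, (A ∘L B) (b i)⟫_ℂ := by
    intro i
    have := b.hasSum_inner_mul_inner (adjoint A (b i)) (B (b i))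
    simp only [adjoint_inner_left] at this
    exact this
  have h2 : ∀ j, HasSum (fun i => F i j) ⟪b j, (B ∘L A) (b j)⟫_ℂ := by
    intro j
    have := b.hasSum_inner_mul_inner (adjoint B (b j)) (A (b j))
    simp only [adjoint_inner_left] at this
    simp only [mul_comm ⟪b j, B _⟫_ℂ] at this
    exact this
  have hs : Summable (Function.uncurry F) := by
    refine Summable.of_norm (Summable.of_nonneg_of_le (fun _ => norm_nonneg _) (fun p => ?_)
      ((summable_inner_sq hA).add ((Equiv.prodComm _ _).summable_iff.2 (summable_inner_sq hB))))
    simp only [Function.uncurry, F, norm_mul, Function.comp, Equiv.prodComm_apply, Prod.fst_swap,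
      Prod.snd_swap]
    nlinarith [sq_nonneg (‖⟪b p.1, A (b p.2)⟫_ℂ‖ - ‖⟪b p.2, B (b p.1)⟫_ℂ‖),
      sq_nonneg (‖⟪b p.1, A (b p.2)⟫_ℂ‖ + ‖⟪b p.2, B (b p.1)⟫_ℂ‖)]
  rw [trace, trace, ← tsum_congr fun i => (h1 i).tsum_eq, ← tsum_congr fun j => (h2 j).tsum_eq]
  exact hs.tsum_comm.symm

/-- Only Hilbert-Schmidt factors of T are moved, so boundedness of X is enough. -/
lemma IsTraceClass.trace_comm {T : E →L[ℂ] E} (h : IsTraceClass T) (X : E →L[ℂ] E) :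
    trace (T ∘L X) = trace (X ∘L T) := by
  obtain ⟨A, B, hA, hB, rfl⟩ := h
  calc trace ((A ∘L B) ∘L X) = trace ((B ∘L X) ∘L A) := trace_comp_comm hA (hB.comp_right X)
    _ = trace ((X ∘L A) ∘L B) := trace_comp_comm hB (hA.comp_left X)

/-- Strong convergence of bounded operators implies convergence of traces. -/
lemma IsTraceClass.tendsto_trace_comp {T : E →L[ℂ] E} (h : IsTraceClass T)
    (P : ℕ → E →L[ℂ] E) (hP : ∀ n, ‖P n‖ ≤ 1)
    (hlim : ∀ x, Filter.Tendsto (fun n => P n x) Filter.atTop (nhds x)) :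
    Filter.Tendsto (fun n => trace (T ∘L P n)) Filter.atTop (nhds (trace T)) := by
  obtain ⟨A, B, hA, hB, rfl⟩ := h
  -- Cyclicity puts P n between B and A. Each diagonal entry is then bounded by ‖B* eᵢ‖ ‖A eᵢ‖
  -- uniformly in n, which is what dominated convergence needs.
  have h1 : ∀ n, trace ((A ∘L B) ∘L P n) = trace (B ∘L (P n ∘L A)) := fun n =>
    trace_comp_comm hA (hB.comp_right (P n))
  rw [trace_comp_comm hA hB]
  simp_rw [h1]
  refine tendsto_tsum_of_dominated_convergence (summable_mul_norm hB.adjoint hA) (fun i => ?_) ?_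
  · have hc : Continuous fun x => ⟪onBasis E i, B x⟫_ℂ := by fun_prop
    exact (hc.tendsto _).comp (hlim _)
  · refine .of_forall fun n i => (norm_inner_comp_le _ _ _).trans ?_
    gcongr
    refine ((P n).le_opNorm _).trans ?_
    exact mul_le_of_le_one_left (norm_nonneg _) (hP n)

end TraceTheory

/-! ### Multiplication operators, Fourier multipliers and frequency cutoffs -/

section FourierMultipliers

open ContinuousLinearMap

lemma coeFn_mulOp {f : ℝ → ℂ} (hf : MemLp f ∞ (volume : Measure ℝ)) (g : L2) :
    mulOp f g =ᵐ[volume] fun x => f x * g x := by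
  rw [mulOp, dif_pos hf]
  have h1 := (ContinuousLinearMap.mul ℂ ℂ).coeFn_holder (r := 2) (hf.toLp f) g
  filter_upwards [h1, hf.coeFn_toLp] with x hx hx2
  refine hx.trans ?_
  simp [hx2]

lemma mulOp_comp {f g : ℝ → ℂ} (hf : MemLp f ∞ (volume : Measure ℝ))
    (hg : MemLp g ∞ (volume : Measure ℝ)) (hfg : MemLp (fun x => f x * g x) ∞ volume) :
    mulOp f ∘L mulOp g = mulOp fun x => f x * g x := by
  ext1 u
  apply Lp.ext
  rw [comp_apply]
  filter_upwards [coeFn_mulOp hf (mulOp g u), coeFn_mulOp hg u, coeFn_mulOp hfg u]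
    with x h1 h2 h3
  rw [h1, h2, h3, mul_assoc]

lemma mulOp_adjoint {f : ℝ → ℂ} (hf : MemLp f ∞ (volume : Measure ℝ)) :
    adjoint (mulOp f) = mulOp fun x => conj (f x) := by
  have hf' : MemLp (fun x => conj (f x)) ∞ (volume : Measure ℝ) := hf.star
  symm
  rw [ContinuousLinearMap.eq_adjoint_iff]
  intro u v
  rw [L2.inner_def, L2.inner_def]
  refine integral_congr_ae ?_
  filter_upwards [coeFn_mulOp hf' u, coeFn_mulOp hf v] with x h1 h2
  rw [h1, h2]
  simp only [RCLike.inner_apply, map_mul, conj_conj]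
  ring

lemma norm_mulOp_le {f : ℝ → ℂ} {C : ℝ} (hC : 0 ≤ C)
    (hf : AEStronglyMeasurable f (volume : Measure ℝ)) (h : ∀ x, ‖f x‖ ≤ C) : ‖mulOp f‖ ≤ C := by
  refine opNorm_le_bound _ hC fun u => ?_
  refine Lp.norm_le_mul_norm_of_ae_le_mul ?_
  filter_upwards [coeFn_mulOp (memLp_top_of_bound hf C (.of_forall h)) u] with x hx
  rw [hx, norm_mul]
  gcongr
  exact h x

/-- Bounded measurable symbols. -/
def BddSymbol (m : ℝ → ℂ) : Prop := Measurable m ∧ ∃ C, ∀ ξ, ‖m ξ‖ ≤ C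

lemma BddSymbol.memLp {m : ℝ → ℂ} (hm : BddSymbol m) :
    MemLp (fun η => m (2 * Real.pi * η)) ∞ (volume : Measure ℝ) := by
  obtain ⟨h1, C, hC⟩ := hm
  exact memLp_top_of_bound (h1.comp (by fun_prop)).aestronglyMeasurable C (.of_forall fun _ => hC _)

lemma BddSymbol.mul {m n : ℝ → ℂ} (hm : BddSymbol m) (hn : BddSymbol n) :
    BddSymbol fun ξ => m ξ * n ξ := by
  obtain ⟨h1, C, hC⟩ := hm
  obtain ⟨h2, D, hD⟩ := hn
  refine ⟨h1.mul h2, C * D, fun ξ => ?_⟩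
  rw [norm_mul]
  exact mul_le_mul (hC ξ) (hD ξ) (norm_nonneg _) ((norm_nonneg _).trans (hC ξ))

lemma BddSymbol.conj {m : ℝ → ℂ} (hm : BddSymbol m) : BddSymbol fun ξ => conj (m ξ) := by
  obtain ⟨h1, C, hC⟩ := hm
  exact ⟨Complex.continuous_conj.measurable.comp h1, C, fun ξ => by simpa using hC ξ⟩

lemma fourierMult_apply (m : ℝ → ℂ) (f : L2) :
    fourierMult m f = 𝓕⁻ (mulOp (fun η => m (2 * Real.pi * η)) (𝓕 f)) := rfl

lemma fourier_fourierMult (m : ℝ → ℂ) (f : L2) :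
    𝓕 (fourierMult m f) = mulOp (fun η => m (2 * Real.pi * η)) (𝓕 f) := by
  rw [fourierMult_apply, FourierTransform.fourier_fourierInv_eq]

lemma fourierMult_comp {m n : ℝ → ℂ} (hm : BddSymbol m) (hn : BddSymbol n) :
    fourierMult m ∘L fourierMult n = fourierMult fun ξ => m ξ * n ξ := by
  ext1 f
  rw [comp_apply, fourierMult_apply m, fourier_fourierMult, fourierMult_apply, ← comp_apply,
    mulOp_comp hm.memLp hn.memLp (hm.mul hn).memLp]

lemma fourierMult_adjoint {m : ℝ → ℂ} (hm : BddSymbol m) :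
    adjoint (fourierMult m) = fourierMult fun ξ => conj (m ξ) := by
  symm
  rw [ContinuousLinearMap.eq_adjoint_iff]
  intro u v
  rw [← Lp.inner_fourier_eq, ← Lp.inner_fourier_eq u, fourier_fourierMult, fourier_fourierMult,
    ← mulOp_adjoint hm.memLp, adjoint_inner_left]

lemma norm_fourierMult_le {m : ℝ → ℂ} {C : ℝ} (hC : 0 ≤ C) (hm : Measurable m)
    (h : ∀ ξ, ‖m ξ‖ ≤ C) : ‖fourierMult m‖ ≤ C := by
  refine opNorm_le_bound _ hC fun u => ?_
  rw [← Lp.norm_fourier_eq, fourier_fourierMult, ← Lp.norm_fourier_eq u]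
  refine (le_opNorm _ _).trans ?_
  gcongr
  exact norm_mulOp_le hC (hm.comp (by fun_prop)).aestronglyMeasurable fun _ => h _

/-- The frequency cutoff to `[-n, n]`. -/
def cutoff (n : ℕ) : L2 →L[ℂ] L2 := fourierMult ((Set.Icc (-n : ℝ) n).indicator 1)

lemma bddSymbol_indicator (n : ℕ) : BddSymbol ((Set.Icc (-n : ℝ) n).indicator 1) := by
  refine ⟨measurable_one.indicator measurableSet_Icc, 1, fun ξ => ?_⟩
  refine (norm_indicator_le_norm_self _ _).trans ?_
  simp

lemma norm_cutoff_le (n : ℕ) : ‖cutoff n‖ ≤ 1 := by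
  refine norm_fourierMult_le zero_le_one (bddSymbol_indicator n).1 fun ξ => ?_
  refine (norm_indicator_le_norm_self _ _).trans ?_
  simp

/-- By Plancherel it suffices to argue on the Fourier side, where the cutoff functions are
eventually 1 at each frequency and dominated convergence applies. -/
lemma tendsto_cutoff (f : L2) :
    Filter.Tendsto (fun n => cutoff n f) Filter.atTop (nhds f) := by
  suffices h : Filter.Tendsto (fun n => (𝓕 (cutoff n f) : L2)) Filter.atTop (nhds (𝓕 f)) by
    have h2 := ((Lp.fourierTransformₗᵢ ℝ ℂ).symm.continuous.tendsto _).comp h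
    have h3 : ∀ g : L2, (Lp.fourierTransformₗᵢ ℝ ℂ).symm (𝓕 g) = g :=
      fun g => (Lp.fourierTransformₗᵢ ℝ ℂ).symm_apply_apply g
    simpa only [Function.comp_def, h3] using h2
  set g : L2 := 𝓕 f with hg
  let χ : ℕ → ℝ → ℂ := fun n η => (Set.Icc (-n : ℝ) n).indicator 1 (2 * Real.pi * η)
  have hχ : ∀ n, (𝓕 (cutoff n f) : L2) =ᵐ[volume] fun η => χ n η * g η := fun n => by
    rw [cutoff, fourier_fourierMult]
    exact coeFn_mulOp (bddSymbol_indicator n).memLp _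
  rw [Lp.tendsto_Lp_iff_tendsto_eLpNorm']
  have h1 : ∀ n, eLpNorm (⇑(𝓕 (cutoff n f) : L2) - ⇑g) 2 volume
      = (∫⁻ η, ‖χ n η * g η - g η‖ₑ ^ (2 : ℝ)) ^ (1 / 2 : ℝ) := fun n => by
    rw [eLpNorm_congr_ae ((hχ n).sub .rfl), eLpNorm_eq_lintegral_rpow_enorm_toReal two_ne_zero (by simp)]
    simp
  simp_rw [h1]
  have h2 : Filter.Tendsto (fun n => ∫⁻ η, ‖χ n η * g η - g η‖ₑ ^ (2 : ℝ)) Filter.atTop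
      (nhds (∫⁻ _ : ℝ, 0)) := by
    have hgm := (Lp.memLp g).1
    refine tendsto_lintegral_of_dominated_convergence' (fun η => ‖g η‖ₑ ^ (2 : ℝ)) (fun n => ?_)
      (fun n => .of_forall fun η => ?_) ?_ (.of_forall fun η => ?_)
    · refine AEMeasurable.pow_const ?_ _
      refine AEStronglyMeasurable.enorm (AEStronglyMeasurable.sub (AEStronglyMeasurable.mul ?_ hgm) hgm)
      exact ((bddSymbol_indicator n).1.comp (by fun_prop)).aestronglyMeasurable
    · dsimp only
      gcongr
      by_cases h : 2 * Real.pi * η ∈ Set.Icc (-n : ℝ) n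
      · simp [χ, Set.indicator_of_mem h]
      · simp [χ, Set.indicator_of_notMem h]
    · exact (lintegral_rpow_enorm_lt_top_of_eLpNorm_lt_top two_ne_zero (by simp)
        (Lp.memLp g).2).ne
    · refine tendsto_const_nhds.congr' ?_
      obtain ⟨N, hN⟩ := exists_nat_ge |2 * Real.pi * η|
      filter_upwards [Filter.eventually_ge_atTop N] with n hn
      have h : 2 * Real.pi * η ∈ Set.Icc (-n : ℝ) n :=
        abs_le.1 (hN.trans (by exact_mod_cast hn))
      simp [χ, Set.indicator_of_mem h]
  rw [lintegral_zero] at h2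
  have h3 := (ENNReal.continuous_rpow_const (y := (1 / 2 : ℝ))).tendsto 0
  rw [ENNReal.zero_rpow_of_pos (by norm_num)] at h3
  exact h3.comp h2

end FourierMultipliers

/-! ### The resolvent (∂ + z)⁻¹ on Schwartz functions -/

section Resolvent

/-- `(∂ + z)⁻¹` for real nonzero `z`. -/
def resolv (z : ℝ) : L2 →L[ℂ] L2 := fourierMult fun ξ => (I * ξ + z)⁻¹

lemma symbol_ne_zero {z : ℝ} (hz : z ≠ 0) (ξ : ℝ) : I * (ξ : ℂ) + z ≠ 0 := by
  intro h
  apply hz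
  simpa using congrArg Complex.re h

lemma symbol_norm_ge (z ξ : ℝ) : |z| ≤ ‖I * (ξ : ℂ) + z‖ := by
  have := Complex.abs_re_le_norm (I * (ξ : ℂ) + z)
  simpa using this

lemma bddSymbol_inv {z : ℝ} (hz : z ≠ 0) : BddSymbol fun ξ : ℝ => (I * (ξ : ℂ) + z)⁻¹ := by
  refine ⟨by fun_prop, |z|⁻¹, fun ξ => ?_⟩
  rw [norm_inv]
  exact inv_anti₀ (abs_pos.2 hz) (symbol_norm_ge z ξ)

/-- The symbol is (z - iξ)/z² times (1 + (ξ/z)²)⁻¹, a polynomial times a power of a Japanese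
bracket. -/
lemma hasTemperateGrowth_inv {z : ℝ} (hz : z ≠ 0) :
    (fun η : ℝ => (I * ((2 * Real.pi * η : ℝ) : ℂ) + z)⁻¹).HasTemperateGrowth := by
  have h1 : (fun η : ℝ => (((1 + ‖2 * Real.pi / z * η‖ ^ 2) ^ (-1 : ℝ) : ℝ) : ℂ)).HasTemperateGrowth := by
    have h := Function.hasTemperateGrowth_one_add_norm_sq_rpow ℝ (-1)
    have h2 : (fun η : ℝ => 2 * Real.pi / z * η).HasTemperateGrowth := by fun_prop
    exact Function.HasTemperateGrowth.comp (Function.Complex.hasTemperateGrowth_ofReal) (h.comp h2)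
  have h3 : (fun η : ℝ => ((z : ℂ) - I * ((2 * Real.pi * η : ℝ) : ℂ)) / z ^ 2).HasTemperateGrowth := by
    simp only [div_eq_mul_inv]
    refine Function.HasTemperateGrowth.mul (Function.HasTemperateGrowth.sub (.const _)
      (Function.HasTemperateGrowth.mul (.const _) ?_)) (.const _)
    exact Function.HasTemperateGrowth.comp (Function.Complex.hasTemperateGrowth_ofReal)
      (f := fun η : ℝ => 2 * Real.pi * η) (by fun_prop)
  convert! h1.mul h3 using 1
  funext η
  have hz' : (z : ℂ) ≠ 0 := by exact_mod_cast hz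
  have h4 : (1 + (2 * Real.pi / z * η) ^ 2 : ℂ) ≠ 0 := by
    norm_cast
    positivity
  have h5 := symbol_ne_zero hz (2 * Real.pi * η)
  simp only [Pi.mul_apply, Real.norm_eq_abs, sq_abs, Real.rpow_neg_one]
  refine inv_eq_of_mul_eq_one_right ?_
  push_cast
  have h6 : (z : ℂ) ^ 2 + (2 * Real.pi * η) ^ 2 ≠ 0 := by
    intro h0
    apply h4
    field_simp
    linear_combination h0
  have h7 : (1 + (2 * Real.pi / z * η) ^ 2 : ℂ) = (z ^ 2 + (2 * Real.pi * η) ^ 2) / z ^ 2 := by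
    field_simp
  rw [h7]
  generalize hD : (z : ℂ) ^ 2 + (2 * Real.pi * η) ^ 2 = D at *
  field_simp
  linear_combination hD - (2 * Real.pi * η : ℂ) ^ 2 * I_sq

/-- On Schwartz data the L² multiplier is a classical solution operator, since the symbol preserves
the Schwartz class. Pointwise arguments are made there and extended to L² by density. -/
lemma exists_schwartz_resolv {z : ℝ} (hz : z ≠ 0) (g : 𝓢(ℝ, ℂ)) :
    ∃ v : 𝓢(ℝ, ℂ), (∀ x, deriv v x + z * v x = g x) ∧ resolv z (g.toLp 2) = v.toLp 2 := by
  set m : ℝ → ℂ := fun η : ℝ => (I * ((2 * Real.pi * η : ℝ) : ℂ) + z)⁻¹ with hm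
  have hmt : m.HasTemperateGrowth := hasTemperateGrowth_inv hz
  refine ⟨𝓕⁻ (SchwartzMap.smulLeftCLM ℂ m (𝓕 g)), ?_, ?_⟩
  · set v := 𝓕⁻ (SchwartzMap.smulLeftCLM ℂ m (𝓕 g)) with hv
    have hFv : 𝓕 v = SchwartzMap.smulLeftCLM ℂ m (𝓕 g) := by
      rw [hv, FourierTransform.fourier_fourierInv_eq]
    have key : SchwartzMap.derivCLM ℂ ℂ v + (z : ℂ) • v = g := by
      have hinj : Function.Injective (𝓕 : 𝓢(ℝ, ℂ) → 𝓢(ℝ, ℂ)) := fun a b hab => by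
        rw [← FourierTransform.fourierInv_fourier_eq (F := 𝓢(ℝ, ℂ)) a, hab,
          FourierTransform.fourierInv_fourier_eq]
      apply hinj
      ext x
      have hd : 𝓕 (SchwartzMap.derivCLM ℂ ℂ v) x = (2 * Real.pi * I * x) • 𝓕 v x := by
        have := Real.fourier_deriv v.integrable v.differentiable
          (SchwartzMap.derivCLM ℂ ℂ v).integrable
        exact congrFun this x
      rw [FourierTransform.fourier_add, FourierTransform.fourier_smul, add_apply,
        smul_apply, hd, hFv, SchwartzMap.smulLeftCLM_apply_apply hmt]
      have h5 := symbol_ne_zero hz (2 * Real.pi * x)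
      simp only [hm, smul_eq_mul]
      push_cast at h5 ⊢
      linear_combination 𝓕 g x * inv_mul_cancel₀ h5
    intro x
    have := congrArg (fun f : 𝓢(ℝ, ℂ) => f x) key
    simpa using this
  · rw [resolv, fourierMult_apply, SchwartzMap.toLp_fourier_eq, ← SchwartzMap.toLp_fourierInv_eq]
    congr 1
    apply Lp.ext
    filter_upwards [coeFn_mulOp (bddSymbol_inv hz).memLp ((𝓕 g).toLp 2), (𝓕 g).coeFn_toLp 2,
      (SchwartzMap.smulLeftCLM ℂ m (𝓕 g)).coeFn_toLp 2] with x h1 h2 h3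
    rw [h1, h2, h3, SchwartzMap.smulLeftCLM_apply_apply hmt]
    rfl

end Resolvent

/-! ### The exponential kernel -/

section ExponentialKernel

open Set Filter

/-- The kernel `1_{y < x} e^{-h(x - y)}` of `(∂ + h)⁻¹` for `h > 0`. -/
def expKer (h x y : ℝ) : ℂ := step x y * (Real.exp (-(h * (x - y))) : ℂ)

lemma step_eq_zero {x y : ℝ} (h : x < y) : step x y = 0 := by
  simp [step, h.not_gt, h.ne']

lemma step_eq_one {x y : ℝ} (h : y < x) : step x y = 1 := by
  simp [step, h]

lemma measurable_step : Measurable fun p : ℝ × ℝ => step p.1 p.2 := by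
  unfold step
  refine Measurable.ite (measurableSet_lt measurable_snd measurable_fst) measurable_const ?_
  exact Measurable.ite (measurableSet_eq_fun measurable_snd measurable_fst) measurable_const
    measurable_const

lemma measurable_expKer (h : ℝ) : Measurable fun p : ℝ × ℝ => expKer h p.1 p.2 := by
  unfold expKer
  exact measurable_step.mul (by fun_prop)

lemma norm_expKer_le (h x y : ℝ) : ‖expKer h x y‖ ≤ Real.exp (-(h * |x - y|)) := by
  rcases lt_trichotomy x y with hxy | rfl | hxy
  · simp [expKer, step_eq_zero hxy, Real.exp_nonneg]
  · simp [expKer, step]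
    norm_num
  · rw [expKer, step_eq_one hxy, one_mul, Complex.norm_real, Real.norm_of_nonneg (Real.exp_nonneg _),
      abs_of_pos (sub_pos.2 hxy)]

lemma expKer_eq_of_lt {h x y : ℝ} (hxy : y < x) :
    expKer h x y = (Real.exp (-(h * (x - y))) : ℂ) := by
  rw [expKer, step_eq_one hxy, one_mul]

lemma expKer_eq_zero {h x y : ℝ} (hxy : x < y) : expKer h x y = 0 := by
  rw [expKer, step_eq_zero hxy, zero_mul]

lemma integral_expKer_mul (h x : ℝ) (g : ℝ → ℂ) :
    ∫ y, expKer h x y * g y = ∫ y in Iic x, (Real.exp (-(h * (x - y))) : ℂ) * g y := by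
  rw [integral_Iic_eq_integral_Iio, ← integral_indicator measurableSet_Iio]
  refine integral_congr_ae ?_
  filter_upwards [compl_mem_ae_iff.2 (measure_singleton x)] with y hy
  rcases lt_or_gt_of_ne hy with hlt | hgt
  · rw [indicator_of_mem (mem_Iio.2 hlt), expKer_eq_of_lt hlt]
  · rw [indicator_of_notMem (by simpa using hgt.le), expKer_eq_zero hgt, zero_mul]

lemma integrable_exp_neg_abs {c : ℝ} (hc : 0 < c) (x : ℝ) :
    Integrable fun y : ℝ => Real.exp (-(c * |x - y|)) := by
  have h0 : Integrable fun y : ℝ => Real.exp (-(c * |y|)) := by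
    rw [← integrableOn_univ, ← Iic_union_Ioi (a := (0 : ℝ)), integrableOn_union]
    constructor
    · refine (integrableOn_exp_mul_Iic hc 0).congr_fun (fun y hy => ?_) measurableSet_Iic
      rw [abs_of_nonpos hy]
      ring_nf
    · refine (integrableOn_exp_mul_Ioi (neg_lt_zero.2 hc) 0).congr_fun (fun y hy => ?_)
        measurableSet_Ioi
      rw [abs_of_pos hy]
      ring_nf
  have := h0.comp_sub_left x
  simpa using this

lemma integral_exp_neg_abs {c : ℝ} (hc : 0 < c) (x : ℝ) :
    ∫ y : ℝ, Real.exp (-(c * |x - y|)) = 2 / c := by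
  rw [integral_sub_left_eq_self (fun y => Real.exp (-(c * |y|))) volume x,
    integral_comp_abs (f := fun y => Real.exp (-(c * y)))]
  have := integral_exp_mul_Ioi (neg_lt_zero.2 hc) 0
  simp only [neg_mul] at this
  rw [this]
  simp
  ring

lemma memLp_expBound {h : ℝ} (hh : 0 < h) (x : ℝ) :
    MemLp (fun y : ℝ => Real.exp (-(h * |x - y|))) 2 := by
  rw [memLp_two_iff_integrable_sq (by fun_prop : Continuous _).aestronglyMeasurable]
  refine (integrable_exp_neg_abs (mul_pos two_pos hh) x).congr (.of_forall fun y => ?_)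
  simp only [← Real.exp_nat_mul]
  push_cast
  ring_nf

lemma memLp_expKer {h : ℝ} (hh : 0 < h) (x : ℝ) : MemLp (expKer h x) 2 :=
  (memLp_expBound hh x).mono ((measurable_expKer h).comp measurable_prodMk_left).aestronglyMeasurable
    (.of_forall fun y => by
      rw [Real.norm_of_nonneg (Real.exp_nonneg _)]
      exact norm_expKer_le h x y)

lemma memLp_expKer_flip {h : ℝ} (hh : 0 < h) (x : ℝ) : MemLp (fun y => expKer h y x) 2 :=
  (memLp_expBound hh x).mono ((measurable_expKer h).comp measurable_prodMk_right).aestronglyMeasurable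
    (.of_forall fun y => by
      rw [Real.norm_of_nonneg (Real.exp_nonneg _), abs_sub_comm]
      exact norm_expKer_le h y x)

lemma integral_norm_expKer_flip_sq {h : ℝ} (hh : 0 < h) (y : ℝ) :
    ∫ x, ‖expKer h x y‖ ^ 2 = 1 / (2 * h) := by
  have h1 : ∀ x, x ≠ y → ‖expKer h x y‖ ^ 2
      = (Ioi y).indicator (fun x => Real.exp (2 * h * y) * Real.exp (-(2 * h) * x)) x := by
    intro x hx
    rcases lt_or_gt_of_ne hx with hlt | hgt
    · rw [indicator_of_notMem (by simpa using hlt.le), expKer_eq_zero hlt]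
      simp
    · rw [indicator_of_mem (mem_Ioi.2 hgt), expKer_eq_of_lt hgt, Complex.norm_real,
        Real.norm_of_nonneg (Real.exp_nonneg _), ← Real.exp_nat_mul, ← Real.exp_add]
      congr 1
      push_cast
      ring
  have h2 : (fun x => ‖expKer h x y‖ ^ 2) =ᵐ[volume]
      (Ioi y).indicator (fun x => Real.exp (2 * h * y) * Real.exp (-(2 * h) * x)) := by
    filter_upwards [compl_mem_ae_iff.2 (measure_singleton y)] with x hx using h1 x hx
  rw [integral_congr_ae h2, integral_indicator measurableSet_Ioi, integral_const_mul,
    integral_exp_mul_Ioi (by linarith)]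
  have : Real.exp (2 * h * y) * Real.exp (-(2 * h) * y) = 1 := by
    rw [← Real.exp_add]
    simp
  rw [neg_div_neg_eq, ← mul_div_assoc, this]

end ExponentialKernel

/-! ### Bilinear pairings with L² functions and extension by density -/

section Pairing

open Filter

lemma integrable_mul_L2 {p : ℝ → ℂ} (hp : MemLp p 2) (f : L2) : Integrable fun y => p y * f y :=
  hp.integrable_mul (Lp.memLp f)

lemma integral_mul_L2_eq_inner {p : ℝ → ℂ} (hp : MemLp p 2) (f : L2) :
    ∫ y, p y * f y = ⟪hp.star.toLp _, f⟫_ℂ := by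
  rw [L2.inner_def]
  refine integral_congr_ae ?_
  filter_upwards [hp.star.coeFn_toLp] with y hy
  rw [hy]
  simp [mul_comm]

lemma continuous_integral_mul_L2 {p : ℝ → ℂ} (hp : MemLp p 2) :
    Continuous fun f : L2 => ∫ y, p y * f y := by
  simp_rw [integral_mul_L2_eq_inner hp]
  fun_prop

/-- Two continuous functions on `L²` agree if they agree on Schwartz functions. -/
lemma eq_of_eq_on_schwartz {F : Type*} [TopologicalSpace F] [T2Space F] {a b : L2 → F}
    (ha : Continuous a) (hb : Continuous b) (h : ∀ g : 𝓢(ℝ, ℂ), a (g.toLp 2) = b (g.toLp 2))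
    (f : L2) : a f = b f := by
  have hd := SchwartzMap.denseRange_toLpCLM (E := ℝ) (F := ℂ) (μ := volume)
    (p := 2) ENNReal.ofNat_ne_top
  exact congrFun (hd.equalizer ha hb (funext fun g => h g)) f

/-- An integral representation on Schwartz functions extends to `L²`. -/
lemma ae_eq_integral_of_schwartz (T : L2 →L[ℂ] L2) {k : ℝ → ℝ → ℂ} (hk : ∀ x, MemLp (k x) 2)
    (h : ∀ g : 𝓢(ℝ, ℂ), T (g.toLp 2) =ᵐ[volume] fun x => ∫ y, k x y * g y) (f : L2) :
    T f =ᵐ[volume] fun x => ∫ y, k x y * f y := by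
  have hd := SchwartzMap.denseRange_toLpCLM (E := ℝ) (F := ℂ) (μ := volume)
    (p := 2) ENNReal.ofNat_ne_top
  obtain ⟨u, hu, hlim⟩ := mem_closure_iff_seq_limit.1 (hd f)
  choose g hg using hu
  have h1 : Tendsto (fun n => T (u n)) atTop (nhds (T f)) := (T.continuous.tendsto f).comp hlim
  -- L² convergence gives pointwise convergence only along a subsequence and almost everywhere. The
  -- integrals on the other side converge for every x, since each row of the kernel is in L².
  obtain ⟨ns, hns, hae⟩ := (tendstoInMeasure_of_tendsto_Lp h1).exists_seq_tendsto_ae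
  have h2 : ∀ᵐ x, ∀ n, T (u n) x = ∫ y, k x y * u n y := by
    refine ae_all_iff.2 fun n => ?_
    filter_upwards [h (g n)] with x hx
    have hn : u n = (g n).toLp 2 := (hg n).symm
    rw [hn, hx]
    refine integral_congr_ae ?_
    filter_upwards [(g n).coeFn_toLp 2] with y hy
    rw [hy]
  filter_upwards [hae, h2] with x hx1 hx2
  refine tendsto_nhds_unique hx1 ?_
  simp_rw [hx2]
  exact ((continuous_integral_mul_L2 (hk x)).tendsto f).comp (hlim.comp hns.tendsto_atTop)

end Pairing

/-! ### Variation of constants and the kernels of the resolvents -/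

section ResolventKernel

open Set Filter

lemma hasDerivAt_ofReal_exp_mul (z x : ℝ) :
    HasDerivAt (fun y : ℝ => (Real.exp (z * y) : ℂ)) (z * Real.exp (z * x) : ℂ) x := by
  have h : HasDerivAt (fun y : ℝ => Real.exp (z * y)) (Real.exp (z * x) * z) x := by
    simpa using ((hasDerivAt_id x).const_mul z).exp
  exact h.ofReal_comp.congr_deriv (by push_cast; ring)

lemma ofReal_exp_sub (h x y : ℝ) : (Real.exp (-(h * (x - y))) : ℂ)
    = (Real.exp (-h * x) : ℂ) * (Real.exp (h * y) : ℂ) := by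
  rw [← Complex.ofReal_mul, ← Real.exp_add]
  congr 2
  ring

lemma ofReal_exp_mul_exp_neg (h x : ℝ) :
    (Real.exp (-h * x) : ℂ) * (Real.exp (h * x) : ℂ) = 1 := by
  rw [← Complex.ofReal_mul, ← Real.exp_add]
  simp

/-- Variation of constants from `-∞`. -/
lemma eq_integral_expKer {h : ℝ} (hh : 0 < h) {v g : ℝ → ℂ} {C : ℝ}
    (hv : ∀ x, HasDerivAt v (g x - h * v x) x) (hvb : ∀ x, ‖v x‖ ≤ C) (x : ℝ)
    (hg : Integrable fun y => expKer h x y * g y) :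
    v x = ∫ y, expKer h x y * g y := by
  rw [integral_expKer_mul]
  -- The integrating factor e^{hy} removes the zeroth order term.
  have hd : ∀ y, HasDerivAt (fun y => (Real.exp (h * y) : ℂ) * v y)
      ((Real.exp (h * y) : ℂ) * g y) y := fun y => by
    exact ((hasDerivAt_ofReal_exp_mul h y).mul (hv y)).congr_deriv (by ring)
  have hint : IntegrableOn (fun y => (Real.exp (h * y) : ℂ) * g y) (Iic x) := by
    have h1 : IntegrableOn (fun y => (Real.exp (h * x) : ℂ) * (expKer h x y * g y)) (Iio x) :=
      (hg.const_mul _).integrableOn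
    rw [integrableOn_Iic_iff_integrableOn_Iio]
    refine h1.congr_fun (fun y hy => ?_) measurableSet_Iio
    dsimp only
    rw [expKer_eq_of_lt hy, ofReal_exp_sub]
    linear_combination (Real.exp (h * y) : ℂ) * g y * ofReal_exp_mul_exp_neg h x
  -- Boundedness of v excludes the homogeneous solution e^{-hy}: the boundary term at -∞ vanishes.
  have hlim : Tendsto (fun y => (Real.exp (h * y) : ℂ) * v y) atBot (nhds 0) := by
    rw [tendsto_zero_iff_norm_tendsto_zero]
    have h1 : Tendsto (fun y => Real.exp (h * y) * C) atBot (nhds 0) := by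
      have := (Real.tendsto_exp_atBot.comp (tendsto_id.const_mul_atBot hh)).mul_const C
      simpa using this
    refine squeeze_zero (fun _ => norm_nonneg _) (fun y => ?_) h1
    rw [norm_mul, Complex.norm_real, Real.norm_of_nonneg (Real.exp_nonneg _)]
    gcongr
    exact hvb y
  have := integral_Iic_of_hasDerivAt_of_tendsto' (fun y _ => hd y) hint hlim
  simp_rw [ofReal_exp_sub, mul_assoc]
  rw [integral_const_mul, this, sub_zero, ← mul_assoc, ofReal_exp_mul_exp_neg, one_mul]

/-- Variation of constants from `+∞`. -/
lemma eq_integral_expKer_flip {h : ℝ} (hh : 0 < h) {v g : ℝ → ℂ} {C : ℝ}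
    (hv : ∀ x, HasDerivAt v (g x + h * v x) x) (hvb : ∀ x, ‖v x‖ ≤ C) (x : ℝ)
    (hg : Integrable fun y => expKer h y x * g y) :
    v x = -∫ y, expKer h y x * g y := by
  have hflip : ∀ y, expKer h y x = expKer h (-x) (-y) := fun y => by
    simp only [expKer, step, neg_lt_neg_iff, neg_inj, eq_comm (a := x)]
    rw [show -x - -y = y - x by ring]
  -- Reflection about the origin turns the problem at +∞ into the one at -∞.
  have h1 := eq_integral_expKer hh (v := fun y => v (-y)) (g := fun y => -g (-y)) (C := C)
    (fun y => by
      have := (hv (-y)).scomp y (hasDerivAt_neg y)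
      exact this.congr_deriv (by simp; ring)) (fun y => hvb _) (-x) (by
      have := hg.comp_neg.neg
      refine this.congr (.of_forall fun y => ?_)
      simp [hflip])
  simp only [neg_neg] at h1
  rw [h1, ← integral_neg_eq_self]
  simp only [hflip, neg_neg, mul_neg, integral_neg]
  
lemma resolv_pos_ae_eq {h : ℝ} (hh : 0 < h) (f : L2) :
    resolv h f =ᵐ[volume] fun x => ∫ y, expKer h x y * f y := by
  refine ae_eq_integral_of_schwartz _ (fun x => memLp_expKer hh x) (fun g => ?_) f
  obtain ⟨v, hv, hvL⟩ := exists_schwartz_resolv hh.ne' g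
  rw [hvL]
  filter_upwards [v.coeFn_toLp 2] with x hx
  rw [hx]
  refine eq_integral_expKer hh (C := SchwartzMap.seminorm ℝ 0 0 v) (fun y => ?_) (fun y => v.norm_le_seminorm ℝ y) x
    ((memLp_expKer hh x).integrable_mul (g.memLp 2))
  exact (v.hasDerivAt y).congr_deriv (by rw [← hv y]; ring)

lemma resolv_neg_ae_eq {h : ℝ} (hh : 0 < h) (f : L2) :
    resolv (-h) f =ᵐ[volume] fun x => ∫ y, -expKer h y x * f y := by
  refine ae_eq_integral_of_schwartz _ (fun x => (memLp_expKer_flip hh x).neg) (fun g => ?_) f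
  obtain ⟨v, hv, hvL⟩ := exists_schwartz_resolv (neg_ne_zero.2 hh.ne') g
  rw [hvL]
  filter_upwards [v.coeFn_toLp 2] with x hx
  rw [hx]
  trans -∫ y, expKer h y x * g y
  swap
  · rw [← integral_neg]
    exact integral_congr_ae (.of_forall fun y => by simp)
  refine eq_integral_expKer_flip hh (C := SchwartzMap.seminorm ℝ 0 0 v) (fun y => ?_) (fun y => v.norm_le_seminorm ℝ y) x
    ((memLp_expKer_flip hh x).integrable_mul (g.memLp 2))
  exact (v.hasDerivAt y).congr_deriv (by rw [← hv y]; push_cast; ring)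

end ResolventKernel

/-! ### Integral operators: Hilbert-Schmidt norm and trace -/

section Kernels

open Set Filter

/-- Distinct basis vectors have distance √2, so the balls of radius 1/2 around them are disjoint,
and a separable space holds only countably many. Countability is what lets an almost everywhere
identity hold for all basis vectors at once. -/
lemma HilbertBasis.countable_index {E : Type*} [NormedAddCommGroup E] [InnerProductSpace ℂ E]
    [TopologicalSpace.SeparableSpace E] {ι : Type*} (b : HilbertBasis ι ℂ E) : Countable ι := by
  rw [← Set.countable_univ_iff]
  refine Set.PairwiseDisjoint.countable_of_isOpen (s := fun i => Metric.ball (b i) (1 / 2)) ?_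
    (fun _ _ => Metric.isOpen_ball) (fun i _ => ⟨b i, Metric.mem_ball_self (by norm_num)⟩)
  intro i _ j _ hij
  refine Metric.ball_disjoint_ball ?_
  have h1 : ‖b i - b j‖ ^ 2 = 2 := by
    rw [@norm_sub_sq ℂ, b.orthonormal.1, b.orthonormal.1, b.orthonormal.2 hij]
    norm_num
  rw [dist_eq_norm]
  nlinarith [norm_nonneg (b i - b j)]

instance : Countable (basisSet L2) := by
  have : Fact ((2 : ℝ≥0∞) ≠ ∞) := ⟨ENNReal.ofNat_ne_top⟩
  exact HilbertBasis.countable_index (onBasis L2)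

/-- `T` is an integral operator with square integrable kernel `k`. -/
structure HasKernel (T : L2 →L[ℂ] L2) (k : ℝ → ℝ → ℂ) : Prop where
  row : ∀ x, MemLp (k x) 2
  sq : ∫⁻ x, ∫⁻ y, ‖k x y‖ₑ ^ 2 < ∞
  rep : ∀ f : L2, T f =ᵐ[volume] fun x => ∫ y, k x y * f y

lemma enorm_toLp_sq {f : ℝ → ℂ} (hf : MemLp f 2) : ‖hf.toLp f‖ₑ ^ 2 = ∫⁻ y, ‖f y‖ₑ ^ 2 := by
  rw [Lp.enorm_toLp, eLpNorm_eq_lintegral_rpow_enorm_toReal two_ne_zero (by simp)]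
  rw [← ENNReal.rpow_natCast, ← ENNReal.rpow_mul]
  simp

lemma enorm_L2_sq (f : L2) : ‖f‖ₑ ^ 2 = ∫⁻ y, ‖f y‖ₑ ^ 2 := by
  have := enorm_toLp_sq (Lp.memLp f)
  rwa [Lp.toLp_coeFn] at this

/-- For almost every x the numbers (T bᵢ)(x) are, up to conjugation, the coefficients of the row k x
in the basis; Parseval for the row and Tonelli in x give the formula. -/
lemma HasKernel.hsSq_eq {T : L2 →L[ℂ] L2} {k : ℝ → ℝ → ℂ} (h : HasKernel T k) :
    hsSq T = ∫⁻ x, ∫⁻ y, ‖k x y‖ₑ ^ 2 := by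
  set b := onBasis L2
  have h1 : ∀ᵐ x, ∀ i, T (b i) x = ∫ y, k x y * b i y := ae_all_iff.2 fun i => h.rep (b i)
  calc hsSq T = ∑' i, ∫⁻ x, ‖T (b i) x‖ₑ ^ 2 := tsum_congr fun i => enorm_L2_sq _
    _ = ∫⁻ x, ∑' i, ‖T (b i) x‖ₑ ^ 2 := by
        rw [lintegral_tsum]
        exact fun i => (Lp.aestronglyMeasurable _).enorm.pow_const 2
    _ = ∫⁻ x, ∫⁻ y, ‖k x y‖ₑ ^ 2 := by
        refine lintegral_congr_ae ?_
        filter_upwards [h1] with x hx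
        simp_rw [hx, integral_mul_L2_eq_inner (h.row x)]
        have := enorm_sq_eq_tsum b ((h.row x).star.toLp _)
        rw [enorm_toLp_sq] at this
        have hstar : ∀ z : ℂ, ‖star z‖ₑ = ‖z‖ₑ := fun z => by
          rw [← ofReal_norm, norm_star, ofReal_norm]
        simp only [Pi.star_apply, hstar] at this
        rw [this]
        refine tsum_congr fun i => ?_
        rw [← inner_conj_symm, ← ofReal_norm, RCLike.norm_conj, ofReal_norm]

lemma HasKernel.isHilbertSchmidt {T : L2 →L[ℂ] L2} {k : ℝ → ℝ → ℂ} (h : HasKernel T k) :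
    IsHilbertSchmidt T := by
  rw [isHilbertSchmidt_iff, h.hsSq_eq]
  exact h.sq.ne

lemma lintegral_norm_rpow_two (f : L2) : ∫ x, ‖f x‖ ^ (2 : ℝ) = ‖f‖ ^ 2 := by
  have := enorm_L2_sq f
  rw [← ofReal_norm, ← ENNReal.ofReal_pow (norm_nonneg _)] at this
  rw [integral_eq_lintegral_of_nonneg_ae (.of_forall fun _ => by positivity)
    ((Lp.aestronglyMeasurable f).norm.aemeasurable.pow_const _).aestronglyMeasurable,
    ← ENNReal.toReal_ofReal (sq_nonneg ‖f‖), this]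
  congr 1
  refine lintegral_congr fun x => ?_
  rw [Real.rpow_two, ENNReal.ofReal_pow (norm_nonneg _), ofReal_norm]

lemma integral_norm_mul_le (f g : L2) : ∫ x, ‖g x * conj (f x)‖ ≤ ‖f‖ * ‖g‖ := by
  have h3 := integral_mul_le_Lp_mul_Lq_of_nonneg (μ := volume) Real.HolderConjugate.two_two
    (f := fun x => ‖f x‖) (g := fun x => ‖g x‖) (.of_forall fun _ => norm_nonneg _)
    (.of_forall fun _ => norm_nonneg _) (by simpa using (Lp.memLp f).norm)
    (by simpa using (Lp.memLp g).norm)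
  rw [lintegral_norm_rpow_two, lintegral_norm_rpow_two, ← Real.sqrt_eq_rpow, ← Real.sqrt_eq_rpow,
    Real.sqrt_sq (norm_nonneg _), Real.sqrt_sq (norm_nonneg _)] at h3
  refine le_trans (le_of_eq (integral_congr_ae (.of_forall fun x => ?_))) h3
  simp only [norm_mul, RCLike.norm_conj, mul_comm]

lemma inner_eq_integral_mul_conj (f g : L2) : ⟪f, g⟫_ℂ = ∫ x, g x * conj (f x) := by
  rw [L2.inner_def]
  rfl

lemma integrable_mul_conj (f g : L2) : Integrable fun x => g x * conj (f x) :=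
  L2.integrable_inner (𝕜 := ℂ) f g

lemma tsum_conj_mul_eq_integral {k l : ℝ → ℂ} (hk : MemLp k 2) (hl : MemLp l 2) :
    ∑' i, (∫ y, l y * onBasis L2 i y) * conj (∫ y, k y * onBasis L2 i y)
      = ∫ y, l y * conj (k y) := by
  simp_rw [integral_mul_L2_eq_inner hk, integral_mul_L2_eq_inner hl, inner_conj_symm]
  rw [(onBasis L2).tsum_inner_mul_inner, inner_eq_integral_mul_conj]
  refine integral_congr_ae ?_
  filter_upwards [hk.star.coeFn_toLp, hl.star.coeFn_toLp] with y hy1 hy2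
  rw [hy1, hy2]
  simp [mul_comm]

/-- The trace of a product of integral operators, in terms of the kernels of the second factor
and of the adjoint of the first one. -/
lemma HasKernel.trace_comp {T S : L2 →L[ℂ] L2} {k l : ℝ → ℝ → ℂ}
    (hT : HasKernel (ContinuousLinearMap.adjoint T) k) (hS : HasKernel S l) :
    trace (T ∘L S) = ∫ x, ∫ y, l x y * conj (k x y) := by
  obtain ⟨T', hT'⟩ : ∃ T', T' = ContinuousLinearMap.adjoint T := ⟨_, rfl⟩
  rw [← hT'] at hT
  have hF : ∀ i, ⟪onBasis L2 i, (T ∘L S) (onBasis L2 i)⟫_ℂ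
      = ∫ x, S (onBasis L2 i) x * conj (T' (onBasis L2 i) x) := fun i => by
    rw [ContinuousLinearMap.comp_apply, ← ContinuousLinearMap.adjoint_inner_left, ← hT',
      inner_eq_integral_mul_conj]
  -- The Hilbert-Schmidt property makes the sum over the basis absolutely convergent in L¹, so it
  -- may be moved under the integral in x; Parseval for the rows then evaluates it.
  have hsum : Summable fun i => ∫ x, ‖S (onBasis L2 i) x * conj (T' (onBasis L2 i) x)‖ :=
    Summable.of_nonneg_of_le (fun i => integral_nonneg fun _ => norm_nonneg _)
      (fun i => integral_norm_mul_le _ _)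
      (summable_mul_norm hT.isHilbertSchmidt hS.isHilbertSchmidt)
  have hswap := integral_tsum_of_summable_integral_norm
    (fun i => integrable_mul_conj (T' (onBasis L2 i)) (S (onBasis L2 i))) hsum
  rw [trace, tsum_congr hF, hswap]
  have h1 : ∀ᵐ x, ∀ i, T' (onBasis L2 i) x = ∫ y, k x y * onBasis L2 i y :=
    ae_all_iff.2 fun i => hT.rep _
  have h2 : ∀ᵐ x, ∀ i, S (onBasis L2 i) x = ∫ y, l x y * onBasis L2 i y :=
    ae_all_iff.2 fun i => hS.rep _
  refine integral_congr_ae ?_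
  filter_upwards [h1, h2] with x hx1 hx2
  rw [← tsum_conj_mul_eq_integral (hT.row x) (hS.row x)]
  exact tsum_congr fun i => by rw [hx1, hx2]

end Kernels

/-! ### Hilbert-Schmidt norm of a resolvent times a potential -/

section ResolventMul

open Set Filter

lemma SchwartzMap.bdd (Q : 𝓢(ℝ, ℂ)) : MemLp Q ∞ (volume : Measure ℝ) := Q.memLp_top volume

lemma integrable_norm_sq (Q : 𝓢(ℝ, ℂ)) : Integrable fun x => ‖Q x‖ ^ 2 :=
  (memLp_two_iff_integrable_sq_norm Q.continuous.aestronglyMeasurable).1 (Q.memLp 2)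

/-- `(∂ + z)⁻¹ Q`. -/
def resolvMul (z : ℝ) (Q : 𝓢(ℝ, ℂ)) : L2 →L[ℂ] L2 := resolv z ∘L mulOp Q

lemma lintegral_enorm_expKer_flip {h : ℝ} (hh : 0 < h) (y : ℝ) :
    ∫⁻ x, ‖expKer h x y‖ₑ ^ 2 = ENNReal.ofReal (1 / (2 * h)) := by
  rw [← integral_norm_expKer_flip_sq hh y, ofReal_integral_eq_lintegral_ofReal]
  · simp_rw [enorm_sq_eq_ofReal]
  · exact (memLp_two_iff_integrable_sq_norm (memLp_expKer_flip hh y).1).1 (memLp_expKer_flip hh y)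
  · exact .of_forall fun _ => by positivity

lemma expKer_neg (h x y : ℝ) : expKer h (-x) (-y) = expKer h y x := by
  simp only [expKer, step, neg_lt_neg_iff, neg_inj, eq_comm (a := x)]
  rw [show -x - -y = y - x by ring]

lemma lintegral_enorm_expKer {h : ℝ} (hh : 0 < h) (y : ℝ) :
    ∫⁻ x, ‖expKer h y x‖ₑ ^ 2 = ENNReal.ofReal (1 / (2 * h)) := by
  rw [← lintegral_enorm_expKer_flip hh (-y),
    ← MeasureTheory.lintegral_neg_eq_self (μ := volume) fun x => ‖expKer h x (-y)‖ₑ ^ 2]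
  simp only [expKer_neg]

/-- The potential depends on y alone, so integrating in x first leaves the constant column norm c.
-/
lemma lintegral_kernel_mul {k : ℝ → ℝ → ℂ} (hk : Measurable fun p : ℝ × ℝ => k p.1 p.2)
    {c : ℝ} (hc : 0 ≤ c) (hkc : ∀ y, ∫⁻ x, ‖k x y‖ₑ ^ 2 = ENNReal.ofReal c) (Q : 𝓢(ℝ, ℂ)) :
    ∫⁻ x, ∫⁻ y, ‖k x y * Q y‖ₑ ^ 2 = ENNReal.ofReal (c * ∫ y, ‖Q y‖ ^ 2) := by
  have hQ : Measurable Q := Q.continuous.measurable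
  rw [lintegral_lintegral_swap]
  · simp_rw [enorm_mul, mul_pow]
    rw [ENNReal.ofReal_mul hc, ofReal_integral_eq_lintegral_ofReal (integrable_norm_sq Q)
      (.of_forall fun _ => by positivity), ← lintegral_const_mul _ (by fun_prop)]
    refine lintegral_congr fun y => ?_
    rw [lintegral_mul_const _ ?_, hkc, enorm_sq_eq_ofReal]
    exact (hk.comp measurable_prodMk_right).enorm.pow_const 2
  · exact ((hk.mul (hQ.comp measurable_snd)).enorm.pow_const 2).aemeasurable

lemma memLp_mul_schwartz {k : ℝ → ℂ} (hk : MemLp k 2) (Q : 𝓢(ℝ, ℂ)) :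
    MemLp (fun y => k y * Q y) 2 := by
  have := hk.mul' (Q.memLp_top volume) (r := 2)
  simpa [mul_comm] using this

lemma hasKernel_resolvMul_pos {h : ℝ} (hh : 0 < h) (Q : 𝓢(ℝ, ℂ)) :
    HasKernel (resolvMul h Q) fun x y => expKer h x y * Q y where
  row x := memLp_mul_schwartz (memLp_expKer hh x) Q
  sq := by
    rw [lintegral_kernel_mul (measurable_expKer h) (by positivity) (lintegral_enorm_expKer_flip hh)]
    exact ENNReal.ofReal_lt_top
  rep f := by
    rw [resolvMul, ContinuousLinearMap.comp_apply]
    filter_upwards [resolv_pos_ae_eq hh (mulOp Q f)] with x hx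
    rw [hx]
    refine integral_congr_ae ?_
    filter_upwards [coeFn_mulOp (Q.memLp_top volume) f] with y hy
    rw [hy, mul_assoc]

lemma hasKernel_resolvMul_neg {h : ℝ} (hh : 0 < h) (Q : 𝓢(ℝ, ℂ)) :
    HasKernel (resolvMul (-h) Q) fun x y => -expKer h y x * Q y where
  row x := memLp_mul_schwartz (memLp_expKer_flip hh x).neg Q
  sq := by
    rw [lintegral_kernel_mul (c := 1 / (2 * h)) (k := fun x y => -expKer h y x)
      ((measurable_expKer h).comp measurable_swap).neg (by positivity)
      (fun y => by simp only [enorm_neg, lintegral_enorm_expKer hh y])]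
    exact ENNReal.ofReal_lt_top
  rep f := by
    rw [resolvMul, ContinuousLinearMap.comp_apply]
    filter_upwards [resolv_neg_ae_eq hh (mulOp Q f)] with x hx
    rw [hx]
    refine integral_congr_ae ?_
    filter_upwards [coeFn_mulOp (Q.memLp_top volume) f] with y hy
    rw [hy, mul_assoc]

lemma hsNorm_resolvMul_sq_pos {h : ℝ} (hh : 0 < h) (Q : 𝓢(ℝ, ℂ)) :
    hsNorm (resolvMul h Q) ^ 2 = 1 / (2 * h) * ∫ y, ‖Q y‖ ^ 2 := by
  rw [hsNorm_sq, (hasKernel_resolvMul_pos hh Q).hsSq_eq, lintegral_kernel_mul (measurable_expKer h)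
    (by positivity) (lintegral_enorm_expKer_flip hh), ENNReal.toReal_ofReal]
  have : 0 ≤ ∫ y, ‖Q y‖ ^ 2 := integral_nonneg fun _ => by positivity
  positivity

lemma hsNorm_resolvMul_sq_neg {h : ℝ} (hh : 0 < h) (Q : 𝓢(ℝ, ℂ)) :
    hsNorm (resolvMul (-h) Q) ^ 2 = 1 / (2 * h) * ∫ y, ‖Q y‖ ^ 2 := by
  rw [hsNorm_sq, (hasKernel_resolvMul_neg hh Q).hsSq_eq,
    lintegral_kernel_mul (c := 1 / (2 * h)) (k := fun x y => -expKer h y x)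
      ((measurable_expKer h).comp measurable_swap).neg (by positivity)
      (fun y => by simp only [enorm_neg, lintegral_enorm_expKer hh y]), ENNReal.toReal_ofReal]
  have : 0 ≤ ∫ y, ‖Q y‖ ^ 2 := integral_nonneg fun _ => by positivity
  positivity

lemma isHilbertSchmidt_resolvMul {z : ℝ} (hz : z ≠ 0) (Q : 𝓢(ℝ, ℂ)) :
    IsHilbertSchmidt (resolvMul z Q) := by
  rcases hz.lt_or_gt with h | h
  · have := (hasKernel_resolvMul_neg (neg_pos.2 h) Q).isHilbertSchmidt
    rwa [neg_neg] at this
  · exact (hasKernel_resolvMul_pos h Q).isHilbertSchmidt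

end ResolventMul

/-! ### The Lax equation as a pair of resolvent equations -/

section WeakEquation

open Set Filter

lemma integrable_L2_mul_schwartz (u : L2) (φ : 𝓢(ℝ, ℂ)) : Integrable fun x => u x * φ x :=
  (Lp.memLp u).integrable_mul (φ.memLp 2)

lemma continuous_integral_L2_mul_schwartz (φ : 𝓢(ℝ, ℂ)) :
    Continuous fun u : L2 => ∫ x, u x * φ x := by
  exact (continuous_integral_mul_L2 (φ.memLp 2)).congr fun u => by simp only [mul_comm]

lemma eq_of_integral_mul_schwartz {u v : L2}
    (h : ∀ φ : 𝓢(ℝ, ℂ), ∫ x, u x * φ x = ∫ x, v x * φ x) : u = v := by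
  refine ext_inner_left ℂ fun w => ?_
  have hstar : ∀ (f : L2) (u : L2), ⟪f, u⟫_ℂ = conj ⟪u, f⟫_ℂ := fun f u => (inner_conj_symm _ _).symm
  rw [hstar, hstar w v]
  congr 1
  refine eq_of_eq_on_schwartz (a := fun w => ⟪u, w⟫_ℂ) (b := fun w => ⟪v, w⟫_ℂ) (by fun_prop)
    (by fun_prop) (fun φ => ?_) w
  rw [← inner_conj_symm, ← inner_conj_symm v]
  congr 1
  have key : ∀ u : L2, ⟪φ.toLp 2, u⟫_ℂ
      = ∫ x, u x * (SchwartzMap.postcompCLM (𝕜 := ℝ) (conjCLE : ℂ →L[ℝ] ℂ) φ) x := fun u => by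
    rw [L2.inner_def]
    refine integral_congr_ae ?_
    filter_upwards [φ.coeFn_toLp 2] with x hx
    rw [hx]
    rfl
  rw [key, key, h]

/-- `(∂ + z) u = g` in the sense of distributions if and only if `u = (∂ + z)⁻¹ g`. -/
lemma weak_iff_eq_resolv {z : ℝ} (hz : z ≠ 0) (u g : L2) :
    (∀ φ : 𝓢(ℝ, ℂ), ∫ x, (-(u x * deriv φ x) + z * u x * φ x) = ∫ x, g x * φ x)
      ↔ u = resolv z g := by
  -- The transpose of ∂ + z under the bilinear pairing.
  let D : 𝓢(ℝ, ℂ) → 𝓢(ℝ, ℂ) := fun φ => -SchwartzMap.derivCLM ℂ ℂ φ + (z : ℂ) • φ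
  have hD : ∀ (φ : 𝓢(ℝ, ℂ)) (x : ℝ), D φ x = -deriv φ x + z * φ x := fun φ x => by
    simp [D]
  have h1 : ∀ (u : L2) (φ : 𝓢(ℝ, ℂ)),
      ∫ x, (-(u x * deriv φ x) + z * u x * φ x) = ∫ x, u x * D φ x := fun u φ => by
    refine integral_congr_ae (.of_forall fun x => ?_)
    simp only [hD]
    ring
  have h2 : ∀ (g : L2) (φ : 𝓢(ℝ, ℂ)), ∫ x, resolv z g x * D φ x = ∫ x, g x * φ x := by
    intro g φ
    refine eq_of_eq_on_schwartz (a := fun g => ∫ x, resolv z g x * D φ x)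
      ((continuous_integral_L2_mul_schwartz _).comp (resolv z).continuous)
      (continuous_integral_L2_mul_schwartz φ) (fun g => ?_) g
    obtain ⟨v, hv, hvL⟩ := exists_schwartz_resolv hz g
    have e1 : ∫ x, resolv z (g.toLp 2) x * D φ x = ∫ x, v x * D φ x := by
      rw [hvL]
      refine integral_congr_ae ?_
      filter_upwards [v.coeFn_toLp 2] with x hx
      rw [hx]
    have e2 : ∫ x, (g.toLp 2 : L2) x * φ x = ∫ x, g x * φ x := by
      refine integral_congr_ae ?_
      filter_upwards [g.coeFn_toLp 2] with x hx
      rw [hx]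
    rw [e1, e2]
    have i1 : Integrable fun x => v x * deriv φ x :=
      (v.memLp 2).integrable_mul ((SchwartzMap.derivCLM ℂ ℂ φ).memLp 2)
    have i2 : Integrable fun x => deriv v x * φ x :=
      ((SchwartzMap.derivCLM ℂ ℂ v).memLp 2).integrable_mul (φ.memLp 2)
    have i3 : Integrable fun x => z * (v x * φ x) :=
      ((v.memLp 2).integrable_mul (φ.memLp 2)).const_mul _
    have e3 : ∀ x, v x * D φ x = -(v x * deriv φ x) + z * (v x * φ x) := fun x => by
      rw [hD]; ring
    have e4 : ∀ x, g x * φ x = deriv v x * φ x + z * (v x * φ x) := fun x => by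
      rw [← hv]; ring
    simp_rw [e3, e4]
    rw [integral_add i1.fun_neg i3, integral_add i2 i3, integral_neg,
      SchwartzMap.integral_mul_deriv_eq_neg_deriv_mul, neg_neg]
  constructor
  · intro h
    refine eq_of_integral_mul_schwartz fun χ => ?_
    -- D is surjective on Schwartz functions: D v = χ amounts to (∂ - z)v = -χ, solved by the
    -- resolvent at -z. Testing against all D v therefore determines u.
    obtain ⟨v, hv, -⟩ := exists_schwartz_resolv (neg_ne_zero.2 hz) (-χ)
    have : D v = χ := by
      ext x
      have := hv x
      rw [hD]
      push_cast at this
      rw [Pi.neg_apply] at this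
      linear_combination -this
    rw [← this, ← h1, h, h2]
  · rintro rfl φ
    rw [h1, h2]

/-- The solution operator equation of the Lax system: `(∂ + h) u₁ - Q u₂ = f₁` and
`(∂ - h) u₂ - R u₁ = f₂`. -/
def IsSol (h : ℝ) (Q R : 𝓢(ℝ, ℂ)) (u f : L2 × L2) : Prop :=
  u.1 = resolv h (f.1 + mulOp Q u.2) ∧ u.2 = resolv (-h) (f.2 + mulOp R u.1)

/-- The complex conjugate of a Schwartz function. -/
def conjS (q : 𝓢(ℝ, ℂ)) : 𝓢(ℝ, ℂ) := SchwartzMap.postcompCLM (𝕜 := ℝ) (conjCLE : ℂ →L[ℝ] ℂ) q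

@[simp] lemma conjS_apply (q : 𝓢(ℝ, ℂ)) (x : ℝ) : conjS q x = conj (q x) := rfl

/-- `r = -q̄` as a Schwartz function. -/
def rS (q : 𝓢(ℝ, ℂ)) : 𝓢(ℝ, ℂ) := -conjS q

@[simp] lemma rS_apply (q : 𝓢(ℝ, ℂ)) (x : ℝ) : rS q x = rOf q x := by
  simp [rS, rOf]

/-- Moving the potential to the right-hand side leaves a constant coefficient equation, to which
`weak_iff_eq_resolv` applies. -/
lemma weak_shift (z : ℂ) (Q φ : 𝓢(ℝ, ℂ)) (u v f : L2) :
    (∫ x, (-(u x * deriv φ x) + (z * u x - Q x * v x) * φ x) = ∫ x, f x * φ x) ↔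
      ∫ x, (-(u x * deriv φ x) + z * u x * φ x) = ∫ x, (f + mulOp Q v : L2) x * φ x := by
  have hm := coeFn_mulOp (Q.memLp_top volume) v
  have i0 := integrable_L2_mul_schwartz (mulOp Q v) φ
  have i1 : Integrable fun x => u x * deriv φ x :=
    integrable_L2_mul_schwartz u (SchwartzMap.derivCLM ℂ ℂ φ)
  have i2 : Integrable fun x => -(u x * deriv φ x) + z * u x * φ x := by
    simp_rw [mul_assoc]
    exact i1.fun_neg.add ((integrable_L2_mul_schwartz u φ).const_mul z)
  have e1 : ∫ x, (-(u x * deriv φ x) + (z * u x - Q x * v x) * φ x)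
      = (∫ x, (-(u x * deriv φ x) + z * u x * φ x)) - ∫ x, mulOp Q v x * φ x := by
    rw [← integral_sub i2 i0]
    refine integral_congr_ae ?_
    filter_upwards [hm] with x hx
    rw [hx]
    ring
  have e2 : ∫ x, (f + mulOp Q v : L2) x * φ x
      = (∫ x, f x * φ x) + ∫ x, mulOp Q v x * φ x := by
    rw [← integral_add (integrable_L2_mul_schwartz f φ) i0]
    refine integral_congr_ae ?_
    filter_upwards [Lp.coeFn_add f (mulOp Q v)] with x hx
    rw [hx, Pi.add_apply]
    ring
  rw [e1, e2, sub_eq_iff_eq_add]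

lemma laxEq_iff {κ : ℂ} {z : ℝ} (hz : z ≠ 0) (hκ : I * κ ^ 2 = z) (q : 𝓢(ℝ, ℂ))
    (u f : L2 × L2) :
    LaxEq κ q u f ↔ u.1 = resolv z (f.1 + mulOp (κ • q) u.2) ∧
      u.2 = resolv (-z) (f.2 + mulOp (κ • rS q) u.1) := by
  rw [← weak_iff_eq_resolv hz, ← weak_iff_eq_resolv (neg_ne_zero.2 hz), LaxEq, ← forall_and, hκ]
  refine forall_congr' fun φ => and_congr ?_ ?_
  · exact weak_shift z (κ • q) φ u.1 u.2 f.1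
  · rw [show (((-z : ℝ)) : ℂ) = -z by push_cast; rfl]
    refine Iff.trans (Eq.congr_left ?_) (weak_shift (-z) (κ • rS q) φ u.2 u.1 f.2)
    refine integral_congr_ae (.of_forall fun x => ?_)
    simp only [smul_apply, rS_apply, smul_eq_mul]
    ring

end WeakEquation

/-! ### Volterra operators on bounded continuous functions -/

section JostOperators

open Set Filter BoundedContinuousFunction

lemma hasDerivAt_integral_Iic {g : ℝ → ℂ} (hg : Continuous g) (hint : ∀ x, IntegrableOn g (Iic x))
    (x : ℝ) : HasDerivAt (fun x => ∫ y in Iic x, g y) (g x) x := by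
  have h1 : ∀ x, ∫ y in Iic x, g y = (∫ y in Iic 0, g y) + ∫ y in (0 : ℝ)..x, g y := fun x => by
    rw [← intervalIntegral.integral_Iic_sub_Iic (hint 0) (hint x)]
    ring
  exact ((hg.integral_hasStrictDerivAt 0 x).hasDerivAt.const_add _).congr_of_eventuallyEq
    (.of_forall h1)

lemma integrable_expKer_mul {h : ℝ} (hh : 0 < h) (x : ℝ) {g : ℝ → ℂ} (hg : Integrable g) :
    Integrable fun y => expKer h x y * g y := by
  refine hg.bdd_mul (c := 1) ((measurable_expKer h).comp measurable_prodMk_left).aestronglyMeasurable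
    (.of_forall fun y => (norm_expKer_le h x y).trans ?_)
  rw [Real.exp_le_one_iff]
  have := abs_nonneg (x - y)
  nlinarith

lemma norm_expKer_le_one {h : ℝ} (hh : 0 < h) (x y : ℝ) : ‖expKer h x y‖ ≤ 1 := by
  refine (norm_expKer_le h x y).trans ?_
  rw [Real.exp_le_one_iff]
  have := abs_nonneg (x - y)
  nlinarith

lemma hasDerivAt_integral_expKer {h : ℝ} (hh : 0 < h) {g : ℝ → ℂ} (hgc : Continuous g)
    (hg : Integrable g) (x : ℝ) :
    HasDerivAt (fun x => ∫ y, expKer h x y * g y) (g x - h * ∫ y, expKer h x y * g y) x := by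
  have h1 : ∀ x, ∫ y, expKer h x y * g y
      = (Real.exp (-h * x) : ℂ) * ∫ y in Iic x, (Real.exp (h * y) : ℂ) * g y := fun x => by
    rw [integral_expKer_mul, ← integral_const_mul]
    simp_rw [ofReal_exp_sub, mul_assoc]
  have h2 : ∀ x, IntegrableOn (fun y => (Real.exp (h * y) : ℂ) * g y) (Iic x) := fun x => by
    refine (hg.integrableOn).bdd_mul (c := Real.exp (h * x)) (by fun_prop) ?_
    filter_upwards [ae_restrict_mem measurableSet_Iic] with y hy
    rw [Complex.norm_real, Real.norm_of_nonneg (Real.exp_nonneg _)]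
    gcongr
    exact hy
  have h3 := (hasDerivAt_ofReal_exp_mul (-h) x).mul
    (hasDerivAt_integral_Iic (by fun_prop) h2 x)
  refine (h3.congr_of_eventuallyEq (.of_forall h1)).congr_deriv ?_
  rw [h1 x, Complex.ofReal_neg]
  linear_combination g x * ofReal_exp_mul_exp_neg h x

lemma continuous_integral_expKer {h : ℝ} (hh : 0 < h) {g : ℝ → ℂ} (hgc : Continuous g)
    (hg : Integrable g) : Continuous fun x => ∫ y, expKer h x y * g y :=
  continuous_iff_continuousAt.2 fun x => (hasDerivAt_integral_expKer hh hgc hg x).continuousAt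

lemma integrable_schwartz_mul (Q : 𝓢(ℝ, ℂ)) (b : ℝ →ᵇ ℂ) : Integrable fun y => Q y * b y :=
  Q.integrable.mul_bdd (c := ‖b‖) b.continuous.aestronglyMeasurable
    (.of_forall fun y => b.norm_coe_le_norm y)

lemma norm_integral_expKer_le {h : ℝ} (hh : 0 < h) (Q : 𝓢(ℝ, ℂ)) (b : ℝ →ᵇ ℂ) (x : ℝ) :
    ‖∫ y, expKer h x y * (Q y * b y)‖ ≤ (∫ y, ‖Q y‖) * ‖b‖ := by
  rw [← integral_mul_const]
  refine norm_integral_le_of_norm_le (Q.integrable.norm.mul_const _) (.of_forall fun y => ?_)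
  rw [norm_mul, norm_mul]
  calc ‖expKer h x y‖ * (‖Q y‖ * ‖b y‖) ≤ 1 * (‖Q y‖ * ‖b‖) := by
        gcongr
        · exact norm_expKer_le_one hh x y
        · exact b.norm_coe_le_norm y
    _ = _ := one_mul _

/-- `b ↦ ∫_{y < x} e^{-2h(x-y)} Q(y) b(y) dy` on bounded continuous functions. -/
def volterraC (h : ℝ) (hh : 0 < h) (Q : 𝓢(ℝ, ℂ)) : (ℝ →ᵇ ℂ) →L[ℂ] (ℝ →ᵇ ℂ) :=
  LinearMap.mkContinuous
    { toFun := fun b => ofNormedAddCommGroup (fun x => ∫ y, expKer h x y * (Q y * b y))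
        (continuous_integral_expKer hh (by fun_prop) (integrable_schwartz_mul Q b))
        ((∫ y, ‖Q y‖) * ‖b‖) (norm_integral_expKer_le hh Q b)
      map_add' := fun b b' => by
        ext x
        simp only [coe_ofNormedAddCommGroup, BoundedContinuousFunction.add_apply, mul_add]
        exact integral_add (integrable_expKer_mul hh x (integrable_schwartz_mul Q b))
          (integrable_expKer_mul hh x (integrable_schwartz_mul Q b'))
      map_smul' := fun c b => by
        ext x
        simp only [coe_ofNormedAddCommGroup, BoundedContinuousFunction.smul_apply, RingHom.id_apply,
          smul_eq_mul, ← integral_const_mul]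
        refine integral_congr_ae (.of_forall fun y => ?_)
        dsimp only
        ring }
    (∫ y, ‖Q y‖) fun b => by
      refine (norm_le (by positivity)).2 fun x => norm_integral_expKer_le hh Q b x

lemma volterraC_apply {h : ℝ} (hh : 0 < h) (Q : 𝓢(ℝ, ℂ)) (b : ℝ →ᵇ ℂ) (x : ℝ) :
    volterraC h hh Q b x = ∫ y, expKer h x y * (Q y * b y) := rfl

lemma norm_setIntegral_Iic_le (R : 𝓢(ℝ, ℂ)) (c : ℝ →ᵇ ℂ) (x : ℝ) :
    ‖∫ y in Iic x, R y * c y‖ ≤ (∫ y, ‖R y‖) * ‖c‖ := by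
  rw [← integral_mul_const]
  refine (norm_integral_le_integral_norm _).trans ?_
  refine (setIntegral_le_integral (integrable_schwartz_mul R c).norm
    (.of_forall fun _ => norm_nonneg _)).trans ?_
  refine integral_mono (integrable_schwartz_mul R c).norm (R.integrable.norm.mul_const _)
    fun y => ?_
  dsimp only
  rw [norm_mul]
  gcongr
  exact c.norm_coe_le_norm y

/-- `c ↦ ∫_{y < x} R(y) c(y) dy` on bounded continuous functions. -/
def volterraJ (R : 𝓢(ℝ, ℂ)) : (ℝ →ᵇ ℂ) →L[ℂ] (ℝ →ᵇ ℂ) :=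
  LinearMap.mkContinuous
    { toFun := fun c => ofNormedAddCommGroup (fun x => ∫ y in Iic x, R y * c y)
        (continuous_iff_continuousAt.2 fun x => (hasDerivAt_integral_Iic (by fun_prop)
          (fun _ => (integrable_schwartz_mul R c).integrableOn) x).continuousAt)
        ((∫ y, ‖R y‖) * ‖c‖) (norm_setIntegral_Iic_le R c)
      map_add' := fun b b' => by
        ext x
        simp only [coe_ofNormedAddCommGroup, BoundedContinuousFunction.add_apply, mul_add]
        exact integral_add (integrable_schwartz_mul R b).integrableOn
          (integrable_schwartz_mul R b').integrableOn
      map_smul' := fun c b => by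
        ext x
        simp only [coe_ofNormedAddCommGroup, BoundedContinuousFunction.smul_apply, RingHom.id_apply,
          smul_eq_mul, ← integral_const_mul]
        refine integral_congr_ae (.of_forall fun y => ?_)
        dsimp only
        ring }
    (∫ y, ‖R y‖) fun b => by
      refine (norm_le (by positivity)).2 fun x => norm_setIntegral_Iic_le R b x

lemma volterraJ_apply (R : 𝓢(ℝ, ℂ)) (c : ℝ →ᵇ ℂ) (x : ℝ) :
    volterraJ R c x = ∫ y in Iic x, R y * c y := rfl

lemma volterraC_smul {h : ℝ} (hh : 0 < h) (μ : ℂ) (Q : 𝓢(ℝ, ℂ)) :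
    volterraC h hh (μ • Q) = μ • volterraC h hh Q := by
  ext b x
  rw [_root_.smul_apply, BoundedContinuousFunction.smul_apply, volterraC_apply, volterraC_apply, smul_eq_mul,
    ← integral_const_mul]
  refine integral_congr_ae (.of_forall fun y => ?_)
  simp only [_root_.smul_apply, smul_eq_mul]
  ring

lemma volterraJ_smul (ν : ℂ) (R : 𝓢(ℝ, ℂ)) : volterraJ (ν • R) = ν • volterraJ R := by
  ext b x
  rw [_root_.smul_apply, BoundedContinuousFunction.smul_apply, volterraJ_apply, volterraJ_apply, smul_eq_mul,
    ← integral_const_mul]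
  refine integral_congr_ae (.of_forall fun y => ?_)
  simp only [_root_.smul_apply, smul_eq_mul]
  ring

/-- The bound is homogeneous of degree zero: for x = hd and y = h'd it equals (h' - h)/h whatever
the distance d. This makes the kernel continuous in h uniformly on the line. -/
lemma abs_exp_neg_sub_le {x y : ℝ} (hx : 0 < x) (hxy : x ≤ y) :
    |Real.exp (-x) - Real.exp (-y)| ≤ (y - x) / x := by
  have h1 : Real.exp (-y) ≤ Real.exp (-x) := Real.exp_le_exp.2 (by linarith)
  rw [abs_of_nonneg (by linarith)]
  have h2 : Real.exp (-y) = Real.exp (-x) * Real.exp (-(y - x)) := by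
    rw [← Real.exp_add]; ring_nf
  have h3 := Real.add_one_le_exp (-(y - x))
  have h4 : Real.exp (-x) * x ≤ 1 := by
    have := Real.add_one_le_exp x
    rw [Real.exp_neg, inv_mul_le_iff₀ (Real.exp_pos x)]
    linarith
  rw [le_div_iff₀ hx, h2]
  have h5 : Real.exp (-x) - Real.exp (-x) * Real.exp (-(y - x)) ≤ Real.exp (-x) * (y - x) := by
    nlinarith [Real.exp_pos (-x)]
  nlinarith [sub_nonneg.2 hxy]

lemma norm_expKer_sub_le {h h' : ℝ} (hh : 0 < h) (hh' : h ≤ h') (x y : ℝ) :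
    ‖expKer h x y - expKer h' x y‖ ≤ (h' - h) / h := by
  have h0 : 0 ≤ (h' - h) / h := div_nonneg (sub_nonneg.2 hh') hh.le
  rcases lt_trichotomy x y with hxy | rfl | hxy
  · simpa [expKer_eq_zero hxy] using h0
  · simpa [expKer] using h0
  · rw [expKer_eq_of_lt hxy, expKer_eq_of_lt hxy, ← Complex.ofReal_sub, Complex.norm_real,
      Real.norm_eq_abs]
    have hd : 0 < x - y := sub_pos.2 hxy
    refine (abs_exp_neg_sub_le (mul_pos hh hd) (by gcongr)).trans_eq ?_
    field_simp

lemma norm_volterraC_sub_le {h h' : ℝ} (hh : 0 < h) (hh' : 0 < h') (Q : 𝓢(ℝ, ℂ)) :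
    ‖volterraC h' hh' Q - volterraC h hh Q‖ ≤ (∫ y, ‖Q y‖) * (|h' - h| / min h h') := by
  have hm : 0 < min h h' := lt_min hh hh'
  have hk : ∀ x y, ‖expKer h' x y - expKer h x y‖ ≤ |h' - h| / min h h' := fun x y => by
    rcases le_total h h' with hle | hle
    · rw [norm_sub_rev, min_eq_left hle, abs_of_nonneg (sub_nonneg.2 hle)]
      exact norm_expKer_sub_le hh hle x y
    · rw [min_eq_right hle, abs_sub_comm, abs_of_nonneg (sub_nonneg.2 hle)]
      exact norm_expKer_sub_le hh' hle x y
  have hQ : 0 ≤ ∫ y, ‖Q y‖ := by positivity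
  refine ContinuousLinearMap.opNorm_le_bound _ (by positivity) fun b => ?_
  refine (norm_le (by positivity)).2 fun x => ?_
  rw [_root_.sub_apply, BoundedContinuousFunction.sub_apply, volterraC_apply, volterraC_apply,
    ← integral_sub (integrable_expKer_mul hh' x (integrable_schwartz_mul Q b))
      (integrable_expKer_mul hh x (integrable_schwartz_mul Q b)), mul_assoc, ← integral_mul_const]
  refine norm_integral_le_of_norm_le (Q.integrable.norm.mul_const _) (.of_forall fun y => ?_)
  rw [← sub_mul, norm_mul, norm_mul]
  calc ‖expKer h' x y - expKer h x y‖ * (‖Q y‖ * ‖b y‖)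
      ≤ |h' - h| / min h h' * (‖Q y‖ * ‖b‖) := by
        gcongr
        · exact hk x y
        · exact b.norm_coe_le_norm y
    _ = _ := by ring

lemma norm_resolv_le {z : ℝ} (hz : z ≠ 0) : ‖resolv z‖ ≤ |z|⁻¹ := by
  refine norm_fourierMult_le (by positivity) (bddSymbol_inv hz).1 fun ξ => ?_
  rw [norm_inv]
  exact inv_anti₀ (abs_pos.2 hz) (symbol_norm_ge z ξ)

lemma memLp_schwartz_mul (Q : 𝓢(ℝ, ℂ)) (b : ℝ →ᵇ ℂ) : MemLp (fun y => Q y * b y) 2 :=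
  ((Q.memLp 2).norm.mul_const ‖b‖).mono (Q.continuous.mul b.continuous).aestronglyMeasurable
    (.of_forall fun y => by
      rw [Pi.mul_apply, norm_mul, Real.norm_of_nonneg (by positivity)]
      exact mul_le_mul_of_nonneg_left (b.norm_coe_le_norm y) (norm_nonneg (Q y)))

lemma norm_toLp_schwartz_mul_le (Q : 𝓢(ℝ, ℂ)) (b : ℝ →ᵇ ℂ) :
    ‖(memLp_schwartz_mul Q b).toLp‖ ≤ ‖b‖ * ‖Q.toLp 2‖ := by
  refine Lp.norm_le_mul_norm_of_ae_le_mul ?_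
  filter_upwards [(memLp_schwartz_mul Q b).coeFn_toLp, Q.coeFn_toLp 2] with y h1 h2
  rw [h1, h2, norm_mul, mul_comm]
  gcongr
  exact b.norm_coe_le_norm y

lemma volterraC_ae_eq {h : ℝ} (hh : 0 < h) (Q : 𝓢(ℝ, ℂ)) (b : ℝ →ᵇ ℂ) :
    resolv h (memLp_schwartz_mul Q b).toLp =ᵐ[volume] volterraC h hh Q b := by
  filter_upwards [resolv_pos_ae_eq hh (memLp_schwartz_mul Q b).toLp] with x hx
  rw [hx, volterraC_apply]
  refine integral_congr_ae ?_
  filter_upwards [(memLp_schwartz_mul Q b).coeFn_toLp] with y hy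
  rw [hy]

lemma integral_norm_schwartz_mul_le (R : 𝓢(ℝ, ℂ)) {c : ℝ → ℂ} {u : L2} (hu : u =ᵐ[volume] c) :
    ∫ y, ‖R y * c y‖ ≤ ‖R.toLp 2‖ * ‖u‖ := by
  have h1 := integral_norm_mul_le u (R.toLp 2)
  have h2 : ∫ y, ‖R y * c y‖ = ∫ y, ‖(R.toLp 2 : L2) y * conj (u y)‖ := by
    refine integral_congr_ae ?_
    filter_upwards [R.coeFn_toLp 2, hu] with y h2 h3
    rw [h2, h3, norm_mul, norm_mul, RCLike.norm_conj]
  rw [h2, mul_comm]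
  exact h1

lemma norm_volterraJ_apply_le (R : 𝓢(ℝ, ℂ)) (c : ℝ →ᵇ ℂ) {u : L2} (hu : ⇑u =ᵐ[volume] ⇑c) (x : ℝ) :
    ‖volterraJ R c x‖ ≤ ‖R.toLp 2‖ * ‖u‖ := by
  rw [volterraJ_apply]
  refine (norm_integral_le_integral_norm _).trans
    (le_trans ?_ (integral_norm_schwartz_mul_le R hu))
  exact setIntegral_le_integral (integrable_schwartz_mul R c).norm
    (.of_forall fun _ => norm_nonneg _)

/-- The estimate uses L² norms, although each operator alone is bounded through an L¹ norm. The
inner function is (∂ + h)⁻¹(Qb), whose L² norm is at most ‖Q‖‖b‖/h, and its pairing with R is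
controlled by Cauchy-Schwarz. Hence smallness in L² suffices for the Neumann series. -/
lemma norm_volterraJ_comp_volterraC_le {h : ℝ} (hh : 0 < h) (Q R : 𝓢(ℝ, ℂ)) :
    ‖volterraJ R ∘L volterraC h hh Q‖ ≤ ‖R.toLp 2‖ * ‖Q.toLp 2‖ / h := by
  refine ContinuousLinearMap.opNorm_le_bound _ (by positivity) fun b => ?_
  refine (norm_le (by positivity)).2 fun x => ?_
  have hu : ‖resolv h (memLp_schwartz_mul Q b).toLp‖ ≤ |h|⁻¹ * (‖b‖ * ‖Q.toLp 2‖) :=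
    (ContinuousLinearMap.le_opNorm _ _).trans
      (mul_le_mul (norm_resolv_le hh.ne') (norm_toLp_schwartz_mul_le Q b) (norm_nonneg _)
        (by positivity))
  rw [ContinuousLinearMap.comp_apply]
  refine (norm_volterraJ_apply_le R _ (volterraC_ae_eq hh Q b) x).trans ?_
  refine (mul_le_mul_of_nonneg_left hu (norm_nonneg _)).trans_eq ?_
  rw [abs_of_pos hh]
  field_simp

end JostOperators

/-! ### Jost solutions and the inverse transmission coefficient -/

section Jost

open Set Filter Topology

/-- The smallness condition on the potentials `Q`, `R` at the spectral parameter `h > 0`. -/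
structure Small (h : ℝ) (Q R : 𝓢(ℝ, ℂ)) : Prop where
  left : ‖Q.toLp 2‖ ^ 2 ≤ h / 2
  right : ‖R.toLp 2‖ ^ 2 ≤ h / 2

/-- The second component of the Jost solution normalised at `-∞`, up to the factor `e^{hx}`. -/
def jb {h : ℝ} (hh : 0 < h) (Q R : 𝓢(ℝ, ℂ)) : BoundedContinuousFunction ℝ ℂ :=
  Ring.inverse (1 - volterraJ R ∘L volterraC (2 * h) (mul_pos two_pos hh) Q)
    (BoundedContinuousFunction.const ℝ 1)

/-- The first component of the Jost solution normalised at `-∞`, up to the factor `e^{hx}`. -/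
def jc {h : ℝ} (hh : 0 < h) (Q R : 𝓢(ℝ, ℂ)) : BoundedContinuousFunction ℝ ℂ :=
  volterraC (2 * h) (mul_pos two_pos hh) Q (jb hh Q R)

/-- The inverse transmission coefficient. -/
def ja {h : ℝ} (hh : 0 < h) (Q R : 𝓢(ℝ, ℂ)) : ℂ := 1 + ∫ x, R x * jc hh Q R x

variable {h : ℝ} (hh : 0 < h) {Q R : 𝓢(ℝ, ℂ)}

lemma Small.norm_le (hh : 0 < h) (hs : Small h Q R) :
    ‖volterraJ R ∘L volterraC (2 * h) (mul_pos two_pos hh) Q‖ ≤ 1 / 4 := by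
  refine (norm_volterraJ_comp_volterraC_le (mul_pos two_pos hh) Q R).trans ?_
  rw [div_le_iff₀ (mul_pos two_pos hh)]
  -- The product ‖R‖‖Q‖ is at most h/2, half the sum of the squares, and it is divided by 2h.
  nlinarith [hs.left, hs.right, sq_nonneg (‖R.toLp 2‖ - ‖Q.toLp 2‖)]

lemma Small.isUnit (hh : 0 < h) (hs : Small h Q R) :
    IsUnit (1 - volterraJ R ∘L volterraC (2 * h) (mul_pos two_pos hh) Q) :=
  isUnit_one_sub_of_norm_lt_one
    (x := (volterraJ R ∘L volterraC (2 * h) (mul_pos two_pos hh) Q :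
      BoundedContinuousFunction ℝ ℂ →L[ℂ] BoundedContinuousFunction ℝ ℂ))
    ((hs.norm_le hh).trans_lt (by norm_num))

/-- The Volterra equation of the second component: c is eliminated from c' + 2hc = Qb and b' = Rc
with c → 0 and b → 1 at -∞. -/
lemma jb_eq (hs : Small h Q R) :
    jb hh Q R = BoundedContinuousFunction.const ℝ 1 + volterraJ R (jc hh Q R) := by
  have h1 := Ring.mul_inverse_cancel _ (hs.isUnit hh)
  have h2 := congrArg (fun T => T (BoundedContinuousFunction.const ℝ (1 : ℂ))) h1
  rw [← sub_eq_iff_eq_add]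
  exact h2

lemma jb_apply (hs : Small h Q R) (x : ℝ) :
    jb hh Q R x = 1 + ∫ t in Iic x, R t * jc hh Q R t := by
  conv_lhs => rw [jb_eq hh hs]
  rfl

lemma jc_apply (x : ℝ) :
    jc hh Q R x = ∫ y, expKer (2 * h) x y * (Q y * jb hh Q R y) := rfl

lemma hasDerivAt_jb (hs : Small h Q R) (x : ℝ) :
    HasDerivAt (jb hh Q R) (R x * jc hh Q R x) x := by
  have := (hasDerivAt_integral_Iic (g := fun t => R t * jc hh Q R t) (by fun_prop)
    (fun _ => (integrable_schwartz_mul R _).integrableOn) x).const_add 1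
  exact this.congr_of_eventuallyEq (.of_forall fun y => jb_apply hh hs y)

lemma hasDerivAt_jc (x : ℝ) :
    HasDerivAt (jc hh Q R) (Q x * jb hh Q R x - 2 * h * jc hh Q R x) x := by
  refine (hasDerivAt_integral_expKer (mul_pos two_pos hh) (g := fun y => Q y * jb hh Q R y)
    (by fun_prop) (integrable_schwartz_mul Q _) x).congr_deriv ?_
  rw [jc_apply]
  push_cast
  ring

/-- Operator norm 1/4 gives ‖b‖ ≤ 1 + ‖b‖/4, hence ‖b‖ ≤ 4/3 and ‖b - 1‖ ≤ ‖b‖/4 ≤ 1/3. This bound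
provides all later nonvanishing and the use of the principal logarithm. -/
lemma norm_jb_sub_one_le (hs : Small h Q R) (x : ℝ) : ‖jb hh Q R x - 1‖ ≤ 1 / 3 := by
  set b := jb hh Q R with hb
  have h1 : ‖volterraJ R (jc hh Q R)‖ ≤ 1 / 4 * ‖b‖ :=
    ((volterraJ R ∘L volterraC (2 * h) (mul_pos two_pos hh) Q).le_opNorm b).trans
      (mul_le_mul_of_nonneg_right (hs.norm_le hh) (norm_nonneg _))
  have h2 : ‖b‖ ≤ 1 + 1 / 4 * ‖b‖ := by
    calc ‖b‖ = ‖BoundedContinuousFunction.const ℝ (1 : ℂ) + volterraJ R (jc hh Q R)‖ := by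
          rw [hb, ← jb_eq hh hs]
      _ ≤ ‖BoundedContinuousFunction.const ℝ (1 : ℂ)‖ + ‖volterraJ R (jc hh Q R)‖ := norm_add_le _ _
      _ ≤ 1 + 1 / 4 * ‖b‖ := by
          gcongr
          exact (BoundedContinuousFunction.norm_const_le _).trans (by simp)
  have h3 : b x - 1 = volterraJ R (jc hh Q R) x := by
    rw [hb, jb_apply hh hs, volterraJ_apply]
    ring
  rw [h3]
  refine (BoundedContinuousFunction.norm_coe_le_norm _ x).trans (h1.trans ?_)
  linarith

lemma tendsto_jc_atBot : Tendsto (jc hh Q R) atBot (𝓝 0) := by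
  have := tendsto_integral_filter_of_dominated_convergence (l := atBot) (μ := volume)
    (F := fun x y => expKer (2 * h) x y * (Q y * jb hh Q R y)) (f := fun _ => 0)
    (fun y => ‖Q y * jb hh Q R y‖)
    (.of_forall fun x => (integrable_expKer_mul (mul_pos two_pos hh) x
      (integrable_schwartz_mul Q _)).1)
    (.of_forall fun x => .of_forall fun y => ?_) (integrable_schwartz_mul Q _).norm
    (.of_forall fun y => ?_)
  · rw [integral_zero] at this
    exact this
  · rw [norm_mul]
    exact mul_le_of_le_one_left (norm_nonneg _) (norm_expKer_le_one (mul_pos two_pos hh) x y)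
  · refine tendsto_const_nhds.congr' ?_
    filter_upwards [eventually_lt_atBot y] with x hx
    rw [expKer_eq_zero hx, zero_mul]

lemma tendsto_jc_atTop : Tendsto (jc hh Q R) atTop (𝓝 0) := by
  have h2 : 0 < 2 * h := mul_pos two_pos hh
  have := tendsto_integral_filter_of_dominated_convergence (l := atTop) (μ := volume)
    (F := fun x y => expKer (2 * h) x y * (Q y * jb hh Q R y)) (f := fun _ => 0)
    (fun y => ‖Q y * jb hh Q R y‖)
    (.of_forall fun x => (integrable_expKer_mul h2 x (integrable_schwartz_mul Q _)).1)
    (.of_forall fun x => .of_forall fun y => ?_) (integrable_schwartz_mul Q _).norm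
    (.of_forall fun y => ?_)
  · rw [integral_zero] at this
    exact this
  · rw [norm_mul]
    exact mul_le_of_le_one_left (norm_nonneg _) (norm_expKer_le_one h2 x y)
  · have h3 : Tendsto (fun x => expKer (2 * h) x y) atTop (𝓝 0) := by
      rw [tendsto_zero_iff_norm_tendsto_zero]
      refine squeeze_zero (fun _ => norm_nonneg _) (fun x => norm_expKer_le (2 * h) x y) ?_
      refine Real.tendsto_exp_atBot.comp (tendsto_neg_atTop_atBot.comp ?_)
      refine Tendsto.const_mul_atTop h2 (tendsto_abs_atTop_atTop.comp ?_)
      exact tendsto_atTop_add_const_right _ (-y) tendsto_id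
    simpa using h3.mul_const (Q y * jb hh Q R y)

lemma tendsto_jb_atTop (hs : Small h Q R) : Tendsto (jb hh Q R) atTop (𝓝 (ja hh Q R)) := by
  have h1 := (aecover_Iic (μ := volume) (tendsto_id (α := ℝ) (x := atTop)))
    |>.integral_tendsto_of_countably_generated (integrable_schwartz_mul R (jc hh Q R))
  exact (h1.const_add 1).congr fun x => (jb_apply hh hs x).symm

lemma tendsto_jb_atBot (hs : Small h Q R) : Tendsto (jb hh Q R) atBot (𝓝 1) := by
  have hi := integrable_schwartz_mul R (jc hh Q R)
  have h1 : Tendsto (fun x : ℝ => ∫ t in Iic x, R t * jc hh Q R t) atBot (𝓝 0) := by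
    simp_rw [← integral_indicator measurableSet_Iic]
    rw [← integral_zero ℝ ℂ (μ := volume)]
    refine tendsto_integral_filter_of_dominated_convergence (fun t => ‖R t * jc hh Q R t‖)
      (.of_forall fun x => hi.1.indicator measurableSet_Iic)
      (.of_forall fun x => .of_forall fun t => norm_indicator_le_norm_self _ _) hi.norm
      (.of_forall fun t => ?_)
    refine tendsto_const_nhds.congr' ?_
    filter_upwards [eventually_lt_atBot t] with x hx
    rw [indicator_of_notMem (by simpa using hx)]
  have h2 := (h1.const_add 1).congr fun x => (jb_apply hh hs x).symm
  simpa using h2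

lemma integrable_integral_expKer_mul {h : ℝ} (hh : 0 < h) {g : ℝ → ℂ} (hgc : Continuous g) (hg : Integrable g) :
    Integrable fun x => ∫ y, expKer h x y * g y := by
  have hm : AEStronglyMeasurable (fun p : ℝ × ℝ => expKer h p.1 p.2 * g p.2)
      (volume.prod volume) :=
    ((measurable_expKer h).mul (hgc.measurable.comp measurable_snd)).aestronglyMeasurable
  have hb : ∀ y, Integrable fun x => expKer h x y := fun y => by
    refine (integrable_exp_neg_abs hh y).mono
      ((measurable_expKer h).comp measurable_prodMk_right).aestronglyMeasurable
      (.of_forall fun x => ?_)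
    rw [Real.norm_of_nonneg (Real.exp_nonneg _), abs_sub_comm]
    exact norm_expKer_le h x y
  refine Integrable.integral_prod_left ((integrable_prod_iff' hm).2 ⟨.of_forall fun y => ?_, ?_⟩)
  · exact (hb y).mul_const (g y)
  · refine (hg.norm.const_mul (2 / h)).mono hm.norm.prod_swap.integral_prod_right' (.of_forall fun y => ?_)
    change ‖∫ x, ‖expKer h x y * g y‖‖ ≤ _
    simp only [norm_mul, integral_mul_const, norm_norm]
    rw [Real.norm_of_nonneg (r := 2 / h) (by positivity),
      Real.norm_of_nonneg (integral_nonneg fun _ => norm_nonneg _)]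
    gcongr
    rw [← integral_exp_neg_abs hh y]
    refine integral_mono (hb y).norm (integrable_exp_neg_abs hh y) fun x => ?_
    dsimp only
    rw [abs_sub_comm]
    exact norm_expKer_le h x y

lemma integrable_jc : Integrable (jc hh Q R) :=
  integrable_integral_expKer_mul (mul_pos two_pos hh) (g := fun y => Q y * jb hh Q R y)
    (by fun_prop) (integrable_schwartz_mul Q _)

/-- The reflection `x ↦ Q(-x)`. -/
def refl (Q : 𝓢(ℝ, ℂ)) : 𝓢(ℝ, ℂ) :=
  SchwartzMap.compCLMOfContinuousLinearEquiv ℂ (ContinuousLinearEquiv.neg ℝ) Q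

@[simp] lemma refl_apply (Q : 𝓢(ℝ, ℂ)) (x : ℝ) : refl Q x = Q (-x) := rfl

lemma norm_toLp_refl (Q : 𝓢(ℝ, ℂ)) : ‖(refl Q).toLp 2‖ = ‖Q.toLp 2‖ := by
  have h1 : ∀ Q : 𝓢(ℝ, ℂ), ‖Q.toLp 2‖ₑ ^ 2 = ∫⁻ x, ‖Q x‖ₑ ^ 2 := fun Q => by
    rw [enorm_L2_sq]
    refine lintegral_congr_ae ?_
    filter_upwards [Q.coeFn_toLp 2] with x hx
    rw [hx]
  have h2 : ‖(refl Q).toLp 2‖ₑ ^ 2 = ‖Q.toLp 2‖ₑ ^ 2 := by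
    rw [h1, h1, ← MeasureTheory.lintegral_neg_eq_self (μ := volume) fun x => ‖Q x‖ₑ ^ 2]
    rfl
  rw [enorm_sq_eq_ofReal, enorm_sq_eq_ofReal, ENNReal.ofReal_eq_ofReal_iff (by positivity)
    (by positivity)] at h2
  exact (sq_eq_sq₀ (norm_nonneg _) (norm_nonneg _)).1 h2

/-- If u solves the system for (Q, R), then (u₂(-x), -u₁(-x)) solves it for the reflected pair
(R(-x), Q(-x)). So the Jost solution at +∞ can be obtained from the one at -∞, with no second
construction. -/
lemma Small.refl (hs : Small h Q R) : Small h (refl R) (refl Q) :=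
  ⟨by rw [norm_toLp_refl]; exact hs.right, by rw [norm_toLp_refl]; exact hs.left⟩

/-- The first component of the Jost solution normalised at `+∞`, up to the factor `e^{-hx}`. -/
def rb {h : ℝ} (hh : 0 < h) (Q R : 𝓢(ℝ, ℂ)) (x : ℝ) : ℂ := jb hh (refl R) (refl Q) (-x)

/-- The second component of the Jost solution normalised at `+∞`, up to the factor `e^{-hx}`. -/
def rs {h : ℝ} (hh : 0 < h) (Q R : 𝓢(ℝ, ℂ)) (x : ℝ) : ℂ := -jc hh (refl R) (refl Q) (-x)

@[fun_prop] lemma continuous_rb : Continuous (rb hh Q R) := by unfold rb; fun_prop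

@[fun_prop] lemma continuous_rs : Continuous (rs hh Q R) := by unfold rs; fun_prop

lemma norm_rb_le (x : ℝ) : ‖rb hh Q R x‖ ≤ ‖jb hh (refl R) (refl Q)‖ :=
  BoundedContinuousFunction.norm_coe_le_norm _ _

lemma norm_rs_le (x : ℝ) : ‖rs hh Q R x‖ ≤ ‖jc hh (refl R) (refl Q)‖ := by
  rw [rs, norm_neg]
  exact BoundedContinuousFunction.norm_coe_le_norm _ _

lemma integrable_rs : Integrable (rs hh Q R) := (integrable_jc hh).comp_neg.neg

lemma norm_rb_sub_one_le (hs : Small h Q R) (x : ℝ) : ‖rb hh Q R x - 1‖ ≤ 1 / 3 :=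
  norm_jb_sub_one_le hh hs.refl _

lemma hasDerivAt_rb (hs : Small h Q R) (x : ℝ) :
    HasDerivAt (rb hh Q R) (Q x * rs hh Q R x) x := by
  refine ((hasDerivAt_jb hh hs.refl (-x)).scomp x (hasDerivAt_neg x)).congr_deriv ?_
  simp [rs]

lemma hasDerivAt_rs (x : ℝ) :
    HasDerivAt (rs hh Q R) (2 * h * rs hh Q R x + R x * rb hh Q R x) x := by
  refine ((hasDerivAt_jc hh (Q := refl R) (R := refl Q) (-x)).scomp x
    (hasDerivAt_neg x)).neg.congr_deriv ?_
  simp [rs, rb]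
  ring

lemma tendsto_rb_atTop (hs : Small h Q R) : Tendsto (rb hh Q R) atTop (𝓝 1) :=
  (tendsto_jb_atBot hh hs.refl).comp tendsto_neg_atTop_atBot

lemma tendsto_rb_atBot (hs : Small h Q R) :
    Tendsto (rb hh Q R) atBot (𝓝 (ja hh (refl R) (refl Q))) :=
  (tendsto_jb_atTop hh hs.refl).comp tendsto_neg_atBot_atTop

lemma integrable_schwartz_mul_of_bdd (Q : 𝓢(ℝ, ℂ)) {g : ℝ → ℂ} (hg : Continuous g) {C : ℝ}
    (hC : ∀ x, ‖g x‖ ≤ C) : Integrable fun x => Q x * g x :=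
  Q.integrable.mul_bdd hg.aestronglyMeasurable (.of_forall hC)

/-! ### Wronskian identities -/

section Wronskian

variable {h' : ℝ} (hh' : 0 < h') {Q' R' : 𝓢(ℝ, ℂ)}

lemma integrable_R_jc_rb (S : 𝓢(ℝ, ℂ)) (c : BoundedContinuousFunction ℝ ℂ) :
    Integrable fun x => S x * c x * rb hh Q R x :=
  (integrable_schwartz_mul S c).mul_bdd (continuous_rb hh).aestronglyMeasurable
    (.of_forall (norm_rb_le hh))

lemma integrable_Q_jb_rs (S : 𝓢(ℝ, ℂ)) (b : BoundedContinuousFunction ℝ ℂ) :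
    Integrable fun x => S x * b x * rs hh Q R x :=
  (integrable_schwartz_mul S b).mul_bdd (continuous_rs hh).aestronglyMeasurable
    (.of_forall (norm_rs_le hh))

lemma integrable_jc_rs (c : BoundedContinuousFunction ℝ ℂ) :
    Integrable fun x => c x * rs hh Q R x :=
  (integrable_rs hh).bdd_mul c.continuous.aestronglyMeasurable
    (.of_forall c.norm_coe_le_norm)

/-- The left solution belongs to the primed parameters and the right one to the unprimed ones. All
products common to both systems cancel, so the derivative is linear in the differences of the
parameters. -/
lemma hasDerivAt_wronskian (hs : Small h Q R) (hs' : Small h' Q' R') (x : ℝ) :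
    HasDerivAt (fun x => jb hh' Q' R' x * rb hh Q R x - jc hh' Q' R' x * rs hh Q R x)
      (((R' - R) x * jc hh' Q' R' x * rb hh Q R x - (Q' - Q) x * jb hh' Q' R' x * rs hh Q R x)
        + 2 * (h' - h) * (jc hh' Q' R' x * rs hh Q R x)) x := by
  refine (((hasDerivAt_jb hh' hs' x).mul (hasDerivAt_rb hh hs x)).sub
    ((hasDerivAt_jc hh' x).mul (hasDerivAt_rs hh x))).congr_deriv ?_
  simp only [sub_apply]
  ring

/-- Integrate the derivative of the Wronskian over the line. The products of c with c₊ vanish at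
both ends, leaving a' at +∞ and the limit of b₊ at -∞. -/
lemma ja_sub_ja_refl (hs : Small h Q R) (hs' : Small h' Q' R') :
    ja hh' Q' R' - ja hh (refl R) (refl Q) =
      (∫ x, (R' - R) x * jc hh' Q' R' x * rb hh Q R x)
        - (∫ x, (Q' - Q) x * jb hh' Q' R' x * rs hh Q R x)
        + 2 * (h' - h) * ∫ x, jc hh' Q' R' x * rs hh Q R x := by
  have i1 := integrable_R_jc_rb hh (Q := Q) (R := R) (R' - R) (jc hh' Q' R')
  have i2 := integrable_Q_jb_rs hh (Q := Q) (R := R) (Q' - Q) (jb hh' Q' R')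
  have i12 : Integrable fun x => (R' - R) x * jc hh' Q' R' x * rb hh Q R x
      - (Q' - Q) x * jb hh' Q' R' x * rs hh Q R x := i1.sub i2
  have i3 := (integrable_jc_rs hh (Q := Q) (R := R) (jc hh' Q' R')).const_mul (2 * (h' - h) : ℂ)
  have lim1 : Tendsto (fun x => jc hh' Q' R' x * rs hh Q R x) atTop (𝓝 0) := by
    refine (tendsto_jc_atTop hh').zero_mul_isBoundedUnder_le ?_
    exact isBoundedUnder_of ⟨_, norm_rs_le hh⟩
  have lim2 : Tendsto (fun x => jc hh' Q' R' x * rs hh Q R x) atBot (𝓝 0) := by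
    refine (tendsto_jc_atBot hh').zero_mul_isBoundedUnder_le ?_
    exact isBoundedUnder_of ⟨_, norm_rs_le hh⟩
  have := integral_of_hasDerivAt_of_tendsto (hasDerivAt_wronskian hh hh' hs hs')
    (i12.add i3)
    (((tendsto_jb_atBot hh' hs').mul (tendsto_rb_atBot hh hs)).sub lim2)
    (((tendsto_jb_atTop hh' hs').mul (tendsto_rb_atTop hh hs)).sub lim1)
  rw [integral_add i12 i3, integral_sub i1 i2, integral_const_mul] at this
  rw [this]
  ring

/-- Equal parameters make the right-hand side of `ja_sub_ja_refl` vanish: both Jost solutions define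
the same coefficient. -/
lemma ja_refl (hs : Small h Q R) : ja hh (refl R) (refl Q) = ja hh Q R := by
  have := ja_sub_ja_refl hh hh hs hs
  simp only [sub_self, zero_apply, zero_mul, integral_zero, mul_zero, add_zero] at this
  exact (sub_eq_zero.1 this).symm

lemma wronskian_eq (hs : Small h Q R) (x : ℝ) :
    jb hh Q R x * rb hh Q R x - jc hh Q R x * rs hh Q R x = ja hh Q R := by
  have hd : ∀ x, HasDerivAt (fun x => jb hh Q R x * rb hh Q R x - jc hh Q R x * rs hh Q R x) 0 x :=
    fun x => (hasDerivAt_wronskian hh hh hs hs x).congr_deriv (by simp)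
  have hc := is_const_of_deriv_eq_zero (fun x => (hd x).differentiableAt) (fun x => (hd x).deriv)
  have lim1 : Tendsto (fun x => jc hh Q R x * rs hh Q R x) atTop (𝓝 0) := by
    refine (tendsto_jc_atTop hh).zero_mul_isBoundedUnder_le ?_
    exact isBoundedUnder_of ⟨_, norm_rs_le hh⟩
  have := (((tendsto_jb_atTop hh hs).mul (tendsto_rb_atTop hh hs)).sub lim1)
  rw [mul_one, sub_zero] at this
  exact tendsto_nhds_unique (tendsto_const_nhds.congr fun y => hc x y) this

/-- An exact difference formula without a remainder; every derivative of a is read off from it. -/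
lemma ja_sub_ja (hs : Small h Q R) (hs' : Small h' Q' R') :
    ja hh' Q' R' - ja hh Q R =
      (∫ x, (R' - R) x * jc hh' Q' R' x * rb hh Q R x)
        - (∫ x, (Q' - Q) x * jb hh' Q' R' x * rs hh Q R x)
        + 2 * (h' - h) * ∫ x, jc hh' Q' R' x * rs hh Q R x := by
  rw [← ja_refl hh hs, ja_sub_ja_refl hh hh' hs hs']

end Wronskian

end Jost

/-! ### The Birman-Schwinger operator and the inverse of the Lax operator -/

section Resolvent

open Set Filter Topology

variable {h : ℝ} (hh : 0 < h) {Q R : 𝓢(ℝ, ℂ)}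

lemma integral_norm_sq_eq (Q : 𝓢(ℝ, ℂ)) : ∫ x, ‖Q x‖ ^ 2 = ‖Q.toLp 2‖ ^ 2 := by
  rw [← lintegral_norm_rpow_two]
  refine integral_congr_ae ?_
  filter_upwards [Q.coeFn_toLp 2] with x hx
  rw [hx]
  norm_cast

lemma Small.hsNorm_left_le (hh : 0 < h) (hs : Small h Q R) : hsNorm (resolvMul h Q) ≤ 1 / 2 := by
  have h1 := hsNorm_resolvMul_sq_pos hh Q
  have h2 : 1 / (2 * h) * ∫ y, ‖Q y‖ ^ 2 ≤ 1 / (2 * h) * (h / 2) := by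
    rw [integral_norm_sq_eq]
    gcongr
    exact hs.left
  have h3 : 1 / (2 * h) * (h / 2) = 1 / 4 := by field_simp; norm_num
  exact abs_le_of_sq_le_sq' (by rw [h1]; linarith) (by norm_num) |>.2

lemma Small.hsNorm_right_le (hh : 0 < h) (hs : Small h Q R) :
    hsNorm (resolvMul (-h) R) ≤ 1 / 2 := by
  have h1 := hsNorm_resolvMul_sq_neg hh R
  have h2 : 1 / (2 * h) * ∫ y, ‖R y‖ ^ 2 ≤ 1 / (2 * h) * (h / 2) := by
    rw [integral_norm_sq_eq]
    gcongr
    exact hs.right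
  have h3 : 1 / (2 * h) * (h / 2) = 1 / 4 := by field_simp; norm_num
  exact abs_le_of_sq_le_sq' (by rw [h1]; linarith) (by norm_num) |>.2

/-- The Birman-Schwinger operator `(∂ + h)⁻¹ Q (∂ - h)⁻¹ R`. -/
def birman (h : ℝ) (Q R : 𝓢(ℝ, ℂ)) : L2 →L[ℂ] L2 := resolvMul h Q ∘L resolvMul (-h) R

lemma Small.norm_birman_le (hh : 0 < h) (hs : Small h Q R) : ‖birman h Q R‖ ≤ 1 / 4 := by
  refine (ContinuousLinearMap.opNorm_comp_le _ _).trans ?_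
  have h1 := ((isHilbertSchmidt_resolvMul hh.ne' Q).norm_le).trans (hs.hsNorm_left_le hh)
  have h2 := ((isHilbertSchmidt_resolvMul (neg_ne_zero.2 hh.ne') R).norm_le).trans
    (hs.hsNorm_right_le hh)
  calc ‖resolvMul h Q‖ * ‖resolvMul (-h) R‖ ≤ 1 / 2 * (1 / 2) := by gcongr
    _ = 1 / 4 := by norm_num

lemma Small.isUnit_birman (hh : 0 < h) (hs : Small h Q R) : IsUnit (1 - birman h Q R) :=
  isUnit_one_sub_of_norm_lt_one (x := (birman h Q R : L2 →L[ℂ] L2))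
    ((hs.norm_birman_le hh).trans_lt (by norm_num))

/-- The inverse of the Lax operator `[[∂ + h, -Q], [-R, ∂ - h]]`. -/
def solOp (h : ℝ) (Q R : 𝓢(ℝ, ℂ)) : (L2 × L2) →L[ℂ] (L2 × L2) :=
  -- Substituting u₂ = (∂ - h)⁻¹(f₂ + Ru₁) into the first equation leaves (1 - B)u₁ = (∂ + h)⁻¹f₁ +
  -- (∂ + h)⁻¹Q(∂ - h)⁻¹f₂.
  let U := Ring.inverse (1 - birman h Q R) ∘L
    (resolv h ∘L ContinuousLinearMap.fst ℂ L2 L2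
      + resolvMul h Q ∘L resolv (-h) ∘L ContinuousLinearMap.snd ℂ L2 L2)
  U.prod (resolv (-h) ∘L ContinuousLinearMap.snd ℂ L2 L2 + resolvMul (-h) R ∘L U)

lemma eq_inverse_apply_iff {T : L2 →L[ℂ] L2} (hT : IsUnit (1 - T)) (u g : L2) :
    u = Ring.inverse (1 - T) g ↔ u = g + T u := by
  have h1 := Ring.mul_inverse_cancel _ hT
  have h2 := Ring.inverse_mul_cancel _ hT
  constructor
  · rintro rfl
    have := congrArg (fun S => S g) h1
    rw [← sub_eq_iff_eq_add]
    exact this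
  · intro hu
    have h3 : (1 - T) u = g := by
      change u - T u = g
      rw [sub_eq_iff_eq_add]
      exact hu
    have := congrArg (fun S => S u) h2
    rw [← h3]
    exact this.symm

lemma isSol_iff_eq_solOp (hh : 0 < h) (hs : Small h Q R) (u f : L2 × L2) :
    IsSol h Q R u f ↔ u = solOp h Q R f := by
  have h1 : ∀ u1 : L2, u1 = (solOp h Q R f).1 ↔
      u1 = resolv h f.1 + resolvMul h Q (resolv (-h) f.2) + birman h Q R u1 :=
    fun u1 => eq_inverse_apply_iff (hs.isUnit_birman hh) u1 _
  have h2 : (solOp h Q R f).2 = resolv (-h) f.2 + resolvMul (-h) R (solOp h Q R f).1 := rfl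
  have h3 : ∀ u1 : L2, birman h Q R u1 = resolvMul h Q (resolvMul (-h) R u1) := fun _ => rfl
  have h4 : IsSol h Q R u f ↔ u.1 = resolv h f.1 + resolvMul h Q u.2 ∧
      u.2 = resolv (-h) f.2 + resolvMul (-h) R u.1 := by
    unfold IsSol
    rw [map_add, map_add]
    rfl
  rw [h4, Prod.ext_iff]
  constructor
  · rintro ⟨e1, e2⟩
    have e : u.1 = (solOp h Q R f).1 := by
      rw [h1, h3, add_assoc, ← map_add, ← e2]
      exact e1
    exact ⟨e, by rw [h2, ← e]; exact e2⟩
  · rintro ⟨e1, e2⟩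
    have e3 : u.2 = resolv (-h) f.2 + resolvMul (-h) R u.1 := by rw [e2, h2, e1]
    refine ⟨?_, e3⟩
    have := (h1 u.1).1 e1
    rw [h3, add_assoc, ← map_add, ← e3] at this
    exact this

lemma isSol_of_ae_eq (hh : 0 < h) {u f : L2 × L2} {v₁ v₂ : ℝ → ℂ}
    (h1 : u.1 =ᵐ[volume] v₁) (h2 : u.2 =ᵐ[volume] v₂)
    (e1 : ∀ᵐ x, v₁ x = ∫ y, expKer h x y * (f.1 y + Q y * v₂ y))
    (e2 : ∀ᵐ x, v₂ x = ∫ y, -expKer h y x * (f.2 y + R y * v₁ y)) : IsSol h Q R u f := by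
  have k1 : (f.1 + mulOp Q u.2 : L2) =ᵐ[volume] fun y => f.1 y + Q y * v₂ y := by
    filter_upwards [Lp.coeFn_add f.1 (mulOp Q u.2), coeFn_mulOp (SchwartzMap.bdd Q) u.2, h2] with y a1 a2 a3
    rw [a1, Pi.add_apply, a2, a3]
  have k2 : (f.2 + mulOp R u.1 : L2) =ᵐ[volume] fun y => f.2 y + R y * v₁ y := by
    filter_upwards [Lp.coeFn_add f.2 (mulOp R u.1), coeFn_mulOp (SchwartzMap.bdd R) u.1, h1] with y a1 a2 a3
    rw [a1, Pi.add_apply, a2, a3]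
  constructor
  · refine Lp.ext ?_
    filter_upwards [h1, e1, resolv_pos_ae_eq hh (f.1 + mulOp Q u.2)] with x a1 a2 a3
    rw [a1, a2, a3]
    refine integral_congr_ae ?_
    filter_upwards [k1] with y hy
    rw [hy]
  · refine Lp.ext ?_
    filter_upwards [h2, e2, resolv_neg_ae_eq hh (f.2 + mulOp R u.1)] with x a1 a2 a3
    rw [a1, a2, a3]
    refine integral_congr_ae ?_
    filter_upwards [k2] with y hy
    rw [hy]

end Resolvent

/-! ### The Green's function built from the Jost solutions -/

section GreenFunction

open Set Filter Topology

variable {h : ℝ} (hh : 0 < h) {Q R : 𝓢(ℝ, ℂ)}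

lemma norm_ja_sub_one_le (hs : Small h Q R) : ‖ja hh Q R - 1‖ ≤ 1 / 3 :=
  le_of_tendsto ((tendsto_jb_atTop hh hs).sub_const 1).norm
    (.of_forall fun x => norm_jb_sub_one_le hh hs x)

lemma ne_zero_of_norm_sub_one_le {z : ℂ} (hz : ‖z - 1‖ ≤ 1 / 3) : z ≠ 0 := by
  rintro rfl
  norm_num at hz

lemma ja_ne_zero (hs : Small h Q R) : ja hh Q R ≠ 0 :=
  ne_zero_of_norm_sub_one_le (norm_ja_sub_one_le hh hs)

/-- The Green's function of `[[∂ + h, -Q], [-R, ∂ - h]]`. -/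
def greenFun (hh : 0 < h) (Q R : 𝓢(ℝ, ℂ)) (x z : ℝ) : Matrix (Fin 2) (Fin 2) ℂ :=
  (ja hh Q R)⁻¹ •
    (expKer h x z • !![rb hh Q R x * jb hh Q R z, -(rb hh Q R x * jc hh Q R z);
      rs hh Q R x * jb hh Q R z, -(rs hh Q R x * jc hh Q R z)]
    + expKer h z x • !![jc hh Q R x * rs hh Q R z, -(jc hh Q R x * rb hh Q R z);
      jb hh Q R x * rs hh Q R z, -(jb hh Q R x * rb hh Q R z)])

lemma greenFun_zero_zero (x z : ℝ) : greenFun hh Q R x z 0 0 = (ja hh Q R)⁻¹ *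
    (expKer h x z * (rb hh Q R x * jb hh Q R z) + expKer h z x * (jc hh Q R x * rs hh Q R z)) := by
  simp [greenFun]

lemma greenFun_zero_one (x z : ℝ) : greenFun hh Q R x z 0 1 = -(ja hh Q R)⁻¹ *
    (expKer h x z * (rb hh Q R x * jc hh Q R z) + expKer h z x * (jc hh Q R x * rb hh Q R z)) := by
  simp [greenFun]
  ring

lemma greenFun_one_zero (x z : ℝ) : greenFun hh Q R x z 1 0 = (ja hh Q R)⁻¹ *
    (expKer h x z * (rs hh Q R x * jb hh Q R z) + expKer h z x * (jb hh Q R x * rs hh Q R z)) := by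
  simp [greenFun]

lemma greenFun_one_one (x z : ℝ) : greenFun hh Q R x z 1 1 = -(ja hh Q R)⁻¹ *
    (expKer h x z * (rs hh Q R x * jc hh Q R z) + expKer h z x * (jb hh Q R x * rb hh Q R z)) := by
  simp [greenFun]
  ring

/-- Both exponential kernels are e^{-h|x - z|} on their half planes, so agreement of F₁ and F₂ on
the diagonal removes the jump; the value 1/2 there is the mean of the two sides. -/
lemma continuous_expKer_glue (h : ℝ) {F₁ F₂ : ℝ × ℝ → ℂ} (h1 : Continuous F₁)
    (h2 : Continuous F₂) (h12 : ∀ x, F₁ (x, x) = F₂ (x, x)) :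
    Continuous fun p : ℝ × ℝ => expKer h p.1 p.2 * F₁ p + expKer h p.2 p.1 * F₂ p := by
  have : (fun p : ℝ × ℝ => expKer h p.1 p.2 * F₁ p + expKer h p.2 p.1 * F₂ p) =
      fun p : ℝ × ℝ => (Real.exp (-(h * |p.1 - p.2|)) : ℂ) *
        (if p.2 ≤ p.1 then F₁ p else F₂ p) := by
    funext ⟨x, z⟩
    rcases lt_trichotomy x z with hxz | rfl | hxz
    · simp only [expKer_eq_zero hxz, expKer_eq_of_lt hxz, not_le.2 hxz, if_false]
      rw [abs_sub_comm, abs_of_pos (sub_pos.2 hxz)]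
      ring
    · have : expKer h x x = 1 / 2 := by simp [expKer, step]
      simp [this, h12 x]
      ring
    · simp only [expKer_eq_zero hxz, expKer_eq_of_lt hxz, hxz.le, if_true]
      rw [abs_of_pos (sub_pos.2 hxz)]
      ring
  rw [this]
  refine Continuous.mul (by fun_prop) (Continuous.if_le h1 h2 continuous_snd continuous_fst ?_)
  rintro ⟨x, z⟩ (rfl : z = x)
  exact h12 z

/-- The Green's function of `[[∂ + h, 0], [0, ∂ - h]]`. -/
def freeFun (h x z : ℝ) : Matrix (Fin 2) (Fin 2) ℂ := !![expKer h x z, 0; 0, -expKer h z x]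

lemma continuous_greenFun_sub (hs : Small h Q R) :
    Continuous fun p : ℝ × ℝ => greenFun hh Q R p.1 p.2 - freeFun h p.1 p.2 := by
  have ha := ja_ne_zero hh hs
  have hw := wronskian_eq hh hs
  refine continuous_matrix fun i j => ?_
  fin_cases i <;> fin_cases j
  -- Subtracting the free kernel subtracts a from the coefficient above the factor a⁻¹. Matching on
  -- the diagonal is then exactly the Wronskian identity; the off-diagonal entries match by
  -- symmetry.
  · have := (continuous_expKer_glue h (F₁ := fun p => rb hh Q R p.1 * jb hh Q R p.2 - ja hh Q R)
      (F₂ := fun p => jc hh Q R p.1 * rs hh Q R p.2) (by fun_prop) (by fun_prop)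
      fun x => by rw [← hw x]; ring).const_mul (ja hh Q R)⁻¹
    refine this.congr fun p => ?_
    simp [greenFun, freeFun]
    field_simp
    ring
  · have := (continuous_expKer_glue h (F₁ := fun p => rb hh Q R p.1 * jc hh Q R p.2)
      (F₂ := fun p => jc hh Q R p.1 * rb hh Q R p.2) (by fun_prop) (by fun_prop)
      fun x => by ring).const_mul (-(ja hh Q R)⁻¹)
    refine this.congr fun p => ?_
    simp [greenFun, freeFun]
    field_simp
    ring
  · have := (continuous_expKer_glue h (F₁ := fun p => rs hh Q R p.1 * jb hh Q R p.2)
      (F₂ := fun p => jb hh Q R p.1 * rs hh Q R p.2) (by fun_prop) (by fun_prop)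
      fun x => by ring).const_mul (ja hh Q R)⁻¹
    refine this.congr fun p => ?_
    simp [greenFun, freeFun]
  · have := (continuous_expKer_glue h (F₁ := fun p => rs hh Q R p.1 * jc hh Q R p.2)
      (F₂ := fun p => jb hh Q R p.1 * rb hh Q R p.2 - ja hh Q R) (by fun_prop) (by fun_prop)
      fun x => by rw [← hw x]; ring).const_mul (-(ja hh Q R)⁻¹)
    refine this.congr fun p => ?_
    simp [greenFun, freeFun]
    field_simp
    ring

lemma exists_norm_greenFun_le (hh : 0 < h) (Q R : 𝓢(ℝ, ℂ)) :
    ∃ C : ℝ, ∀ i j x z, ‖greenFun hh Q R x z i j‖ ≤ C * Real.exp (-(h * |x - z|)) := by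
  obtain ⟨M, hM0, hM⟩ : ∃ M : ℝ, 0 ≤ M ∧ ∀ x, ‖jb hh Q R x‖ ≤ M ∧ ‖jc hh Q R x‖ ≤ M ∧
      ‖rb hh Q R x‖ ≤ M ∧ ‖rs hh Q R x‖ ≤ M := by
    refine ⟨‖jb hh Q R‖ + ‖jc hh Q R‖ + ‖jb hh (refl R) (refl Q)‖ + ‖jc hh (refl R) (refl Q)‖,
      by positivity, fun x => ?_⟩
    have h1 := (jb hh Q R).norm_coe_le_norm x
    have h2 := (jc hh Q R).norm_coe_le_norm x
    have h3 := norm_rb_le hh (Q := Q) (R := R) x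
    have h4 := norm_rs_le hh (Q := Q) (R := R) x
    have p1 := norm_nonneg (jb hh Q R)
    have p2 := norm_nonneg (jc hh Q R)
    have p3 := norm_nonneg (jb hh (refl R) (refl Q))
    have p4 := norm_nonneg (jc hh (refl R) (refl Q))
    exact ⟨by linarith, by linarith, by linarith, by linarith⟩
  have key : ∀ (x z : ℝ) (d a1 a2 b1 b2 : ℂ), ‖a1‖ ≤ M → ‖a2‖ ≤ M → ‖b1‖ ≤ M → ‖b2‖ ≤ M →
      ‖d * (expKer h x z * (a1 * a2) + expKer h z x * (b1 * b2))‖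
        ≤ ‖d‖ * (2 * (M * M)) * Real.exp (-(h * |x - z|)) := by
    intro x z d a1 a2 b1 b2 h1 h2 h3 h4
    have e1 := norm_expKer_le h x z
    have e2 := norm_expKer_le h z x
    rw [abs_sub_comm] at e2
    rw [norm_mul, mul_assoc]
    gcongr
    refine (norm_add_le _ _).trans ?_
    simp only [norm_mul]
    calc _ ≤ Real.exp (-(h * |x - z|)) * (M * M) + Real.exp (-(h * |x - z|)) * (M * M) := by gcongr
      _ = _ := by ring
  refine ⟨‖(ja hh Q R)⁻¹‖ * (2 * (M * M)), fun i j x z => ?_⟩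
  obtain ⟨x1, x2, x3, x4⟩ := hM x
  obtain ⟨z1, z2, z3, z4⟩ := hM z
  fin_cases i <;> fin_cases j
  · simp only [Fin.zero_eta, greenFun_zero_zero]
    exact key _ _ _ _ _ _ _ x3 z1 x2 z4
  · simp only [Fin.zero_eta, Fin.mk_one, greenFun_zero_one]
    rw [← norm_neg (ja hh Q R)⁻¹]
    exact key _ _ _ _ _ _ _ x3 z2 x2 z3
  · simp only [Fin.zero_eta, Fin.mk_one, greenFun_one_zero]
    exact key _ _ _ _ _ _ _ x4 z1 x1 z4
  · simp only [Fin.mk_one, greenFun_one_one]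
    rw [← norm_neg (ja hh Q R)⁻¹]
    exact key _ _ _ _ _ _ _ x4 z2 x1 z3

lemma measurable_greenFun (i j : Fin 2) :
    Measurable fun p : ℝ × ℝ => greenFun hh Q R p.1 p.2 i j := by
  have m1 := measurable_expKer h
  have m2 : Measurable fun p : ℝ × ℝ => expKer h p.2 p.1 := (measurable_expKer h).comp measurable_swap
  have b := (jb hh Q R).continuous.measurable
  have c := (jc hh Q R).continuous.measurable
  have b' := (continuous_rb hh (Q := Q) (R := R)).measurable
  have c' := (continuous_rs hh (Q := Q) (R := R)).measurable
  fin_cases i <;> fin_cases j <;> simp only [Fin.zero_eta, Fin.mk_one, greenFun_zero_zero,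
    greenFun_zero_one, greenFun_one_zero, greenFun_one_one] <;> fun_prop

lemma memLp_greenFun (i j : Fin 2) (x : ℝ) : MemLp (fun z => greenFun hh Q R x z i j) 2 := by
  obtain ⟨C, hC⟩ := exists_norm_greenFun_le hh Q R
  refine ((memLp_expBound hh x).const_mul C).mono
    ((measurable_greenFun hh i j).comp measurable_prodMk_left).aestronglyMeasurable
    (.of_forall fun z => ?_)
  exact (hC i j x z).trans (le_abs_self _)

end GreenFunction

/-! ### The Green's function is the integral kernel of the inverse -/

section GreenFunction

open Set Filter Topology

variable {h : ℝ} (hh : 0 < h) {Q R : 𝓢(ℝ, ℂ)}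

lemma memLp_volterraC {h : ℝ} (hh : 0 < h) (f : 𝓢(ℝ, ℂ)) (b : BoundedContinuousFunction ℝ ℂ) :
    MemLp (volterraC h hh f b) 2 :=
  (Lp.memLp _).ae_eq (volterraC_ae_eq hh f b)

/-- The part of `∫ G f` on the left of the diagonal. -/
def greenL (hh : 0 < h) (Q R f₁ f₂ : 𝓢(ℝ, ℂ)) : BoundedContinuousFunction ℝ ℂ :=
  volterraC h hh f₁ (jb hh Q R) - volterraC h hh f₂ (jc hh Q R)

lemma greenL_apply (f₁ f₂ : 𝓢(ℝ, ℂ)) (x : ℝ) : greenL hh Q R f₁ f₂ x =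
    ∫ y, expKer h x y * (f₁ y * jb hh Q R y - f₂ y * jc hh Q R y) := by
  have i1 := integrable_expKer_mul hh x (integrable_schwartz_mul f₁ (jb hh Q R))
  have i2 := integrable_expKer_mul hh x (integrable_schwartz_mul f₂ (jc hh Q R))
  simp only [mul_sub]
  rw [integral_sub i1 i2]
  rfl

lemma hasDerivAt_greenL (f₁ f₂ : 𝓢(ℝ, ℂ)) (x : ℝ) : HasDerivAt (greenL hh Q R f₁ f₂)
    (f₁ x * jb hh Q R x - f₂ x * jc hh Q R x - h * greenL hh Q R f₁ f₂ x) x := by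
  have := hasDerivAt_integral_expKer hh
    (g := fun y => f₁ y * jb hh Q R y - f₂ y * jc hh Q R y) (by fun_prop)
    ((integrable_schwartz_mul f₁ _).sub (integrable_schwartz_mul f₂ _)) x
  simp only [← greenL_apply hh] at this
  exact this

lemma memLp_greenL (f₁ f₂ : 𝓢(ℝ, ℂ)) : MemLp (greenL hh Q R f₁ f₂) 2 :=
  (memLp_volterraC hh f₁ _).sub (memLp_volterraC hh f₂ _)

/-- The part of `∫ G f` on the right of the diagonal. -/
def greenR (hh : 0 < h) (Q R f₁ f₂ : 𝓢(ℝ, ℂ)) (x : ℝ) : ℂ :=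
  -greenL hh (refl R) (refl Q) (refl f₂) (-refl f₁) (-x)

lemma greenR_apply (f₁ f₂ : 𝓢(ℝ, ℂ)) (x : ℝ) : greenR hh Q R f₁ f₂ x =
    ∫ y, expKer h y x * (f₁ y * rs hh Q R y - f₂ y * rb hh Q R y) := by
  rw [greenR, greenL_apply, ← integral_neg, ← integral_neg_eq_self]
  refine integral_congr_ae (.of_forall fun y => ?_)
  simp [expKer_neg, rs, rb]
  ring

lemma hasDerivAt_greenR (f₁ f₂ : 𝓢(ℝ, ℂ)) (x : ℝ) : HasDerivAt (greenR hh Q R f₁ f₂)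
    (f₂ x * rb hh Q R x - f₁ x * rs hh Q R x + h * greenR hh Q R f₁ f₂ x) x := by
  refine ((hasDerivAt_greenL hh (Q := refl R) (R := refl Q) (refl f₂) (-refl f₁) (-x)).scomp x
    (hasDerivAt_neg x)).neg.congr_deriv ?_
  simp [rs, rb, greenR]
  ring

lemma memLp_greenR (f₁ f₂ : 𝓢(ℝ, ℂ)) : MemLp (greenR hh Q R f₁ f₂) 2 :=
  ((memLp_greenL hh _ _).comp_measurePreserving (Measure.measurePreserving_neg volume)).neg

lemma exists_norm_green_le (f₁ f₂ : 𝓢(ℝ, ℂ)) : ∃ M : ℝ, 0 ≤ M ∧ ∀ x, ‖jb hh Q R x‖ ≤ M ∧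
    ‖jc hh Q R x‖ ≤ M ∧ ‖rb hh Q R x‖ ≤ M ∧ ‖rs hh Q R x‖ ≤ M ∧
    ‖greenL hh Q R f₁ f₂ x‖ ≤ M ∧ ‖greenR hh Q R f₁ f₂ x‖ ≤ M := by
  refine ⟨‖jb hh Q R‖ + ‖jc hh Q R‖ + ‖jb hh (refl R) (refl Q)‖ + ‖jc hh (refl R) (refl Q)‖
    + ‖greenL hh Q R f₁ f₂‖ + ‖greenL hh (refl R) (refl Q) (refl f₂) (-refl f₁)‖,
    by positivity, fun x => ?_⟩
  have h1 := (jb hh Q R).norm_coe_le_norm x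
  have h2 := (jc hh Q R).norm_coe_le_norm x
  have h3 := norm_rb_le hh (Q := Q) (R := R) x
  have h4 := norm_rs_le hh (Q := Q) (R := R) x
  have h5 := (greenL hh Q R f₁ f₂).norm_coe_le_norm x
  have h6 : ‖greenR hh Q R f₁ f₂ x‖ ≤ ‖greenL hh (refl R) (refl Q) (refl f₂) (-refl f₁)‖ := by
    rw [greenR, norm_neg]
    exact BoundedContinuousFunction.norm_coe_le_norm _ _
  have p1 := norm_nonneg (jb hh Q R)
  have p2 := norm_nonneg (jc hh Q R)
  have p3 := norm_nonneg (jb hh (refl R) (refl Q))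
  have p4 := norm_nonneg (jc hh (refl R) (refl Q))
  have p5 := norm_nonneg (greenL hh Q R f₁ f₂)
  have p6 := norm_nonneg (greenL hh (refl R) (refl Q) (refl f₂) (-refl f₁))
  exact ⟨by linarith, by linarith, by linarith, by linarith, by linarith, by linarith⟩

/-- The first component of `∫ G f`. -/
def greenV₁ (hh : 0 < h) (Q R f₁ f₂ : 𝓢(ℝ, ℂ)) (x : ℝ) : ℂ := (ja hh Q R)⁻¹ *
  (rb hh Q R x * greenL hh Q R f₁ f₂ x + jc hh Q R x * greenR hh Q R f₁ f₂ x)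

/-- The second component of `∫ G f`. -/
def greenV₂ (hh : 0 < h) (Q R f₁ f₂ : 𝓢(ℝ, ℂ)) (x : ℝ) : ℂ := (ja hh Q R)⁻¹ *
  (rs hh Q R x * greenL hh Q R f₁ f₂ x + jb hh Q R x * greenR hh Q R f₁ f₂ x)

/-- Variation of constants. The derivatives of the two partial integrals contribute the source f₁
times the Wronskian, which cancels a⁻¹, while the f₂ terms cancel each other. -/
lemma hasDerivAt_greenV₁ (hs : Small h Q R) (f₁ f₂ : 𝓢(ℝ, ℂ)) (x : ℝ) :
    HasDerivAt (greenV₁ hh Q R f₁ f₂)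
      (f₁ x + Q x * greenV₂ hh Q R f₁ f₂ x - h * greenV₁ hh Q R f₁ f₂ x) x := by
  refine ((((hasDerivAt_rb hh hs x).mul (hasDerivAt_greenL hh f₁ f₂ x)).add
    ((hasDerivAt_jc hh x).mul (hasDerivAt_greenR hh f₁ f₂ x))).const_mul
      (ja hh Q R)⁻¹).congr_deriv ?_
  have ha := ja_ne_zero hh hs
  have hw := wronskian_eq hh hs x
  rw [greenV₁, greenV₂]
  field_simp
  linear_combination (f₁ x) * hw

lemma hasDerivAt_greenV₂ (hs : Small h Q R) (f₁ f₂ : 𝓢(ℝ, ℂ)) (x : ℝ) :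
    HasDerivAt (greenV₂ hh Q R f₁ f₂)
      (f₂ x + R x * greenV₁ hh Q R f₁ f₂ x + h * greenV₂ hh Q R f₁ f₂ x) x := by
  refine ((((hasDerivAt_rs hh x).mul (hasDerivAt_greenL hh f₁ f₂ x)).add
    ((hasDerivAt_jb hh hs x).mul (hasDerivAt_greenR hh f₁ f₂ x))).const_mul
      (ja hh Q R)⁻¹).congr_deriv ?_
  have ha := ja_ne_zero hh hs
  have hw := wronskian_eq hh hs x
  rw [greenV₁, greenV₂]
  field_simp
  linear_combination (f₂ x) * hw

lemma exists_norm_greenV_le (f₁ f₂ : 𝓢(ℝ, ℂ)) : ∃ C : ℝ, ∀ x,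
    ‖greenV₁ hh Q R f₁ f₂ x‖ ≤ C ∧ ‖greenV₂ hh Q R f₁ f₂ x‖ ≤ C := by
  obtain ⟨M, hM0, hM⟩ := exists_norm_green_le hh (Q := Q) (R := R) f₁ f₂
  refine ⟨‖(ja hh Q R)⁻¹‖ * (M * M + M * M), fun x => ?_⟩
  obtain ⟨x1, x2, x3, x4, x5, x6⟩ := hM x
  rw [greenV₁, greenV₂, norm_mul, norm_mul]
  constructor
  · gcongr
    refine (norm_add_le _ _).trans ?_
    rw [norm_mul, norm_mul]
    gcongr
  · gcongr
    refine (norm_add_le _ _).trans ?_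
    rw [norm_mul, norm_mul]
    gcongr

lemma memLp_bdd_mul {u v : ℝ → ℂ} (hu : Continuous u) {C : ℝ} (hC : ∀ x, ‖u x‖ ≤ C)
    (hv : MemLp v 2) : MemLp (fun x => u x * v x) 2 :=
  hv.of_le_mul (hu.aestronglyMeasurable.mul hv.1) (.of_forall fun x => by
    rw [norm_mul]
    exact mul_le_mul_of_nonneg_right (hC x) (norm_nonneg _))

lemma memLp_greenV₁ (f₁ f₂ : 𝓢(ℝ, ℂ)) : MemLp (greenV₁ hh Q R f₁ f₂) 2 := by
  obtain ⟨M, hM0, hM⟩ := exists_norm_green_le hh (Q := Q) (R := R) f₁ f₂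
  have e1 : MemLp (fun x => rb hh Q R x * greenL hh Q R f₁ f₂ x) 2 :=
    memLp_bdd_mul (continuous_rb hh) (fun x => (hM x).2.2.1) (memLp_greenL hh f₁ f₂)
  have e2 : MemLp (fun x => jc hh Q R x * greenR hh Q R f₁ f₂ x) 2 :=
    memLp_bdd_mul (jc hh Q R).continuous (fun x => (hM x).2.1) (memLp_greenR hh f₁ f₂)
  exact (e1.add e2).const_mul (ja hh Q R)⁻¹

lemma memLp_greenV₂ (f₁ f₂ : 𝓢(ℝ, ℂ)) : MemLp (greenV₂ hh Q R f₁ f₂) 2 := by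
  obtain ⟨M, hM0, hM⟩ := exists_norm_green_le hh (Q := Q) (R := R) f₁ f₂
  have e1 : MemLp (fun x => rs hh Q R x * greenL hh Q R f₁ f₂ x) 2 :=
    memLp_bdd_mul (continuous_rs hh) (fun x => (hM x).2.2.2.1) (memLp_greenL hh f₁ f₂)
  have e2 : MemLp (fun x => jb hh Q R x * greenR hh Q R f₁ f₂ x) 2 :=
    memLp_bdd_mul (jb hh Q R).continuous (fun x => (hM x).1) (memLp_greenR hh f₁ f₂)
  exact (e1.add e2).const_mul (ja hh Q R)⁻¹

lemma integrable_expKer_flip_mul {h : ℝ} (hh : 0 < h) (x : ℝ) {g : ℝ → ℂ} (hg : Integrable g) :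
    Integrable fun y => expKer h y x * g y := by
  have := (integrable_expKer_mul hh (-x) hg.comp_neg).comp_neg
  simpa [expKer_neg] using this

/-- The functions on the left solve the system classically and are bounded, so variation of
constants turns the two differential equations into the resolvent equations that characterise
`solOp`. -/
lemma solOp_schwartz (hs : Small h Q R) (f₁ f₂ : 𝓢(ℝ, ℂ)) :
    ((memLp_greenV₁ hh (Q := Q) (R := R) f₁ f₂).toLp,
      (memLp_greenV₂ hh (Q := Q) (R := R) f₁ f₂).toLp)
      = solOp h Q R (f₁.toLp 2, f₂.toLp 2) := by
  obtain ⟨C, hC⟩ := exists_norm_greenV_le hh (Q := Q) (R := R) f₁ f₂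
  have c1 : Continuous (greenV₁ hh Q R f₁ f₂) :=
    continuous_iff_continuousAt.2 fun x => (hasDerivAt_greenV₁ hh hs f₁ f₂ x).continuousAt
  have c2 : Continuous (greenV₂ hh Q R f₁ f₂) :=
    continuous_iff_continuousAt.2 fun x => (hasDerivAt_greenV₂ hh hs f₁ f₂ x).continuousAt
  rw [← isSol_iff_eq_solOp hh hs]
  refine isSol_of_ae_eq hh (memLp_greenV₁ hh f₁ f₂).coeFn_toLp
    (memLp_greenV₂ hh f₁ f₂).coeFn_toLp (.of_forall fun x => ?_)
    (.of_forall fun x => ?_)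
  · rw [eq_integral_expKer hh (hasDerivAt_greenV₁ hh hs f₁ f₂) (fun x => (hC x).1) x
      (integrable_expKer_mul hh x (f₁.integrable.add
        (integrable_schwartz_mul_of_bdd Q c2 fun x => (hC x).2)))]
    refine integral_congr_ae ?_
    filter_upwards [f₁.coeFn_toLp 2] with y hy
    rw [hy]
  · rw [eq_integral_expKer_flip hh (hasDerivAt_greenV₂ hh hs f₁ f₂) (fun x => (hC x).2) x
      (integrable_expKer_flip_mul hh x (f₂.integrable.add
        (integrable_schwartz_mul_of_bdd R c1 fun x => (hC x).1))), ← integral_neg]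
    refine integral_congr_ae ?_
    filter_upwards [f₂.coeFn_toLp 2] with y hy
    rw [hy, neg_mul]

lemma greenV₁_eq (f₁ f₂ : 𝓢(ℝ, ℂ)) (x : ℝ) : greenV₁ hh Q R f₁ f₂ x =
    ∫ y, (greenFun hh Q R x y 0 0 * f₁ y + greenFun hh Q R x y 0 1 * f₂ y) := by
  have i1 : Integrable fun y => f₁ y * jb hh Q R y - f₂ y * jc hh Q R y :=
    (integrable_schwartz_mul f₁ _).sub (integrable_schwartz_mul f₂ _)
  have i2 : Integrable fun y => f₁ y * rs hh Q R y - f₂ y * rb hh Q R y :=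
    (integrable_schwartz_mul_of_bdd f₁ (continuous_rs hh) (norm_rs_le hh)).sub
      (integrable_schwartz_mul_of_bdd f₂ (continuous_rb hh) (norm_rb_le hh))
  rw [greenV₁, greenL_apply, greenR_apply, ← integral_const_mul, ← integral_const_mul,
    ← integral_add ((integrable_expKer_mul hh x i1).const_mul _)
      ((integrable_expKer_flip_mul hh x i2).const_mul _), ← integral_const_mul]
  refine integral_congr_ae (.of_forall fun y => ?_)
  simp only [greenFun_zero_zero, greenFun_zero_one]
  ring

lemma greenV₂_eq (f₁ f₂ : 𝓢(ℝ, ℂ)) (x : ℝ) : greenV₂ hh Q R f₁ f₂ x =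
    ∫ y, (greenFun hh Q R x y 1 0 * f₁ y + greenFun hh Q R x y 1 1 * f₂ y) := by
  have i1 : Integrable fun y => f₁ y * jb hh Q R y - f₂ y * jc hh Q R y :=
    (integrable_schwartz_mul f₁ _).sub (integrable_schwartz_mul f₂ _)
  have i2 : Integrable fun y => f₁ y * rs hh Q R y - f₂ y * rb hh Q R y :=
    (integrable_schwartz_mul_of_bdd f₁ (continuous_rs hh) (norm_rs_le hh)).sub
      (integrable_schwartz_mul_of_bdd f₂ (continuous_rb hh) (norm_rb_le hh))
  rw [greenV₂, greenL_apply, greenR_apply, ← integral_const_mul, ← integral_const_mul,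
    ← integral_add ((integrable_expKer_mul hh x i1).const_mul _)
      ((integrable_expKer_flip_mul hh x i2).const_mul _), ← integral_const_mul]
  refine integral_congr_ae (.of_forall fun y => ?_)
  simp only [greenFun_one_zero, greenFun_one_one]
  ring

lemma zero_toLp : (0 : 𝓢(ℝ, ℂ)).toLp 2 = (0 : L2) := by
  refine Lp.ext ?_
  filter_upwards [(0 : 𝓢(ℝ, ℂ)).coeFn_toLp 2, Lp.coeFn_zero ℂ 2 (volume : Measure ℝ)] with x h1 h2
  rw [h1, h2]
  rfl

/-- With one component of the source equal to zero, each component of the solution is an operator on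
a single copy of L², and density of Schwartz functions applies. -/
lemma solOp_inl_ae_eq (hs : Small h Q R) (f : L2) :
    ((solOp h Q R (f, 0)).1 =ᵐ[volume] fun x => ∫ y, greenFun hh Q R x y 0 0 * f y) ∧
    ((solOp h Q R (f, 0)).2 =ᵐ[volume] fun x => ∫ y, greenFun hh Q R x y 1 0 * f y) := by
  constructor
  · refine ae_eq_integral_of_schwartz (ContinuousLinearMap.fst ℂ L2 L2 ∘L solOp h Q R ∘L
      ContinuousLinearMap.inl ℂ L2 L2) (memLp_greenFun hh 0 0) (fun g => ?_) f
    have h1 := solOp_schwartz hh hs g 0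
    rw [zero_toLp] at h1
    have h2 : ContinuousLinearMap.fst ℂ L2 L2 (solOp h Q R (g.toLp 2, 0))
        =ᵐ[volume] greenV₁ hh Q R g 0 := by
      rw [← h1]
      exact (memLp_greenV₁ hh (Q := Q) (R := R) g 0).coeFn_toLp
    refine h2.trans (.of_forall fun x => ?_)
    rw [greenV₁_eq]
    simp
  · refine ae_eq_integral_of_schwartz (ContinuousLinearMap.snd ℂ L2 L2 ∘L solOp h Q R ∘L
      ContinuousLinearMap.inl ℂ L2 L2) (memLp_greenFun hh 1 0) (fun g => ?_) f
    have h1 := solOp_schwartz hh hs g 0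
    rw [zero_toLp] at h1
    have h2 : ContinuousLinearMap.snd ℂ L2 L2 (solOp h Q R (g.toLp 2, 0))
        =ᵐ[volume] greenV₂ hh Q R g 0 := by
      rw [← h1]
      exact (memLp_greenV₂ hh (Q := Q) (R := R) g 0).coeFn_toLp
    refine h2.trans (.of_forall fun x => ?_)
    rw [greenV₂_eq]
    simp

lemma solOp_inr_ae_eq (hs : Small h Q R) (f : L2) :
    ((solOp h Q R (0, f)).1 =ᵐ[volume] fun x => ∫ y, greenFun hh Q R x y 0 1 * f y) ∧
    ((solOp h Q R (0, f)).2 =ᵐ[volume] fun x => ∫ y, greenFun hh Q R x y 1 1 * f y) := by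
  constructor
  · refine ae_eq_integral_of_schwartz (ContinuousLinearMap.fst ℂ L2 L2 ∘L solOp h Q R ∘L
      ContinuousLinearMap.inr ℂ L2 L2) (memLp_greenFun hh 0 1) (fun g => ?_) f
    have h1 := solOp_schwartz hh hs 0 g
    rw [zero_toLp] at h1
    have h2 : ContinuousLinearMap.fst ℂ L2 L2 (solOp h Q R (0, g.toLp 2))
        =ᵐ[volume] greenV₁ hh Q R 0 g := by
      rw [← h1]
      exact (memLp_greenV₁ hh (Q := Q) (R := R) 0 g).coeFn_toLp
    refine h2.trans (.of_forall fun x => ?_)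
    rw [greenV₁_eq]
    simp
  · refine ae_eq_integral_of_schwartz (ContinuousLinearMap.snd ℂ L2 L2 ∘L solOp h Q R ∘L
      ContinuousLinearMap.inr ℂ L2 L2) (memLp_greenFun hh 1 1) (fun g => ?_) f
    have h1 := solOp_schwartz hh hs 0 g
    rw [zero_toLp] at h1
    have h2 : ContinuousLinearMap.snd ℂ L2 L2 (solOp h Q R (0, g.toLp 2))
        =ᵐ[volume] greenV₂ hh Q R 0 g := by
      rw [← h1]
      exact (memLp_greenV₂ hh (Q := Q) (R := R) 0 g).coeFn_toLp
    refine h2.trans (.of_forall fun x => ?_)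
    rw [greenV₂_eq]
    simp

lemma solOp_ae_eq (hs : Small h Q R) (f : L2 × L2) : ∀ᵐ x : ℝ,
    (solOp h Q R f).1 x = (∫ y, (greenFun hh Q R x y 0 0 * f.1 y + greenFun hh Q R x y 0 1 * f.2 y))
    ∧ (solOp h Q R f).2 x
      = ∫ y, (greenFun hh Q R x y 1 0 * f.1 y + greenFun hh Q R x y 1 1 * f.2 y) := by
  have h1 : solOp h Q R f = solOp h Q R (f.1, 0) + solOp h Q R (0, f.2) := by
    rw [← map_add]
    simp
  rw [h1]
  obtain ⟨a1, a2⟩ := solOp_inl_ae_eq hh hs f.1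
  obtain ⟨b1, b2⟩ := solOp_inr_ae_eq hh hs f.2
  filter_upwards [a1, a2, b1, b2, Lp.coeFn_add (solOp h Q R (f.1, 0)).1 (solOp h Q R (0, f.2)).1,
    Lp.coeFn_add (solOp h Q R (f.1, 0)).2 (solOp h Q R (0, f.2)).2] with x a1 a2 b1 b2 c1 c2
  have i : ∀ i j (g : L2), Integrable fun y => greenFun hh Q R x y i j * g y := fun i j g =>
    integrable_mul_L2 (memLp_greenFun hh i j x) g
  rw [integral_add (i 0 0 f.1) (i 0 1 f.2), integral_add (i 1 0 f.1) (i 1 1 f.2), Prod.fst_add,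
    Prod.snd_add, c1, c2, Pi.add_apply, Pi.add_apply, a1, a2, b1, b2]
  exact ⟨rfl, rfl⟩

end GreenFunction

/-! ### Uniqueness of the Green's function, its diagonal values and the density -/

section DiagonalGreen

open Set Filter Topology

variable {h : ℝ} (hh : 0 < h) {Q R : 𝓢(ℝ, ℂ)}

/-- Test with indicators of intervals. The exceptional null set in x depends on the interval, but
continuity in x removes it; differentiating in the endpoint recovers D. -/
lemma eq_zero_of_forall_integral_mul_eq_zero {D : ℝ × ℝ → ℂ} (hD : Continuous D)
    (h : ∀ f : L2, ∀ᵐ x : ℝ, ∫ y, D (x, y) * f y = 0) (p : ℝ × ℝ) : D p = 0 := by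
  have h1 : ∀ a b : ℝ, a ≤ b → ∀ x, ∫ y in a..b, D (x, y) = 0 := by
    intro a b hab
    have hc : Continuous fun x => ∫ y in a..b, D (x, y) :=
      intervalIntegral.continuous_parametric_intervalIntegral_of_continuous'
        (f := fun x y => D (x, y)) hD a b
    refine congrFun ((hc.ae_eq_iff_eq volume (continuous_const (y := (0 : ℂ)))).1 ?_)
    have hfin : volume (Ioc a b) ≠ ∞ := by simp
    filter_upwards [h (indicatorConstLp 2 measurableSet_Ioc hfin (1 : ℂ))] with x hx
    rw [intervalIntegral.integral_of_le hab, ← integral_indicator measurableSet_Ioc, ← hx]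
    refine integral_congr_ae ?_
    filter_upwards [indicatorConstLp_coeFn (p := 2) (hs := measurableSet_Ioc) (hμs := hfin)
      (c := (1 : ℂ))] with y hy
    rw [hy]
    by_cases hy' : y ∈ Ioc a b <;> simp [hy']
  obtain ⟨x, y⟩ := p
  have hcx : Continuous fun t => D (x, t) := by fun_prop
  have h2 : HasDerivAt (fun t => ∫ s in (y - 1)..t, D (x, s)) (D (x, y)) y :=
    intervalIntegral.integral_hasDerivAt_right (hcx.intervalIntegrable _ _)
      hcx.stronglyMeasurable.stronglyMeasurableAtFilter hcx.continuousAt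
  have h3 : HasDerivAt (fun t => ∫ s in (y - 1)..t, D (x, s)) 0 y := by
    refine (hasDerivAt_const y (0 : ℂ)).congr_of_eventuallyEq ?_
    filter_upwards [lt_mem_nhds (sub_one_lt y)] with t ht
    exact h1 _ _ ht.le x
  exact h2.unique h3

/-- Both kernels represent the same inverse, and the discontinuous free part cancels in their
difference, so the difference is a continuous kernel of the zero operator. -/
lemma IsGreen.unique {κ : ℂ} {q : 𝓢(ℝ, ℂ)} {G G' : ℝ → ℝ → Matrix (Fin 2) (Fin 2) ℂ}
    (hG : IsGreen κ q G) (hG' : IsGreen κ q G') : G = G' := by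
  obtain ⟨c, S, hS, hk⟩ := hG
  obtain ⟨c', S', hS', hk'⟩ := hG'
  have hSS : S = S' := by
    refine ContinuousLinearMap.ext fun f => ?_
    exact (hS' (S f) f).1 ((hS (S f) f).2 rfl)
  subst hSS
  have hc : Continuous fun p : ℝ × ℝ => G p.1 p.2 - G' p.1 p.2 := by
    refine (c.sub c').congr fun p => ?_
    exact sub_sub_sub_cancel_right _ _ _
  have hi : ∀ i j, Continuous fun p : ℝ × ℝ => G p.1 p.2 i j - G' p.1 p.2 i j := fun i j =>
    hc.matrix_elem i j
  have key : ∀ i j p, G (Prod.fst p) (Prod.snd p) i j - G' p.1 p.2 i j = 0 := by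
    intro i j
    refine eq_zero_of_forall_integral_mul_eq_zero (hi i j) fun f => ?_
    have z0 := Lp.coeFn_zero ℂ 2 (volume : Measure ℝ)
    have zr : ∀ {k l : ℝ → ℂ}, ∫ y, (k y * f y + l y * (0 : L2) y) = ∫ y, k y * f y := by
      intro k l
      refine integral_congr_ae ?_
      filter_upwards [z0] with y hy
      rw [hy]
      simp
    have zl : ∀ {k l : ℝ → ℂ}, ∫ y, (k y * (0 : L2) y + l y * f y) = ∫ y, l y * f y := by
      intro k l
      refine integral_congr_ae ?_
      filter_upwards [z0] with y hy
      rw [hy]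
      simp
    fin_cases j
    · filter_upwards [hk (f, 0), hk' (f, 0)] with x hx hx'
      simp only [zr] at hx hx'
      simp only [sub_mul]
      refine (integral_sub (hx.1 i).1 (hx'.1 i).1).trans ?_
      fin_cases i
      · exact sub_eq_zero.2 (hx.2.1.symm.trans hx'.2.1)
      · exact sub_eq_zero.2 (hx.2.2.symm.trans hx'.2.2)
    · filter_upwards [hk (0, f), hk' (0, f)] with x hx hx'
      simp only [zl] at hx hx'
      simp only [sub_mul]
      refine (integral_sub (hx.1 i).2 (hx'.1 i).2).trans ?_
      fin_cases i
      · exact sub_eq_zero.2 (hx.2.1.symm.trans hx'.2.1)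
      · exact sub_eq_zero.2 (hx.2.2.symm.trans hx'.2.2)
  funext x y
  ext i j
  exact sub_eq_zero.1 (key i j (x, y))

lemma IsGreen.green_eq {κ : ℂ} {q : 𝓢(ℝ, ℂ)} {G : ℝ → ℝ → Matrix (Fin 2) (Fin 2) ℂ}
    (hG : IsGreen κ q G) : green κ q = G := by
  have hex : ∃ G, IsGreen κ q G := ⟨G, hG⟩
  rw [green, dif_pos hex]
  exact hex.choose_spec.unique hG

lemma expKer_eq_step_mul (h x y : ℝ) :
    expKer h x y = (Real.exp (-(h * |x - y|)) : ℂ) * step x y := by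
  rcases lt_or_ge x y with hxy | hxy
  · rw [expKer, step_eq_zero hxy, zero_mul, mul_zero]
  · rw [expKer, abs_of_nonneg (sub_nonneg.2 hxy), mul_comm]

lemma freeGreenPos_eq {κ : ℂ} (hκ : I * κ ^ 2 = (h : ℝ)) (x y : ℝ) :
    freeGreenPos κ x y = freeFun h x y := by
  have : Complex.exp (-(I * κ ^ 2 * (|x - y| : ℝ))) = (Real.exp (-(h * |x - y|)) : ℂ) := by
    rw [hκ]
    push_cast
    rfl
  rw [freeGreenPos, this, freeFun, expKer_eq_step_mul, expKer_eq_step_mul h y x, abs_sub_comm y x]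
  ext i j
  fin_cases i <;> fin_cases j <;> simp

lemma freeGreen_eq_pos (hh : 0 < h) {κ : ℂ} (hκ : I * κ ^ 2 = (h : ℝ)) (x y : ℝ) :
    freeGreen κ x y = freeFun h x y := by
  rw [freeGreen, if_pos (by rw [hκ]; exact hh), freeGreenPos_eq hκ]

lemma I_mul_neg_conj_sq (κ : ℂ) : I * (-conj κ) ^ 2 = -conj (I * κ ^ 2) := by
  simp

lemma freeGreen_eq_neg (hh : 0 < h) {κ : ℂ} (hκ : I * κ ^ 2 = ((-h : ℝ) : ℂ)) (x y : ℝ) :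
    freeGreen κ x y = (freeFun h x y).submatrix Fin.rev Fin.rev := by
  have h1 : I * (-conj κ) ^ 2 = (h : ℝ) := by
    rw [I_mul_neg_conj_sq, hκ, conj_ofReal]
    simp
  rw [freeGreen, if_neg (by rw [hκ, ofReal_re]; linarith), freeGreenPos_eq h1]
  ext i j
  fin_cases i <;> fin_cases j <;> simp [freeFun]

lemma isGreen_pos {κ : ℂ} (hκ : I * κ ^ 2 = (h : ℝ)) {q : 𝓢(ℝ, ℂ)}
    (hs : Small h (κ • q) (κ • rS q)) : IsGreen κ q (greenFun hh (κ • q) (κ • rS q)) := by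
  refine ⟨?_, solOp h (κ • q) (κ • rS q), fun u f => ?_, fun f => ?_⟩
  · simp only [freeGreen_eq_pos hh hκ]
    exact continuous_greenFun_sub hh hs
  · rw [laxEq_iff hh.ne' hκ]
    exact isSol_iff_eq_solOp hh hs u f
  · filter_upwards [solOp_ae_eq hh hs f] with x hx
    exact ⟨fun i => ⟨integrable_mul_L2 (memLp_greenFun hh i 0 x) _,
      integrable_mul_L2 (memLp_greenFun hh i 1 x) _⟩, hx⟩

/-- Exchanging the two components turns the case iκ² = -h into the system with parameter h and the
potentials interchanged; on matrices this reverses both indices. -/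
lemma isGreen_neg {κ : ℂ} (hκ : I * κ ^ 2 = ((-h : ℝ) : ℂ)) {q : 𝓢(ℝ, ℂ)}
    (hs : Small h (κ • rS q) (κ • q)) :
    IsGreen κ q fun x y => (greenFun hh (κ • rS q) (κ • q) x y).submatrix Fin.rev Fin.rev := by
  let sw : (L2 × L2) →L[ℂ] (L2 × L2) :=
    (ContinuousLinearMap.snd ℂ L2 L2).prod (ContinuousLinearMap.fst ℂ L2 L2)
  refine ⟨?_, sw ∘L solOp h (κ • rS q) (κ • q) ∘L sw, fun u f => ?_, fun f => ?_⟩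
  · simp only [freeGreen_eq_neg hh hκ]
    exact (continuous_greenFun_sub hh hs).matrix_submatrix Fin.rev Fin.rev
  · have h1 := isSol_iff_eq_solOp hh hs u.swap f.swap
    rw [laxEq_iff (neg_ne_zero.2 hh.ne') hκ, neg_neg, and_comm]
    refine h1.trans ?_
    rw [← Prod.swap_inj, Prod.swap_swap]
    rfl
  · filter_upwards [solOp_ae_eq hh hs f.swap] with x hx
    refine ⟨fun i => ⟨integrable_mul_L2 (memLp_greenFun hh i.rev 1 x) _,
      integrable_mul_L2 (memLp_greenFun hh i.rev 0 x) _⟩, hx.2.trans ?_, hx.1.trans ?_⟩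
    · exact integral_congr_ae (.of_forall fun y => add_comm _ _)
    · exact integral_congr_ae (.of_forall fun y => add_comm _ _)

lemma expKer_self (h x : ℝ) : expKer h x x = 1 / 2 := by simp [expKer, step]

lemma sgn_eq_one (hh : 0 < h) {κ : ℂ} (hκ : I * κ ^ 2 = (h : ℝ)) : sgn κ = 1 := by
  rw [sgn, hκ, ofReal_re, Real.sign_of_pos hh, ofReal_one]

lemma sgn_eq_neg_one (hh : 0 < h) {κ : ℂ} (hκ : I * κ ^ 2 = ((-h : ℝ) : ℂ)) : sgn κ = -1 := by
  rw [sgn, hκ, ofReal_re, Real.sign_of_neg (by linarith)]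
  simp

/-- The common value of `γ`. -/
def diagGam (hh : 0 < h) (Q R : 𝓢(ℝ, ℂ)) (x : ℝ) : ℂ :=
  2 * (jc hh Q R x * rs hh Q R x) / ja hh Q R

/-- The value of `Q g₂₁ + R g₁₂`. -/
def diagPair (hh : 0 < h) (Q R : 𝓢(ℝ, ℂ)) (x : ℝ) : ℂ :=
  (Q x * jb hh Q R x * rs hh Q R x - R x * jc hh Q R x * rb hh Q R x) / ja hh Q R

/-- With the value 1/2 on the diagonal the difference of the entries is (bb₊ + cc₊)/a, and 1 = (bb₊
- cc₊)/a by the Wronskian identity. -/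
lemma greenFun_diag (hs : Small h Q R) (x : ℝ) :
    greenFun hh Q R x x 0 0 - greenFun hh Q R x x 1 1 - 1 = diagGam hh Q R x := by
  have ha := ja_ne_zero hh hs
  have hw := wronskian_eq hh hs x
  rw [greenFun_zero_zero, greenFun_one_one, diagGam, expKer_self]
  field_simp
  linear_combination 2 * hw

lemma gam_eq_pos {κ : ℂ} (hκ : I * κ ^ 2 = (h : ℝ)) {q : 𝓢(ℝ, ℂ)}
    (hs : Small h (κ • q) (κ • rS q)) (x : ℝ) :
    gam κ q x = diagGam hh (κ • q) (κ • rS q) x := by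
  rw [gam, (isGreen_pos hh hκ hs).green_eq, sgn_eq_one hh hκ, one_mul, greenFun_diag hh hs]

lemma gam_eq_neg {κ : ℂ} (hκ : I * κ ^ 2 = ((-h : ℝ) : ℂ)) {q : 𝓢(ℝ, ℂ)}
    (hs : Small h (κ • rS q) (κ • q)) (x : ℝ) :
    gam κ q x = diagGam hh (κ • rS q) (κ • q) x := by
  rw [gam, (isGreen_neg hh hκ hs).green_eq, sgn_eq_neg_one hh hκ, ← greenFun_diag hh hs]
  change -1 * (greenFun hh (κ • rS q) (κ • q) x x 1 1 - greenFun hh (κ • rS q) (κ • q) x x 0 0) - 1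
    = _
  ring

lemma pair_eq_pos {κ : ℂ} (hκ : I * κ ^ 2 = (h : ℝ)) {q : 𝓢(ℝ, ℂ)}
    (hs : Small h (κ • q) (κ • rS q)) (x : ℝ) :
    κ * (q x * g21 κ q x + rOf q x * g12 κ q x) = diagPair hh (κ • q) (κ • rS q) x := by
  have ha := ja_ne_zero hh hs
  rw [g21, g12, (isGreen_pos hh hκ hs).green_eq, sgn_eq_one hh hκ, greenFun_zero_one,
    greenFun_one_zero, expKer_self, diagPair]
  simp only [_root_.smul_apply, smul_eq_mul, rS_apply]
  field_simp
  ring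

lemma pair_eq_neg {κ : ℂ} (hκ : I * κ ^ 2 = ((-h : ℝ) : ℂ)) {q : 𝓢(ℝ, ℂ)}
    (hs : Small h (κ • rS q) (κ • q)) (x : ℝ) :
    κ * (q x * g21 κ q x + rOf q x * g12 κ q x) = -diagPair hh (κ • rS q) (κ • q) x := by
  have ha := ja_ne_zero hh hs
  rw [g21, g12, (isGreen_neg hh hκ hs).green_eq, sgn_eq_neg_one hh hκ]
  change κ * (q x * (-1 * greenFun hh (κ • rS q) (κ • q) x x 0 1)
    + rOf q x * (-1 * greenFun hh (κ • rS q) (κ • q) x x 1 0)) = _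
  rw [greenFun_zero_one, greenFun_one_zero, expKer_self, diagPair]
  simp only [_root_.smul_apply, smul_eq_mul, rS_apply]
  field_simp
  ring

lemma jb_ne_zero (hs : Small h Q R) (x : ℝ) : jb hh Q R x ≠ 0 :=
  ne_zero_of_norm_sub_one_le (norm_jb_sub_one_le hh hs x)

lemma rb_ne_zero (hs : Small h Q R) (x : ℝ) : rb hh Q R x ≠ 0 :=
  ne_zero_of_norm_sub_one_le (norm_rb_sub_one_le hh hs x)

/-- The Wronskian identity factors 2 + γ into functions close to 1; this is why it has no zeros. -/
lemma two_add_diagGam (hs : Small h Q R) (x : ℝ) :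
    2 + diagGam hh Q R x = 2 * (jb hh Q R x * rb hh Q R x) / ja hh Q R := by
  have ha := ja_ne_zero hh hs
  have hw := wronskian_eq hh hs x
  rw [diagGam]
  field_simp
  linear_combination -hw

lemma two_add_diagGam_ne_zero (hs : Small h Q R) (x : ℝ) : 2 + diagGam hh Q R x ≠ 0 := by
  rw [two_add_diagGam hh hs]
  exact div_ne_zero (mul_ne_zero two_ne_zero (mul_ne_zero (jb_ne_zero hh hs x)
    (rb_ne_zero hh hs x))) (ja_ne_zero hh hs)

lemma mem_slitPlane_of_norm_sub_one_le {z : ℂ} (hz : ‖z - 1‖ ≤ 1 / 3) : z ∈ slitPlane := by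
  have := mem_slitPlane_of_norm_lt_one (hz.trans_lt (by norm_num))
  rwa [add_sub_cancel] at this

/-- The logarithmic derivatives of the Jost solutions give a density for `log a`. -/
lemma integral_density (hs : Small h Q R) :
    Integrable (fun x => -(diagPair hh Q R x / (2 + diagGam hh Q R x))) ∧
    ∫ x, -(diagPair hh Q R x / (2 + diagGam hh Q R x)) = Complex.log (ja hh Q R) := by
  have ha := ja_ne_zero hh hs
  -- Since b' = Rc and b₊' = Qc₊, the factorisation of 2 + γ exhibits the density as half the
  -- difference of two logarithmic derivatives.
  have hpt : ∀ x, -(diagPair hh Q R x / (2 + diagGam hh Q R x)) =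
      (R x * jc hh Q R x / jb hh Q R x - Q x * rs hh Q R x / rb hh Q R x) / 2 := fun x => by
    have h1 := jb_ne_zero hh hs x
    have h2 := rb_ne_zero hh hs x
    rw [two_add_diagGam hh hs, diagPair]
    field_simp
    ring
  simp only [hpt]
  have hinv : ∀ {z : ℂ}, ‖z - 1‖ ≤ 1 / 3 → ‖z⁻¹‖ ≤ 3 / 2 := fun {z} hz => by
    have h1 : 2 / 3 ≤ ‖z‖ := by
      have := norm_sub_norm_le (1 : ℂ) (1 - z)
      rw [norm_sub_rev, norm_one, sub_sub_cancel] at this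
      linarith
    rw [norm_inv, inv_le_comm₀ (by linarith) (by norm_num)]
    linarith
  have i1 : Integrable fun x => R x * jc hh Q R x / jb hh Q R x := by
    simp only [div_eq_mul_inv]
    exact (integrable_schwartz_mul R _).mul_bdd
      ((jb hh Q R).continuous.inv₀ (jb_ne_zero hh hs)).aestronglyMeasurable
      (.of_forall fun x => hinv (norm_jb_sub_one_le hh hs x))
  have i2 : Integrable fun x => Q x * rs hh Q R x / rb hh Q R x := by
    simp only [div_eq_mul_inv]
    exact (integrable_schwartz_mul_of_bdd Q (continuous_rs hh) (norm_rs_le hh)).mul_bdd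
      ((continuous_rb hh).inv₀ (rb_ne_zero hh hs)).aestronglyMeasurable
      (.of_forall fun x => hinv (norm_rb_sub_one_le hh hs x))
  have i3 := (i1.sub i2).div_const 2
  refine ⟨i3, ?_⟩
  -- At -∞ this primitive tends to -(log a)/2, because b → 1 and b₊ → a; at +∞ it tends to (log
  -- a)/2.
  have hd : ∀ x, HasDerivAt (fun x => (Complex.log (jb hh Q R x) - Complex.log (rb hh Q R x)) / 2)
      ((R x * jc hh Q R x / jb hh Q R x - Q x * rs hh Q R x / rb hh Q R x) / 2) x := fun x =>
    (((hasDerivAt_jb hh hs x).clog_real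
      (mem_slitPlane_of_norm_sub_one_le (norm_jb_sub_one_le hh hs x))).sub
      ((hasDerivAt_rb hh hs x).clog_real
        (mem_slitPlane_of_norm_sub_one_le (norm_rb_sub_one_le hh hs x)))).div_const 2
  have hla : ContinuousAt Complex.log (ja hh Q R) :=
    continuousAt_clog (mem_slitPlane_of_norm_sub_one_le (norm_ja_sub_one_le hh hs))
  have hl1 : ContinuousAt Complex.log 1 := continuousAt_clog one_mem_slitPlane
  have hb := tendsto_rb_atBot hh hs
  rw [ja_refl hh hs] at hb
  rw [integral_of_hasDerivAt_of_tendsto hd i3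
    (((hl1.tendsto.comp (tendsto_jb_atBot hh hs)).sub (hla.tendsto.comp hb)).div_const 2)
    (((hla.tendsto.comp (tendsto_jb_atTop hh hs)).sub
      (hl1.tendsto.comp (tendsto_rb_atTop hh hs))).div_const 2), Complex.log_one]
  ring

end DiagonalGreen

/-! ### Dependence of the Jost solutions on the parameters -/

section Parameter

open Set Filter Topology

lemma tendsto_volterraC {ι : Type*} {l : Filter ι} {h : ι → ℝ} {h₀ : ℝ} (hpos : ∀ i, 0 < h i)
    (hh : 0 < h₀) (hlim : Tendsto h l (𝓝 h₀)) (Q : 𝓢(ℝ, ℂ)) :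
    Tendsto (fun i => volterraC (h i) (hpos i) Q) l (𝓝 (volterraC h₀ hh Q)) := by
  rw [tendsto_iff_norm_sub_tendsto_zero]
  refine squeeze_zero (fun _ => norm_nonneg _)
    (fun i => norm_volterraC_sub_le hh (hpos i) Q) ?_
  have h1 : Tendsto (fun i => (∫ y, ‖Q y‖) * (|h i - h₀| / min h₀ (h i))) l
      (𝓝 ((∫ y, ‖Q y‖) * (|h₀ - h₀| / min h₀ h₀))) :=
    ((hlim.sub_const h₀).abs.div (tendsto_const_nhds.min hlim) (by simpa using hh.ne')).const_mul _
  simpa using h1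

variable {ι : Type*} {l : Filter ι} {h : ι → ℝ} {μ ν : ι → ℂ} {h₀ : ℝ} {μ₀ ν₀ : ℂ}
  {Q R : 𝓢(ℝ, ℂ)}

lemma tendsto_smul_comp_smul {F : Type*} [NormedAddCommGroup F] [NormedSpace ℂ F]
    {J C₀ : F →L[ℂ] F} {C : ι → F →L[ℂ] F} (hν : Tendsto ν l (𝓝 ν₀)) (hμ : Tendsto μ l (𝓝 μ₀))
    (hC : Tendsto C l (𝓝 C₀)) :
    Tendsto (fun i => (ν i • J) ∘L (μ i • C i)) l (𝓝 ((ν₀ • J) ∘L (μ₀ • C₀))) :=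
  ((isBoundedBilinearMap_comp (𝕜 := ℂ) (E := F) (F := F) (G := F)).continuous.tendsto
    (ν₀ • J, μ₀ • C₀)).comp ((hν.smul_const J).prodMk_nhds (hμ.smul hC))

lemma tendsto_inverse_one_sub_apply {F : Type*} [NormedAddCommGroup F] [NormedSpace ℂ F]
    [CompleteSpace F] {T₀ : F →L[ℂ] F} {T : ι → F →L[ℂ] F} (hT : IsUnit (1 - T₀))
    (hlim : Tendsto T l (𝓝 T₀)) (v : F) :
    Tendsto (fun i => Ring.inverse (1 - T i) v) l (𝓝 (Ring.inverse (1 - T₀) v)) := by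
  have hc : ContinuousAt Ring.inverse (1 - T₀) := NormedRing.inverse_continuousAt hT.unit
  exact ((ContinuousLinearMap.apply ℂ F v).continuous.tendsto _).comp
    (hc.tendsto.comp (hlim.const_sub 1))

lemma tendsto_jb (hpos : ∀ i, 0 < h i) (hh : 0 < h₀) (hlim : Tendsto h l (𝓝 h₀))
    (hμ : Tendsto μ l (𝓝 μ₀)) (hν : Tendsto ν l (𝓝 ν₀)) (hs : Small h₀ (μ₀ • Q) (ν₀ • R)) :
    Tendsto (fun i => jb (hpos i) (μ i • Q) (ν i • R)) l (𝓝 (jb hh (μ₀ • Q) (ν₀ • R))) := by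
  have h1 := tendsto_volterraC (fun i => mul_pos two_pos (hpos i)) (mul_pos two_pos hh)
    (hlim.const_mul 2) Q
  have h2 : Tendsto (fun i => volterraJ (ν i • R) ∘L
      volterraC (2 * h i) (mul_pos two_pos (hpos i)) (μ i • Q)) l
      (𝓝 (volterraJ (ν₀ • R) ∘L volterraC (2 * h₀) (mul_pos two_pos hh) (μ₀ • Q))) := by
    simp only [volterraJ_smul, volterraC_smul]
    exact tendsto_smul_comp_smul hν hμ h1
  exact tendsto_inverse_one_sub_apply (hs.isUnit hh) h2 _

lemma tendsto_jc (hpos : ∀ i, 0 < h i) (hh : 0 < h₀) (hlim : Tendsto h l (𝓝 h₀))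
    (hμ : Tendsto μ l (𝓝 μ₀)) (hν : Tendsto ν l (𝓝 ν₀)) (hs : Small h₀ (μ₀ • Q) (ν₀ • R)) :
    Tendsto (fun i => jc (hpos i) (μ i • Q) (ν i • R)) l (𝓝 (jc hh (μ₀ • Q) (ν₀ • R))) := by
  have h1 := tendsto_volterraC (fun i => mul_pos two_pos (hpos i)) (mul_pos two_pos hh)
    (hlim.const_mul 2) Q
  have h2 : Tendsto (fun i => volterraC (2 * h i) (mul_pos two_pos (hpos i)) (μ i • Q)) l
      (𝓝 (volterraC (2 * h₀) (mul_pos two_pos hh) (μ₀ • Q))) := by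
    simp only [volterraC_smul]
    exact hμ.smul h1
  exact (isBoundedBilinearMap_apply.continuous.tendsto (_, _)).comp
    (h2.prodMk_nhds (tendsto_jb hpos hh hlim hμ hν hs))

lemma tendsto_integral_mul_bcf {k : ℝ → ℂ} (hk : Integrable k)
    {f : ι → BoundedContinuousFunction ℝ ℂ} {f₀ : BoundedContinuousFunction ℝ ℂ}
    (hf : Tendsto f l (𝓝 f₀)) :
    Tendsto (fun i => ∫ x, f i x * k x) l (𝓝 (∫ x, f₀ x * k x)) := by
  have hi : ∀ g : BoundedContinuousFunction ℝ ℂ, Integrable fun x => g x * k x := fun g =>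
    hk.bdd_mul g.continuous.aestronglyMeasurable (.of_forall g.norm_coe_le_norm)
  rw [tendsto_iff_norm_sub_tendsto_zero] at hf ⊢
  refine squeeze_zero (fun _ => norm_nonneg _) (g := fun i => ‖f i - f₀‖ * ∫ x, ‖k x‖)
    (fun i => ?_) ?_
  · rw [← integral_sub (hi _) (hi _), ← integral_const_mul]
    refine norm_integral_le_of_norm_le (hk.norm.const_mul _) (.of_forall fun x => ?_)
    rw [← sub_mul, norm_mul]
    gcongr
    exact (f i - f₀).norm_coe_le_norm x
  · simpa using hf.mul_const (∫ x, ‖k x‖)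

/-- The derivative of the inverse transmission coefficient along a curve of parameters. -/
lemma hasDerivWithinAt_ja {𝕜 : Type*} [NontriviallyNormedField 𝕜] [NormedAlgebra 𝕜 ℂ]
    {η : 𝕜 → ℝ} {μ ν : 𝕜 → ℂ} {η' μ' ν' : ℂ} {s : Set 𝕜} {t : 𝕜} (hpos : ∀ k, 0 < η k)
    (hη : HasDerivWithinAt (fun k => (η k : ℂ)) η' s t) (hμ : HasDerivWithinAt μ μ' s t)
    (hν : HasDerivWithinAt ν ν' s t) (hst : Small (η t) (μ t • Q) (ν t • R))
    (hs : ∀ᶠ k in 𝓝[s \ {t}] t, Small (η k) (μ k • Q) (ν k • R)) :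
    HasDerivWithinAt (fun k => ja (hpos k) (μ k • Q) (ν k • R))
      (ν' * (∫ x, jc (hpos t) (μ t • Q) (ν t • R) x * (R x * rb (hpos t) (μ t • Q) (ν t • R) x))
        - μ' * (∫ x, jb (hpos t) (μ t • Q) (ν t • R) x * (Q x * rs (hpos t) (μ t • Q) (ν t • R) x))
        + 2 * η' * ∫ x, jc (hpos t) (μ t • Q) (ν t • R) x * rs (hpos t) (μ t • Q) (ν t • R) x)
      s t := by
  have cη : Tendsto η (𝓝[s \ {t}] t) (𝓝 (η t)) := by
    have := (Complex.continuous_re.tendsto _).comp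
      (hη.continuousWithinAt.tendsto.mono_left (nhdsWithin_mono t (sdiff_subset (t := {t}))))
    simpa [Function.comp_def] using this
  have cμ := hμ.continuousWithinAt.tendsto.mono_left (nhdsWithin_mono t (sdiff_subset (t := {t})))
  have cν := hν.continuousWithinAt.tendsto.mono_left (nhdsWithin_mono t (sdiff_subset (t := {t})))
  -- Only the left Jost solution moves with the parameter; the right one stays frozen at t.
  -- Continuity of `jb` and `jc` is therefore sufficient.
  have cb := tendsto_jb hpos (hpos t) cη cμ cν hst
  have cc := tendsto_jc hpos (hpos t) cη cμ cν hst
  have l1 := tendsto_integral_mul_bcf (k := fun x => R x * rb (hpos t) (μ t • Q) (ν t • R) x)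
    (integrable_schwartz_mul_of_bdd R (continuous_rb _) (norm_rb_le _)) cc
  have l2 := tendsto_integral_mul_bcf (k := fun x => Q x * rs (hpos t) (μ t • Q) (ν t • R) x)
    (integrable_schwartz_mul_of_bdd Q (continuous_rs _) (norm_rs_le _)) cb
  have l3 := tendsto_integral_mul_bcf (integrable_rs (hpos t) (Q := μ t • Q) (R := ν t • R)) cc
  rw [hasDerivWithinAt_iff_tendsto_slope] at hη hμ hν ⊢
  refine (((hν.mul l1).sub (hμ.mul l2)).add ((hη.const_mul 2).mul l3)).congr' ?_
  filter_upwards [hs] with k hk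
  -- The exact difference formula makes the slope a sum of slopes of the parameters times convergent
  -- integrals.
  have e := ja_sub_ja (hpos t) (hpos k) hst hk
  have e1 : (∫ x, (ν k • R - ν t • R) x * jc (hpos k) (μ k • Q) (ν k • R) x
      * rb (hpos t) (μ t • Q) (ν t • R) x) = (ν k - ν t) *
        ∫ x, jc (hpos k) (μ k • Q) (ν k • R) x * (R x * rb (hpos t) (μ t • Q) (ν t • R) x) := by
    rw [← integral_const_mul]
    refine integral_congr_ae (.of_forall fun x => ?_)
    simp only [_root_.sub_apply, _root_.smul_apply, smul_eq_mul]
    ring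
  have e2 : (∫ x, (μ k • Q - μ t • Q) x * jb (hpos k) (μ k • Q) (ν k • R) x
      * rs (hpos t) (μ t • Q) (ν t • R) x) = (μ k - μ t) *
        ∫ x, jb (hpos k) (μ k • Q) (ν k • R) x * (Q x * rs (hpos t) (μ t • Q) (ν t • R) x) := by
    rw [← integral_const_mul]
    refine integral_congr_ae (.of_forall fun x => ?_)
    simp only [_root_.sub_apply, _root_.smul_apply, smul_eq_mul]
    ring
  rw [e1, e2] at e
  simp only [slope_def_module, e]
  rw [smul_add (k - t)⁻¹ (_ - _), smul_sub (k - t)⁻¹ (_ * _)]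
  simp only [smul_mul_assoc, mul_smul_comm, mul_assoc]

lemma conj_expKer (h x y : ℝ) : conj (expKer h x y) = expKer h x y := by
  rw [expKer, map_mul, conj_ofReal]
  congr 1
  rw [step]
  split_ifs
  · simp
  · norm_num [Complex.ext_iff]
  · simp

/-- The kernel is real, so the conjugate of b solves the integral equation with conjugated
potentials, and that equation is uniquely solvable. -/
lemma jb_conjS {h : ℝ} (hh : 0 < h) {Q R : 𝓢(ℝ, ℂ)} (hs : Small h Q R)
    (hs' : Small h (conjS Q) (conjS R)) : jb hh (conjS Q) (conjS R) = star (jb hh Q R) := by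
  have hc : volterraC (2 * h) (mul_pos two_pos hh) (conjS Q) (star (jb hh Q R))
      = star (jc hh Q R) := by
    ext x
    change _ = conj (jc hh Q R x)
    rw [jc_apply, volterraC_apply, ← integral_conj]
    refine integral_congr_ae (.of_forall fun y => ?_)
    simp only [map_mul, conj_expKer]
    rfl
  have hb : (1 - volterraJ (conjS R) ∘L volterraC (2 * h) (mul_pos two_pos hh) (conjS Q))
      (star (jb hh Q R)) = BoundedContinuousFunction.const ℝ 1 := by
    change star (jb hh Q R) - volterraJ (conjS R)
      (volterraC (2 * h) (mul_pos two_pos hh) (conjS Q) (star (jb hh Q R))) = _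
    rw [hc, sub_eq_iff_eq_add]
    ext x
    change conj (jb hh Q R x) = 1 + volterraJ (conjS R) (star (jc hh Q R)) x
    rw [jb_apply hh hs, volterraJ_apply, map_add, map_one, ← integral_conj]
    simp only [map_mul]
    rfl
  have := congrArg (fun T => T (star (jb hh Q R))) (Ring.inverse_mul_cancel _ (hs'.isUnit hh))
  rw [jb, ← hb]
  exact this

lemma norm_toLp_conjS (Q : 𝓢(ℝ, ℂ)) : ‖(conjS Q).toLp 2‖ = ‖Q.toLp 2‖ := by
  rw [← sq_eq_sq₀ (norm_nonneg _) (norm_nonneg _), ← integral_norm_sq_eq, ← integral_norm_sq_eq]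
  simp

lemma Small.conjS {h : ℝ} {Q R : 𝓢(ℝ, ℂ)} (hs : Small h Q R) :
    Small h (conjS Q) (conjS R) :=
  ⟨by rw [norm_toLp_conjS]; exact hs.left, by rw [norm_toLp_conjS]; exact hs.right⟩

lemma ja_conjS {h : ℝ} (hh : 0 < h) {Q R : 𝓢(ℝ, ℂ)} (hs : Small h Q R) :
    ja hh (conjS Q) (conjS R) = conj (ja hh Q R) := by
  have h1 := tendsto_jb_atTop hh hs.conjS
  rw [jb_conjS hh hs hs.conjS] at h1
  exact tendsto_nhds_unique h1
    ((Complex.continuous_conj.tendsto _).comp (tendsto_jb_atTop hh hs))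

end Parameter

/-! ### The trace of (1 - cB)⁻¹B through the Green's function -/

section TraceFormula

open Set Filter Topology

variable {h : ℝ} (hh : 0 < h) {Q R : 𝓢(ℝ, ℂ)}

lemma isTraceClass_birman {z : ℝ} (hz : z ≠ 0) (Q R : 𝓢(ℝ, ℂ)) : IsTraceClass (birman z Q R) :=
  ⟨_, _, isHilbertSchmidt_resolvMul hz Q, isHilbertSchmidt_resolvMul (neg_ne_zero.2 hz) R, rfl⟩

/-- The functional `X ↦ tr (X B)`. -/
def traceMul {z : ℝ} (hz : z ≠ 0) (Q R : 𝓢(ℝ, ℂ)) : (L2 →L[ℂ] L2) →L[ℂ] ℂ :=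
  LinearMap.mkContinuous
    { toFun := fun X => trace (X ∘L birman z Q R)
      map_add' := fun X Y => by
        rw [ContinuousLinearMap.add_comp]
        exact trace_add ((isTraceClass_birman hz Q R).comp_left X)
          ((isTraceClass_birman hz Q R).comp_left Y)
      map_smul' := fun c X => by
        rw [ContinuousLinearMap.smul_comp, trace_smul]
        rfl }
    (hsNorm (resolvMul z Q) * hsNorm (resolvMul (-z) R))
    fun X => by
      have hQ := isHilbertSchmidt_resolvMul hz Q
      have h1 := norm_trace_comp_le (hQ.comp_left X)
        (isHilbertSchmidt_resolvMul (neg_ne_zero.2 hz) R)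
      refine h1.trans ((mul_le_mul_of_nonneg_right (hQ.hsNorm_comp_left_le X)
        (hsNorm_nonneg _)).trans (le_of_eq ?_))
      ring

lemma traceMul_apply {z : ℝ} (hz : z ≠ 0) (Q R : 𝓢(ℝ, ℂ)) (X : L2 →L[ℂ] L2) :
    traceMul hz Q R X = trace (X ∘L birman z Q R) := rfl

lemma Small.norm_traceMul_le (hs : Small h Q R) : ‖traceMul hh.ne' Q R‖ ≤ 1 / 4 := by
  refine (LinearMap.mkContinuous_norm_le _
    (mul_nonneg (hsNorm_nonneg _) (hsNorm_nonneg _)) _).trans ?_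
  calc hsNorm (resolvMul h Q) * hsNorm (resolvMul (-h) R) ≤ 1 / 2 * (1 / 2) := by
        gcongr
        · exact hsNorm_nonneg _
        · exact hs.hsNorm_left_le hh
        · exact hs.hsNorm_right_le hh
    _ = 1 / 4 := by norm_num

lemma traceMul_pow {z : ℝ} (hz : z ≠ 0) (Q R : 𝓢(ℝ, ℂ)) (m : ℕ) :
    traceMul hz Q R (birman z Q R ^ m) = trace (birman z Q R ^ (m + 1)) := by
  rw [pow_succ]
  rfl

lemma Small.norm_trace_birman_pow_le (hh : 0 < h) (hs : Small h Q R) (m : ℕ) :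
    ‖trace (birman h Q R ^ (m + 1))‖ ≤ (1 / 4) ^ (m + 1) := by
  have h2 : ‖birman h Q R ^ m‖ ≤ (1 / 4) ^ m := by
    rcases Nat.eq_zero_or_pos m with rfl | hm
    · rw [pow_zero, pow_zero]
      exact ContinuousLinearMap.norm_id_le
    · exact (norm_pow_le' _ hm).trans (pow_le_pow_left₀ (norm_nonneg _) (hs.norm_birman_le hh) m)
  rw [← traceMul_pow hh.ne', pow_succ, mul_comm]
  refine (ContinuousLinearMap.le_opNorm _ _).trans ?_
  gcongr
  exact hs.norm_traceMul_le hh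

lemma fourierMult_neg {m : ℝ → ℂ} (hm : BddSymbol m) :
    fourierMult (fun ξ => -m ξ) = -fourierMult m := by
  have hm' : BddSymbol fun ξ => -m ξ := by
    simpa using (BddSymbol.mul ⟨measurable_const, 1, by simp⟩ hm : BddSymbol fun ξ => (-1 : ℂ) * m ξ)
  refine ContinuousLinearMap.ext fun f => ?_
  rw [_root_.neg_apply, fourierMult_apply, fourierMult_apply]
  have : ∀ u : L2, mulOp (fun η => -m (2 * Real.pi * η)) u = -mulOp (fun η => m (2 * Real.pi * η)) u := by
    intro u
    refine Lp.ext ?_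
    filter_upwards [coeFn_mulOp hm'.memLp u, coeFn_mulOp hm.memLp u,
      Lp.coeFn_neg (mulOp (fun η => m (2 * Real.pi * η)) u)] with x h1 h2 h3
    rw [h1, h3, Pi.neg_apply, h2, neg_mul]
  rw [this]
  exact map_neg (Lp.fourierTransformₗᵢ ℝ ℂ).symm _

lemma adjoint_resolv {h : ℝ} (hh : h ≠ 0) :
    ContinuousLinearMap.adjoint (resolv h) = -resolv (-h) := by
  rw [resolv, fourierMult_adjoint (bddSymbol_inv hh), resolv,
    ← fourierMult_neg (bddSymbol_inv (neg_ne_zero.2 hh))]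
  congr 1
  funext ξ
  rw [map_inv₀, ← inv_neg]
  congr 1
  simp only [map_add, map_mul, conj_I, conj_ofReal, ofReal_neg]
  ring

lemma hasKernel_adjoint_resolvMul (hh : 0 < h) (Q : 𝓢(ℝ, ℂ)) :
    HasKernel (ContinuousLinearMap.adjoint (resolvMul h Q))
      fun x y => conj (Q x) * expKer h y x where
  row x := (memLp_expKer_flip hh x).const_mul _
  sq := by
    have h1 : ∀ x, ∫⁻ y, ‖conj (Q x) * expKer h y x‖ₑ ^ 2 =
        ENNReal.ofReal (1 / (2 * h) * ‖Q x‖ ^ 2) := fun x => by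
      simp only [enorm_mul, mul_pow]
      rw [lintegral_const_mul' _ _ (by simp), lintegral_enorm_expKer_flip hh, enorm_sq_eq_ofReal,
        RCLike.norm_conj, mul_comm, ENNReal.ofReal_mul (by positivity)]
    simp only [h1]
    rw [← ofReal_integral_eq_lintegral_ofReal ((integrable_norm_sq Q).const_mul _)
      (.of_forall fun x => by positivity)]
    exact ENNReal.ofReal_lt_top
  rep f := by
    rw [resolvMul, ContinuousLinearMap.adjoint_comp, adjoint_resolv hh.ne', mulOp_adjoint
      (SchwartzMap.bdd Q), ContinuousLinearMap.comp_apply, _root_.neg_apply, map_neg]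
    filter_upwards [resolv_neg_ae_eq hh f, Lp.coeFn_neg
      (mulOp (fun x => conj (Q x)) (resolv (-h) f)),
      coeFn_mulOp (SchwartzMap.bdd Q).star (resolv (-h) f)] with x h1 h2 h3
    have h3' : (mulOp (fun x => conj (Q x)) (resolv (-h) f)) x = conj (Q x) * resolv (-h) f x := h3
    rw [h2, Pi.neg_apply, h3', h1, ← mul_neg, ← integral_neg, ← integral_const_mul]
    refine integral_congr_ae (.of_forall fun y => ?_)
    simp only
    ring

lemma Small.smul_right (hs : Small h Q R) {t : ℝ} (ht0 : 0 ≤ t) (ht1 : t ≤ 1) :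
    Small h Q ((t : ℂ) • R) := by
  refine ⟨hs.left, ?_⟩
  rw [← integral_norm_sq_eq]
  have h1 : ∀ x, ‖((t : ℂ) • R) x‖ ^ 2 = t ^ 2 * ‖R x‖ ^ 2 := fun x => by
    rw [_root_.smul_apply, smul_eq_mul, norm_mul, mul_pow, norm_real, Real.norm_of_nonneg ht0]
  simp only [h1]
  rw [integral_const_mul, integral_norm_sq_eq]
  exact (mul_le_of_le_one_left (by positivity) (pow_le_one₀ ht0 ht1)).trans hs.right

lemma mulOp_smul (c : ℂ) (R : 𝓢(ℝ, ℂ)) : mulOp (c • R : 𝓢(ℝ, ℂ)) = c • mulOp R := by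
  refine ContinuousLinearMap.ext fun u => Lp.ext ?_
  rw [_root_.smul_apply]
  filter_upwards [coeFn_mulOp (SchwartzMap.bdd (c • R)) u, coeFn_mulOp (SchwartzMap.bdd R) u,
    Lp.coeFn_smul c (mulOp R u)] with x h1 h2 h3
  rw [h1, h3, Pi.smul_apply, h2, _root_.smul_apply, smul_eq_mul, smul_eq_mul, mul_assoc]

lemma birman_smul_right (c : ℂ) : birman h Q (c • R) = c • birman h Q R := by
  rw [birman, birman, resolvMul, resolvMul, resolvMul, mulOp_smul]
  refine ContinuousLinearMap.ext fun f => ?_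
  simp

/-- With w = (1 - cB)⁻¹g, the pair (Bw, (∂ - h)⁻¹Rw) solves the system with potentials Q and cR and
source (0, Rg). This identifies the kernel of the left-hand operator as G₂₂(x, y)R(y). -/
lemma resolvMul_inverse_eq (hh : 0 < h) {c : ℂ} (hsc : Small h Q (c • R)) (g : L2) :
    resolvMul (-h) R (Ring.inverse (1 - birman h Q (c • R)) g)
      = (solOp h Q (c • R) (0, mulOp R g)).2 := by
  set w := Ring.inverse (1 - birman h Q (c • R)) g with hw
  have hw' : w = g + birman h Q (c • R) w := (eq_inverse_apply_iff (hsc.isUnit_birman hh) w g).1 hw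
  have h1 : IsSol h Q (c • R) (birman h Q R w, resolvMul (-h) R w) (0, mulOp R g) := by
    constructor
    · rw [zero_add]
      rfl
    · change resolv (-h) (mulOp R w) =
        resolv (-h) (mulOp R g + mulOp (c • R : 𝓢(ℝ, ℂ)) (birman h Q R w))
      congr 1
      rw [mulOp_smul]
      conv_lhs => rw [hw', birman_smul_right]
      rw [map_add, _root_.smul_apply, _root_.smul_apply, map_smul]
  rw [← (isSol_iff_eq_solOp hh hsc _ _).1 h1]

lemma lintegral_enorm_exp_abs (hh : 0 < h) (C : ℝ) (y : ℝ) :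
    ∫⁻ x, ‖((C * Real.exp (-(h * |x - y|)) : ℝ) : ℂ)‖ₑ ^ 2
      = ENNReal.ofReal (C ^ 2 * (2 / (2 * h))) := by
  have h1 : ∀ x : ℝ, ‖((C * Real.exp (-(h * |x - y|)) : ℝ) : ℂ)‖ₑ ^ 2
      = ENNReal.ofReal (C ^ 2 * Real.exp (-(2 * h * |y - x|))) := fun x => by
    rw [enorm_sq_eq_ofReal, norm_real, Real.norm_eq_abs, sq_abs, mul_pow, ← Real.exp_nat_mul,
      abs_sub_comm]
    congr 3
    push_cast
    ring
  simp only [h1]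
  rw [← ofReal_integral_eq_lintegral_ofReal
    ((integrable_exp_neg_abs (mul_pos two_pos hh) y).const_mul _)
    (.of_forall fun x => by positivity), integral_const_mul, integral_exp_neg_abs (by positivity)]

lemma hasKernel_resolvMul_inverse {c : ℂ} (hsc : Small h Q (c • R)) :
    HasKernel (resolvMul (-h) R ∘L Ring.inverse (1 - birman h Q (c • R)))
      fun x y => greenFun hh Q (c • R) x y 1 1 * R y where
  row x := memLp_mul_schwartz (memLp_greenFun hh 1 1 x) R
  sq := by
    obtain ⟨C, hC⟩ := exists_norm_greenFun_le hh Q (c • R)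
    refine lt_of_le_of_lt (lintegral_mono fun x => lintegral_mono fun y => ?_) ((lintegral_kernel_mul
      (k := fun x y => ((C * Real.exp (-(h * |x - y|)) : ℝ) : ℂ)) (by fun_prop) (by positivity)
      (lintegral_enorm_exp_abs hh C) R).trans_lt ENNReal.ofReal_lt_top)
    rw [enorm_sq_eq_ofReal, enorm_sq_eq_ofReal, norm_mul, norm_mul, norm_real]
    gcongr
    exact (hC 1 1 x y).trans (le_abs_self _)
  rep g := by
    rw [ContinuousLinearMap.comp_apply, resolvMul_inverse_eq hh hsc]
    filter_upwards [(solOp_inr_ae_eq hh hsc (mulOp R g)).2] with x hx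
    rw [hx]
    refine integral_congr_ae ?_
    filter_upwards [coeFn_mulOp (SchwartzMap.bdd R) g] with y hy
    rw [hy, mul_assoc]

/-- Only x < z contributes. There G₂₂ carries another factor e^{-h(z - x)}, and the product e^{-2h(z
- x)} is the kernel that defines c. -/
lemma integral_expKer_greenFun (Q R : 𝓢(ℝ, ℂ)) (z : ℝ) :
    ∫ x, expKer h z x * (Q x * greenFun hh Q R x z 1 1)
      = -(jc hh Q R z * rb hh Q R z) / ja hh Q R := by
  rw [jc_apply, ← integral_mul_const, ← integral_neg, ← integral_div]
  refine integral_congr_ae ?_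
  filter_upwards [volume.ae_ne z] with x hx
  rw [greenFun_one_one]
  rcases lt_or_gt_of_ne hx with hxz | hxz
  · rw [expKer_eq_zero hxz, expKer_eq_of_lt hxz, expKer_eq_of_lt hxz]
    have : Real.exp (-(2 * h * (z - x)))
        = Real.exp (-(h * (z - x))) * Real.exp (-(h * (z - x))) := by
      rw [← Real.exp_add]
      ring_nf
    rw [this]
    push_cast
    ring
  · rw [expKer_eq_zero hxz, expKer_eq_zero hxz]
    simp

/-- Cyclicity writes the trace as that of (∂ + h)⁻¹Q times (∂ - h)⁻¹R(1 - cB)⁻¹, both with known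
kernels. The right-hand side is minus the logarithmic derivative of a under R ↦ cR. -/
lemma traceMul_inverse {c : ℂ} (hsc : Small h Q (c • R)) :
    traceMul hh.ne' Q R (Ring.inverse (1 - birman h Q (c • R))) =
      -(∫ x, jc hh Q (c • R) x * (R x * rb hh Q (c • R) x)) / ja hh Q (c • R) := by
  rw [traceMul_apply, ← (isTraceClass_birman hh.ne' Q R).trace_comm]
  have h1 := HasKernel.trace_comp (hasKernel_adjoint_resolvMul hh Q)
    (hasKernel_resolvMul_inverse hh hsc)
  refine h1.trans ?_
  obtain ⟨C, hC⟩ := exists_norm_greenFun_le hh Q (c • R)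
  rw [integral_integral_swap]
  · rw [← integral_neg, ← integral_div]
    refine integral_congr_ae (.of_forall fun z => ?_)
    have h2 := integral_expKer_greenFun hh Q (c • R) z
    calc ∫ x, greenFun hh Q (c • R) x z 1 1 * R z * conj (conj (Q x) * expKer h z x)
        = R z * ∫ x, expKer h z x * (Q x * greenFun hh Q (c • R) x z 1 1) := by
          rw [← integral_const_mul]
          refine integral_congr_ae (.of_forall fun x => ?_)
          simp only [map_mul, conj_expKer, Complex.conj_conj]
          ring
      _ = _ := by
          rw [h2]
          ring
  · have hm1 := measurable_greenFun hh (Q := Q) (R := c • R) 1 1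
    have hm2 : Measurable fun p : ℝ × ℝ => expKer h p.2 p.1 :=
      (measurable_expKer h).comp measurable_swap
    have hQ := Q.continuous.measurable
    have hR := R.continuous.measurable
    refine ((Q.integrable (μ := volume)).norm.mul_prod (R.integrable (μ := volume)).norm
      |>.const_mul |C|).mono' ?_ (.of_forall fun p => ?_)
    · refine Measurable.aestronglyMeasurable ?_
      refine (hm1.mul (hR.comp measurable_snd)).mul ?_
      exact Complex.continuous_conj.measurable.comp
        ((Complex.continuous_conj.measurable.comp (hQ.comp measurable_fst)).mul hm2)
    · obtain ⟨x, y⟩ := p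
      simp only [Function.uncurry_apply_pair, map_mul, norm_mul, conj_expKer, Complex.conj_conj]
      have e1 : ‖greenFun hh Q (c • R) x y 1 1‖ ≤ |C| := (hC 1 1 x y).trans
        ((le_abs_self _).trans (by
          rw [abs_mul, abs_of_nonneg (Real.exp_nonneg _)]
          exact mul_le_of_le_one_right (abs_nonneg _) (Real.exp_le_one_iff.2 (by
            have := mul_nonneg hh.le (abs_nonneg (x - y)); linarith))))
      calc _ ≤ |C| * ‖R y‖ * (‖Q x‖ * 1) := by
            gcongr
            exact norm_expKer_le_one hh y x
        _ = _ := by ring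

lemma traceMul_inverse_eq_tsum {c : ℂ} (hs : Small h Q R) (hc : ‖c‖ ≤ 1) :
    traceMul hh.ne' Q R (Ring.inverse (1 - birman h Q (c • R))) =
      ∑' m : ℕ, c ^ m * trace (birman h Q R ^ (m + 1)) := by
  have h1 : ‖c • birman h Q R‖ < 1 := by
    rw [norm_smul]
    have := hs.norm_birman_le hh
    nlinarith [norm_nonneg c, norm_nonneg (birman h Q R)]
  rw [birman_smul_right, ← geom_series_eq_inverse _ h1,
    ContinuousLinearMap.map_tsum _ (summable_geometric_of_norm_lt_one h1)]
  refine tsum_congr fun m => ?_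
  rw [smul_pow, map_smul, traceMul_pow, smul_eq_mul]

end TraceFormula

/-! ### The trace series equals -log a -/

section TraceSeries

open Set Filter Topology

variable {h : ℝ} (hh : 0 < h) {Q R : 𝓢(ℝ, ℂ)}

/-- The series `∑ tᵐ tr(Bᵐ) / m`. -/
def traceSeries (h : ℝ) (Q R : 𝓢(ℝ, ℂ)) (t : ℝ) : ℂ :=
  ∑' m : ℕ, (t : ℂ) ^ (m + 1) * (1 / ((m + 1 : ℕ) : ℂ) * trace (birman h Q R ^ (m + 1)))

lemma hasDerivAt_traceSeries (hh : 0 < h) (hs : Small h Q R) {t : ℝ} (ht : t ∈ Ioo (-2 : ℝ) 2) :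
    HasDerivAt (traceSeries h Q R)
      (∑' m : ℕ, (t : ℂ) ^ m * trace (birman h Q R ^ (m + 1))) t := by
  -- Traces are at most 4^{-(m+1)}, so for |y| < 2 the differentiated terms are dominated by
  -- 2^{-m}/4. The interval (-2, 2) contains [0, 1] in its interior.
  refine hasDerivAt_tsum_of_isPreconnected (u := fun m : ℕ => (1 / 4) * (1 / 2 : ℝ) ^ m)
    (t := Ioo (-2 : ℝ) 2) (y₀ := (0 : ℝ))
    (g := fun m (y : ℝ) => (y : ℂ) ^ (m + 1) * (1 / ((m + 1 : ℕ) : ℂ) * trace (birman h Q R ^ (m + 1))))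
    (g' := fun m (y : ℝ) => (y : ℂ) ^ m * trace (birman h Q R ^ (m + 1)))
    (summable_geometric_two.mul_left _) isOpen_Ioo isPreconnected_Ioo (fun m y _ => ?_)
    (fun m y hy => ?_) (by norm_num) ?_ ht
  · have h1 : HasDerivAt (fun y : ℝ => (y : ℂ) ^ (m + 1)) (((m + 1 : ℕ) : ℂ) * (y : ℂ) ^ m) y := by
      simpa using (hasDerivAt_pow (m + 1) (y : ℂ)).comp_ofReal
    refine (h1.mul_const _).congr_deriv ?_
    have h2 : ((m + 1 : ℕ) : ℂ) ≠ 0 := Nat.cast_ne_zero.2 m.succ_ne_zero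
    field_simp
  · rw [norm_mul, norm_pow, norm_real, Real.norm_eq_abs]
    have h1 : |y| ≤ 2 := abs_le.2 ⟨hy.1.le, hy.2.le⟩
    calc |y| ^ m * ‖trace (birman h Q R ^ (m + 1))‖ ≤ 2 ^ m * (1 / 4) ^ (m + 1) := by
          gcongr
          exact hs.norm_trace_birman_pow_le hh m
      _ = 1 / 4 * (1 / 2) ^ m := by
          rw [pow_succ, ← mul_assoc, ← mul_pow]
          norm_num
          ring
  · simp

lemma hasDerivWithinAt_log_ja (hs : Small h Q R) {t : ℝ} (ht : t ∈ Icc (0 : ℝ) 1) :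
    HasDerivWithinAt (fun t : ℝ => Complex.log (ja hh Q ((t : ℂ) • R)))
      ((∫ x, jc hh Q ((t : ℂ) • R) x * (R x * rb hh Q ((t : ℂ) • R) x)) / ja hh Q ((t : ℂ) • R))
      (Icc 0 1) t := by
  have hsm : ∀ k ∈ Icc (0 : ℝ) 1, Small h Q ((k : ℂ) • R) := fun k hk => hs.smul_right hk.1 hk.2
  have h1 := hasDerivWithinAt_ja (𝕜 := ℝ) (η := fun _ => h) (μ := fun _ => 1)
    (ν := fun k : ℝ => (k : ℂ)) (η' := 0) (μ' := 0) (ν' := 1) (s := Icc 0 1) (t := t)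
    (Q := Q) (R := R) (fun _ => hh) (hasDerivWithinAt_const t _ _) (hasDerivWithinAt_const t _ _)
    Complex.ofRealCLM.hasDerivWithinAt (by rw [one_smul]; exact hsm t ht)
    (by
      filter_upwards [self_mem_nhdsWithin] with k hk
      rw [one_smul]
      exact hsm k hk.1)
  simp only [one_smul, one_mul, zero_mul, mul_zero, sub_zero, add_zero] at h1
  exact h1.clog_real (mem_slitPlane_of_norm_sub_one_le (norm_ja_sub_one_le hh (hsm t ht)))

/-- The logarithmic perturbation determinant equals minus the logarithm of the inverse
transmission coefficient. -/
lemma tsum_trace_birman (hs : Small h Q R) :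
    ∑' m : ℕ, 1 / ((m + 1 : ℕ) : ℂ) * trace (birman h Q R ^ (m + 1)) = -Complex.log (ja hh Q R) := by
  -- Along the homotopy R ↦ tR the derivatives of the trace series and of log a cancel by the trace
  -- formula. At t = 0 the series vanishes and a = 1.
  have hd : ∀ t ∈ Icc (0 : ℝ) 1, HasDerivWithinAt
      (fun t : ℝ => traceSeries h Q R t + Complex.log (ja hh Q ((t : ℂ) • R))) 0 (Icc 0 1) t := by
    intro t ht
    refine ((hasDerivAt_traceSeries hh hs ⟨by linarith [ht.1], by linarith [ht.2]⟩).hasDerivWithinAt.add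
      (hasDerivWithinAt_log_ja hh hs ht)).congr_deriv ?_
    rw [← traceMul_inverse_eq_tsum hh hs (by rw [norm_real, Real.norm_of_nonneg ht.1]; exact ht.2),
      traceMul_inverse hh (hs.smul_right ht.1 ht.2)]
    ring
  have hc := constant_of_has_deriv_right_zero (fun t ht => (hd t ht).continuousWithinAt)
    (fun t ht => (hd t (Ico_subset_Icc_self ht)).mono_of_mem_nhdsWithin (Icc_mem_nhdsGE_of_mem ht))
    1 (right_mem_Icc.2 zero_le_one)
  simp only [traceSeries, ofReal_one, one_smul, one_pow, one_mul, ofReal_zero] at hc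
  simp only [zero_pow (Nat.succ_ne_zero _), zero_mul, tsum_zero, zero_add] at hc
  have h0 : ja hh Q ((0 : ℂ) • R) = 1 := by simp [ja]
  rw [h0, Complex.log_one] at hc
  exact eq_neg_of_add_eq_zero_left hc

end TraceSeries

/-! ### Traces of the powers of ΛΓ -/

section PerturbationOperators

open Filter Topology ContinuousLinearMap

lemma clm_comp_assoc (A B C : L2 →L[ℂ] L2) : (A ∘L B) ∘L C = A ∘L (B ∘L C) := mul_assoc A B C

lemma clm_mul_eq (A B : L2 →L[ℂ] L2) : A * B = A ∘L B := by
  ext1 f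
  rfl

/-- The symbol of `(∂ + z)^{-1/2}`. -/
def sqrtSymbol (z : ℝ) (ξ : ℝ) : ℂ := (I * (ξ : ℂ) + z) ^ (-(1 / 2) : ℂ)

variable {z : ℝ}

lemma sqrtSymbol_mul_self (hz : z ≠ 0) (ξ : ℝ) :
    sqrtSymbol z ξ * sqrtSymbol z ξ = (I * (ξ : ℂ) + z)⁻¹ := by
  rw [sqrtSymbol, ← Complex.cpow_add _ _ (symbol_ne_zero hz ξ), ← Complex.cpow_neg_one]
  norm_num

lemma norm_sqrtSymbol_sq (hz : z ≠ 0) (ξ : ℝ) :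
    ‖sqrtSymbol z ξ‖ ^ 2 = ‖(I * (ξ : ℂ) + z)⁻¹‖ := by
  rw [← sqrtSymbol_mul_self hz, norm_mul, sq]

lemma bddSymbol_sqrtSymbol (hz : z ≠ 0) : BddSymbol (sqrtSymbol z) := by
  obtain ⟨-, C, hC⟩ := bddSymbol_inv hz
  refine ⟨Measurable.pow_const (by fun_prop) _, 1 + C, fun ξ => ?_⟩
  have h1 := hC ξ
  rw [← norm_sqrtSymbol_sq hz] at h1
  nlinarith [norm_nonneg (sqrtSymbol z ξ), sq_nonneg (‖sqrtSymbol z ξ‖ - 1)]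

lemma sqrt_comp_sqrt (hz : z ≠ 0) :
    fourierMult (sqrtSymbol z) ∘L fourierMult (sqrtSymbol z) = resolv z := by
  rw [fourierMult_comp (bddSymbol_sqrtSymbol hz) (bddSymbol_sqrtSymbol hz), resolv]
  simp only [sqrtSymbol_mul_self hz]

/-- A multiplier whose symbol is dominated by that of `(∂ + z)⁻¹` gives a Hilbert-Schmidt operator
when followed by a multiplication. -/
lemma isHilbertSchmidt_fourierMult_mulOp (hz : z ≠ 0) (Q : 𝓢(ℝ, ℂ)) {f : ℝ → ℂ}
    (hf : Measurable f) {C : ℝ} (hC0 : 0 ≤ C) (hC : ∀ ξ : ℝ, ‖f ξ‖ ≤ C * ‖(I * (ξ : ℂ) + z)⁻¹‖) :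
    IsHilbertSchmidt (fourierMult f ∘L mulOp Q) ∧
      hsNorm (fourierMult f ∘L mulOp Q) ≤ C * hsNorm (resolvMul z Q) := by
  have hg : Measurable fun ξ : ℝ => f ξ * (I * (ξ : ℂ) + z) := by fun_prop
  have hgC : ∀ ξ : ℝ, ‖f ξ * (I * (ξ : ℂ) + z)‖ ≤ C := fun ξ => by
    have h1 := hC ξ
    have h2 : 0 < ‖I * (ξ : ℂ) + z‖ := norm_pos_iff.2 (symbol_ne_zero hz ξ)
    rw [norm_inv, ← div_eq_mul_inv, le_div_iff₀ h2] at h1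
    rwa [norm_mul]
  have h1 : fourierMult f ∘L mulOp Q =
      (fourierMult fun ξ : ℝ => f ξ * (I * (ξ : ℂ) + z)) ∘L resolvMul z Q := by
    rw [resolvMul, ← clm_comp_assoc, resolv,
      fourierMult_comp ⟨hg, C, hgC⟩ (bddSymbol_inv hz)]
    congr 2
    funext ξ
    rw [mul_inv_cancel_right₀ (symbol_ne_zero hz ξ)]
  have h2 := isHilbertSchmidt_resolvMul hz Q
  rw [h1]
  refine ⟨h2.comp_left _, (h2.hsNorm_comp_left_le _).trans ?_⟩
  gcongr
  · exact hsNorm_nonneg _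
  · exact norm_fourierMult_le hC0 hg hgC

lemma trace_adjoint_comp_self {T : L2 →L[ℂ] L2} (hT : IsHilbertSchmidt T) :
    trace (adjoint T ∘L T) = ((hsNorm T ^ 2 : ℝ) : ℂ) := by
  rw [← (Complex.hasSum_ofReal.2 hT.hasSum).tsum_eq, trace]
  refine tsum_congr fun i => ?_
  rw [comp_apply, adjoint_inner_right, inner_self_eq_norm_sq_to_K]
  norm_cast

/-- `(∂ + z)^{-1/2} Q (∂ - z)^{-1/2}`. -/
def sandwich (z : ℝ) (Q : 𝓢(ℝ, ℂ)) : L2 →L[ℂ] L2 :=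
  fourierMult (sqrtSymbol z) ∘L mulOp Q ∘L fourierMult (sqrtSymbol (-z))

/-- The symbol of (∂ + z)^{-1/2} decays only like |ξ|^{-1/2}, which is not square integrable. On a
bounded frequency band it is comparable with the symbol of the resolvent. -/
lemma norm_cutoff_mul_sqrtSymbol_le (hz : z ≠ 0) (n : ℕ) (ξ : ℝ) :
    ‖(Set.Icc (-n : ℝ) n).indicator 1 ξ * sqrtSymbol z ξ‖
      ≤ (1 + n + |z|) * ‖(I * (ξ : ℂ) + z)⁻¹‖ := by
  have h0 : (0 : ℝ) ≤ n := n.cast_nonneg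
  by_cases hξ : ξ ∈ Set.Icc (-n : ℝ) n
  · rw [Set.indicator_of_mem hξ, Pi.one_apply, one_mul, ← norm_sqrtSymbol_sq hz]
    set a := ‖sqrtSymbol z ξ‖ with ha
    have h1 : ‖I * (ξ : ℂ) + z‖ ≤ 1 + n + |z| := by
      refine (norm_add_le _ _).trans ?_
      rw [norm_mul, norm_I, one_mul, norm_real, norm_real, Real.norm_eq_abs, Real.norm_eq_abs]
      linarith [abs_le.2 hξ]
    have h2 : 0 < ‖I * (ξ : ℂ) + z‖ := norm_pos_iff.2 (symbol_ne_zero hz ξ)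
    have h3 : a ^ 2 * ‖I * (ξ : ℂ) + z‖ = 1 := by
      rw [ha, norm_sqrtSymbol_sq hz, norm_inv, inv_mul_cancel₀ h2.ne']
    have h4 : 0 ≤ a := norm_nonneg _
    have h5 : 1 ≤ a ^ 2 * (1 + n + |z|) := by
      calc (1 : ℝ) = a ^ 2 * ‖I * (ξ : ℂ) + z‖ := h3.symm
        _ ≤ a ^ 2 * (1 + n + |z|) := by gcongr
    -- With K = 1 + n + |z| ≥ 1, K a² ≥ 1 forces K a ≥ 1: otherwise a ≤ K a < 1 and K a² < 1.
    have h6 : 1 ≤ (1 + n + |z|) * a := by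
      by_contra! hlt
      have h7 : 1 ≤ 1 + n + |z| := by linarith [abs_nonneg z]
      have h8 : a ≤ (1 + n + |z|) * a := le_mul_of_one_le_left h4 h7
      nlinarith
    calc a = 1 * a := (one_mul a).symm
      _ ≤ ((1 + n + |z|) * a) * a := by gcongr
      _ = _ := by ring
  · rw [Set.indicator_of_notMem hξ, zero_mul, norm_zero]
    positivity

lemma cutoff_comp_sqrt (hz : z ≠ 0) (n : ℕ) : cutoff n ∘L fourierMult (sqrtSymbol z) =
    fourierMult fun ξ => (Set.Icc (-n : ℝ) n).indicator 1 ξ * sqrtSymbol z ξ := by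
  rw [cutoff, fourierMult_comp (bddSymbol_indicator n) (bddSymbol_sqrtSymbol hz)]

lemma isHilbertSchmidt_cutoff_sqrt_mulOp (hz : z ≠ 0) (Q : 𝓢(ℝ, ℂ)) (n : ℕ) :
    IsHilbertSchmidt (cutoff n ∘L fourierMult (sqrtSymbol z) ∘L mulOp Q) := by
  rw [← clm_comp_assoc, cutoff_comp_sqrt hz]
  exact (isHilbertSchmidt_fourierMult_mulOp hz Q
    ((bddSymbol_indicator n).mul (bddSymbol_sqrtSymbol hz)).1 (by positivity)
    (norm_cutoff_mul_sqrtSymbol_le hz n)).1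

/-- Write P for the cutoff, M = (∂ + z)^{-1/2}, N = (∂ - z)^{-1/2} and F = PM. Cyclicity gives
‖FQN‖² = tr((F*FQ)(NN*Q̄)) in Hilbert-Schmidt norm. The symbols of F*F and NN* are dominated by
those of the resolvents at z and -z, so both factors are Hilbert-Schmidt with bounds independent of
n. -/
lemma hsNorm_cutoff_sandwich_sq_le (hz : z ≠ 0) (Q : 𝓢(ℝ, ℂ)) (n : ℕ) :
    IsHilbertSchmidt (cutoff n ∘L sandwich z Q) ∧ hsNorm (cutoff n ∘L sandwich z Q) ^ 2
      ≤ hsNorm (resolvMul z Q) * hsNorm (resolvMul (-z) (conjS Q)) := by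
  have hz' := neg_ne_zero.2 hz
  have s1 := bddSymbol_sqrtSymbol hz
  have s2 := bddSymbol_sqrtSymbol hz'
  have s3 := (bddSymbol_indicator n).mul s1
  set F := cutoff n ∘L fourierMult (sqrtSymbol z) with hF
  set M := fourierMult (sqrtSymbol (-z)) with hM
  have hT : IsHilbertSchmidt (F ∘L mulOp Q) := by
    have := isHilbertSchmidt_cutoff_sqrt_mulOp hz Q n
    rwa [← clm_comp_assoc, ← hF] at this
  have hTM : cutoff n ∘L sandwich z Q = (F ∘L mulOp Q) ∘L M := by
    simp only [sandwich, hF, hM, clm_comp_assoc]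
  have hHS : IsHilbertSchmidt ((F ∘L mulOp Q) ∘L M) := hT.comp_right M
  rw [hTM]
  refine ⟨hHS, ?_⟩
  have hFF : adjoint F ∘L F = fourierMult fun ξ =>
      conj ((Set.Icc (-n : ℝ) n).indicator 1 ξ * sqrtSymbol z ξ)
        * ((Set.Icc (-n : ℝ) n).indicator 1 ξ * sqrtSymbol z ξ) := by
    rw [hF, cutoff_comp_sqrt hz, fourierMult_adjoint s3, fourierMult_comp s3.conj s3]
  have hMM : M ∘L adjoint M = fourierMult fun ξ => sqrtSymbol (-z) ξ * conj (sqrtSymbol (-z) ξ) := by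
    rw [hM, fourierMult_adjoint s2, fourierMult_comp s2 s2.conj]
  obtain ⟨a1, a2⟩ := isHilbertSchmidt_fourierMult_mulOp hz Q (C := 1)
    (s3.conj.mul s3).1 zero_le_one (fun ξ => by
      rw [norm_mul, RCLike.norm_conj, ← sq, norm_mul, mul_pow, norm_sqrtSymbol_sq hz]
      gcongr
      have h1 : ‖(Set.Icc (-n : ℝ) n).indicator (1 : ℝ → ℂ) ξ‖ ≤ 1 :=
        (norm_indicator_le_norm_self _ _).trans (by simp)
      exact pow_le_one₀ (norm_nonneg _) h1)
  obtain ⟨b1, b2⟩ := isHilbertSchmidt_fourierMult_mulOp hz' (conjS Q) (C := 1)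
    (s2.mul s2.conj).1 zero_le_one (fun ξ => by
      rw [norm_mul, RCLike.norm_conj, ← sq, norm_sqrtSymbol_sq hz', one_mul])
  rw [← hFF] at a1 a2
  rw [← hMM] at b1 b2
  have hQ : adjoint (mulOp Q) = mulOp (conjS Q) := mulOp_adjoint (SchwartzMap.bdd Q)
  have e1 : trace (adjoint ((F ∘L mulOp Q) ∘L M) ∘L ((F ∘L mulOp Q) ∘L M)) =
      trace (((adjoint F ∘L F) ∘L mulOp Q) ∘L ((M ∘L adjoint M) ∘L mulOp (conjS Q))) := by
    rw [← trace_comp_comm hHS hHS.adjoint]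
    have hX : IsTraceClass ((F ∘L mulOp Q) ∘L ((M ∘L adjoint M) ∘L mulOp (conjS Q))) :=
      ⟨_, _, hT, b1, rfl⟩
    have := hX.trace_comm (adjoint F)
    rw [adjoint_comp, adjoint_comp, hQ]
    simp only [clm_comp_assoc] at this ⊢
    exact this
  have e2 : ((hsNorm ((F ∘L mulOp Q) ∘L M) ^ 2 : ℝ) : ℂ) = _ :=
    (trace_adjoint_comp_self hHS).symm.trans e1
  have e3 := congrArg norm e2
  rw [norm_real, Real.norm_of_nonneg (sq_nonneg _)] at e3
  rw [e3]
  refine (norm_trace_comp_le a1 b1).trans ?_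
  rw [one_mul] at a2 b2
  gcongr
  · exact hsNorm_nonneg _
  · exact hsNorm_nonneg _

/-- The cutoffs converge strongly to the identity, so the uniform bound passes to every finite
partial sum. -/
lemma isHilbertSchmidt_of_cutoff {T : L2 →L[ℂ] L2} {C : ℝ}
    (h : ∀ n, IsHilbertSchmidt (cutoff n ∘L T) ∧ hsNorm (cutoff n ∘L T) ^ 2 ≤ C) :
    IsHilbertSchmidt T := by
  refine ⟨_, onBasis L2, summable_of_sum_le (c := C) (fun i => by positivity) fun s => ?_⟩
  have h1 : Tendsto (fun n => ∑ i ∈ s, ‖(cutoff n ∘L T) (onBasis L2 i)‖ ^ 2) atTop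
      (𝓝 (∑ i ∈ s, ‖T (onBasis L2 i)‖ ^ 2)) :=
    tendsto_finsetSum _ fun i _ => (tendsto_cutoff (T (onBasis L2 i))).norm.pow 2
  refine le_of_tendsto h1 (.of_forall fun n => ?_)
  exact ((h n).1.hasSum.summable.sum_le_tsum s fun i _ => by positivity).trans
    ((h n).1.hasSum.tsum_eq.le.trans (h n).2)

lemma isHilbertSchmidt_sandwich (hz : z ≠ 0) (Q : 𝓢(ℝ, ℂ)) : IsHilbertSchmidt (sandwich z Q) :=
  isHilbertSchmidt_of_cutoff (hsNorm_cutoff_sandwich_sq_le hz Q)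

lemma sandwich_mul_sandwich (hz : z ≠ 0) (Q R : 𝓢(ℝ, ℂ)) :
    sandwich z Q * sandwich (-z) R = fourierMult (sqrtSymbol z) *
      (mulOp Q * resolvMul (-z) R) * fourierMult (sqrtSymbol z) := by
  rw [resolvMul, ← sqrt_comp_sqrt (neg_ne_zero.2 hz), sandwich, sandwich, neg_neg]
  simp only [clm_mul_eq, clm_comp_assoc]

lemma sandwich_pow (hz : z ≠ 0) (Q R : 𝓢(ℝ, ℂ)) (m : ℕ) :
    (sandwich z Q * sandwich (-z) R) ^ (m + 1) = fourierMult (sqrtSymbol z) *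
      (mulOp Q * resolvMul (-z) R * birman z Q R ^ m) * fourierMult (sqrtSymbol z) := by
  rw [sandwich_mul_sandwich hz]
  have hB : birman z Q R = fourierMult (sqrtSymbol z) *
      (fourierMult (sqrtSymbol z) * (mulOp Q * resolvMul (-z) R)) := by
    rw [birman, resolvMul, ← sqrt_comp_sqrt hz]
    simp only [clm_mul_eq, clm_comp_assoc]
  induction m with
  | zero => simp
  | succ m ih =>
    rw [pow_succ, ih, pow_succ (birman z Q R), hB]
    noncomm_ring

lemma isTraceClass_sandwich_pow (hz : z ≠ 0) (Q R : 𝓢(ℝ, ℂ)) (m : ℕ) :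
    IsTraceClass ((sandwich z Q * sandwich (-z) R) ^ (m + 1)) := by
  rw [pow_succ']
  exact IsTraceClass.comp_right ⟨_, _, isHilbertSchmidt_sandwich hz Q,
    isHilbertSchmidt_sandwich (neg_ne_zero.2 hz) R, rfl⟩ _

lemma cutoff_mul_cutoff (n : ℕ) : cutoff n * cutoff n = cutoff n := by
  change cutoff n ∘L cutoff n = cutoff n
  rw [cutoff, fourierMult_comp (bddSymbol_indicator n) (bddSymbol_indicator n)]
  congr 1
  funext ξ
  by_cases hξ : ξ ∈ Set.Icc (-n : ℝ) n <;> simp [hξ]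

lemma cutoff_mul_sqrt (hz : z ≠ 0) (n : ℕ) :
    fourierMult (sqrtSymbol z) * cutoff n = cutoff n * fourierMult (sqrtSymbol z) := by
  change fourierMult (sqrtSymbol z) ∘L cutoff n = cutoff n ∘L fourierMult (sqrtSymbol z)
  rw [cutoff_comp_sqrt hz, cutoff, fourierMult_comp (bddSymbol_sqrtSymbol hz) (bddSymbol_indicator n)]
  simp only [mul_comm]

/-- With M = (∂ + z)^{-1/2} the two operators are MWM and MMW, which differ by a cyclic permutation.
Plain cyclicity is not available because MQ need not be Hilbert-Schmidt. After insertion of a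
frequency cutoff, which commutes with M, it is; strong convergence of the cutoffs then removes them
under both traces. -/
lemma trace_sandwich_pow (hz : z ≠ 0) (Q R : 𝓢(ℝ, ℂ)) (m : ℕ) :
    trace ((sandwich z Q * sandwich (-z) R) ^ (m + 1)) = trace (birman z Q R ^ (m + 1)) := by
  set M := fourierMult (sqrtSymbol z) with hM
  set W := mulOp Q * resolvMul (-z) R * birman z Q R ^ m with hW
  have t1 : IsTraceClass (M * W * M) := by
    rw [hM, hW, ← sandwich_pow hz]
    exact isTraceClass_sandwich_pow hz Q R m
  have e : birman z Q R ^ (m + 1) = M * (M * W) := by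
    have hB : birman z Q R = M * M * mulOp Q * resolvMul (-z) R := by
      rw [birman, resolvMul, ← sqrt_comp_sqrt hz]
      simp only [clm_mul_eq, clm_comp_assoc, hM]
    rw [pow_succ', hW]
    nth_rewrite 1 [hB]
    simp only [mul_assoc]
  have t2 : IsTraceClass (M * (M * W)) := by
    rw [← e, pow_succ']
    exact (isTraceClass_birman hz Q R).comp_right _
  rw [sandwich_pow hz, e]
  have l1 := t1.tendsto_trace_comp cutoff norm_cutoff_le tendsto_cutoff
  have l2 := t2.tendsto_trace_comp cutoff norm_cutoff_le tendsto_cutoff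
  refine tendsto_nhds_unique l1 (l2.congr fun n => ?_)
  -- The cutoff supplies the Hilbert-Schmidt factor on the left, and (∂ - z)⁻¹R the one on the
  -- right.
  have t3 : IsTraceClass (cutoff n * M * W) :=
    ⟨cutoff n ∘L M ∘L mulOp Q, resolvMul (-z) R ∘L birman z Q R ^ m,
      isHilbertSchmidt_cutoff_sqrt_mulOp hz Q n,
      (isHilbertSchmidt_resolvMul (neg_ne_zero.2 hz) R).comp_right _, by
        simp only [clm_mul_eq, clm_comp_assoc, hW]⟩
  have c1 := cutoff_mul_sqrt hz n
  have c2 := cutoff_mul_cutoff n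
  calc trace (M * (M * W) * cutoff n) = trace (cutoff n * (M * (M * W))) := t2.trace_comm _
    _ = trace ((M * cutoff n) * (cutoff n * M * W)) := by
        congr 1
        rw [c1]
        calc cutoff n * (M * (M * W)) = (cutoff n * cutoff n) * M * M * W := by
              rw [c2]
              noncomm_ring
          _ = cutoff n * (cutoff n * M) * M * W := by noncomm_ring
          _ = cutoff n * (M * cutoff n) * M * W := by rw [c1]
          _ = cutoff n * M * (cutoff n * M * W) := by noncomm_ring
    _ = trace ((cutoff n * M * W) * (M * cutoff n)) := (t3.trace_comm _).symm
    _ = trace (cutoff n * (M * W * M * cutoff n)) := by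
        simp only [mul_assoc]
    _ = trace ((M * W * M * cutoff n) * cutoff n) := ((t1.comp_right (cutoff n)).trace_comm _).symm
    _ = trace (M * W * M * cutoff n) := by
        rw [mul_assoc, c2]

/-- The two Birman-Schwinger operators are XY and YX for the same Hilbert-Schmidt operators X and Y.
-/
lemma trace_birman_neg_pow (hz : z ≠ 0) (Q R : 𝓢(ℝ, ℂ)) (m : ℕ) :
    trace (birman (-z) Q R ^ (m + 1)) = trace (birman z R Q ^ (m + 1)) := by
  have h1 : ∀ m : ℕ, birman (-z) Q R ^ (m + 1) =
      resolvMul (-z) Q * birman z R Q ^ m * resolvMul z R := by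
    intro m
    have e1 : birman (-z) Q R = resolvMul (-z) Q * resolvMul z R := by
      rw [birman, neg_neg]
      rfl
    have e2 : birman z R Q = resolvMul z R * resolvMul (-z) Q := rfl
    induction m with
    | zero => simp [e1]
    | succ m ih =>
      rw [pow_succ, ih, pow_succ (birman z R Q), e1, e2]
      noncomm_ring
  rw [h1]
  have h2 := trace_comp_comm ((isHilbertSchmidt_resolvMul (neg_ne_zero.2 hz) Q).comp_right
    (birman z R Q ^ m)) (isHilbertSchmidt_resolvMul hz R)
  refine h2.trans ?_
  rw [pow_succ', birman]
  simp only [clm_mul_eq, clm_comp_assoc]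

end PerturbationOperators

/-! ### The Sobolev norm controls the L² norm -/

section SobolevNorm

lemma hat_eq (q : 𝓢(ℝ, ℂ)) (ξ : ℝ) :
    hat q ξ = (1 / (Real.sqrt (2 * Real.pi) : ℂ)) * (𝓕 q) (ξ / (2 * Real.pi)) := by
  rw [hat, SchwartzMap.fourier_coe, Real.fourier_real_eq_integral_exp_smul]
  congr 1
  refine integral_congr_ae (.of_forall fun x => ?_)
  simp only [smul_eq_mul]
  congr 2
  have : (Real.pi : ℂ) ≠ 0 := ofReal_ne_zero.2 Real.pi_ne_zero
  push_cast
  field_simp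

lemma norm_hat_sq (q : 𝓢(ℝ, ℂ)) (ξ : ℝ) :
    ‖hat q ξ‖ ^ 2 = 1 / (2 * Real.pi) * ‖(𝓕 q) (ξ / (2 * Real.pi))‖ ^ 2 := by
  rw [hat_eq, norm_mul, mul_pow, norm_div, norm_one, norm_real, Real.norm_of_nonneg
    (Real.sqrt_nonneg _), div_pow, one_pow, Real.sq_sqrt (by positivity)]

lemma integral_norm_hat_sq (q : 𝓢(ℝ, ℂ)) : ∫ ξ, ‖hat q ξ‖ ^ 2 = ∫ x, ‖q x‖ ^ 2 := by
  have hpi := Real.pi_pos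
  have h1 := Measure.integral_comp_div (fun η : ℝ => ‖(𝓕 q : 𝓢(ℝ, ℂ)) η‖ ^ 2) (2 * Real.pi)
  simp only [norm_hat_sq]
  rw [integral_const_mul, h1,
    SchwartzMap.integral_norm_sq_fourier, abs_of_pos (by positivity), smul_eq_mul, ← mul_assoc,
    one_div_mul_cancel (by positivity), one_mul]

lemma integrable_weight_mul_norm_hat_sq {s : ℝ} (hs : s ≤ 1) (q : 𝓢(ℝ, ℂ)) :
    Integrable fun ξ : ℝ => (4 + ξ ^ 2) ^ s * ‖hat q ξ‖ ^ 2 := by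
  have hpi := Real.pi_pos
  set F : 𝓢(ℝ, ℂ) := 𝓕 q with hF
  have h0 : Integrable fun η : ℝ => (4 * ‖F η‖ + (2 * Real.pi) ^ 2 * (‖η‖ ^ 2 * ‖F η‖)) * ‖F η‖ := by
    refine Integrable.mul_bdd ?_ (c := ‖F.toBoundedContinuousFunction‖)
      F.continuous.norm.aestronglyMeasurable (.of_forall fun η => ?_)
    · exact (F.integrable.norm.const_mul 4).add ((F.integrable_pow_mul volume 2).const_mul _)
    · rw [norm_norm]
      exact F.toBoundedContinuousFunction.norm_coe_le_norm η
  have h1 := (h0.comp_div (by positivity : (2 * Real.pi) ≠ 0)).const_mul (1 / (2 * Real.pi))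
  have hc : Continuous fun ξ : ℝ => (4 + ξ ^ 2) ^ s * ‖hat q ξ‖ ^ 2 := by
    simp only [norm_hat_sq]
    refine Continuous.mul ((by fun_prop : Continuous fun ξ : ℝ => 4 + ξ ^ 2).rpow_const fun ξ =>
      Or.inl (by positivity)) ?_
    fun_prop
  refine h1.mono' hc.aestronglyMeasurable (.of_forall fun ξ => ?_)
  rw [Real.norm_of_nonneg (by positivity), norm_hat_sq]
  have h2 : (4 + ξ ^ 2) ^ s ≤ 4 + ξ ^ 2 := by
    conv_rhs => rw [← Real.rpow_one (4 + ξ ^ 2)]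
    exact Real.rpow_le_rpow_of_exponent_le (by nlinarith [sq_nonneg ξ]) hs
  calc (4 + ξ ^ 2) ^ s * (1 / (2 * Real.pi) * ‖F (ξ / (2 * Real.pi))‖ ^ 2)
      ≤ (4 + ξ ^ 2) * (1 / (2 * Real.pi) * ‖F (ξ / (2 * Real.pi))‖ ^ 2) := by gcongr
    _ = _ := by
      rw [Real.norm_eq_abs, sq_abs]
      field_simp

lemma integral_norm_sq_le_of_sobolevNorm_le {s δ : ℝ} (hs0 : 0 ≤ s) (hs1 : s ≤ 1) (hδ : 0 ≤ δ)
    {q : 𝓢(ℝ, ℂ)} (hq : sobolevNorm s q ≤ δ) : ∫ x, ‖q x‖ ^ 2 ≤ δ ^ 2 := by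
  rw [sobolevNorm, Real.sqrt_le_left hδ] at hq
  refine le_trans ?_ hq
  -- Without integrability the Bochner integral in the Sobolev norm would take its default value 0
  -- and control nothing.
  have hi := integrable_weight_mul_norm_hat_sq hs1 q
  rw [← integral_norm_hat_sq]
  refine integral_mono_of_nonneg (.of_forall fun ξ => by positivity) hi (.of_forall fun ξ => ?_)
  exact le_mul_of_one_le_left (by positivity)
    (Real.one_le_rpow (by nlinarith [sq_nonneg ξ]) hs0)

end SobolevNorm

/-! ### Translation to κ: logarithm formula, symmetry and spectral derivative -/

section Assembly

open Set Filter Topology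

variable {q : 𝓢(ℝ, ℂ)} {κ : ℂ} {h : ℝ}

lemma norm_toLp_smul_sq (κ : ℂ) (Q : 𝓢(ℝ, ℂ)) :
    ‖(κ • Q).toLp 2‖ ^ 2 = ‖κ‖ ^ 2 * ∫ x, ‖Q x‖ ^ 2 := by
  rw [← integral_norm_sq_eq, ← integral_const_mul]
  refine integral_congr_ae (.of_forall fun x => ?_)
  simp only [_root_.smul_apply, smul_eq_mul, norm_mul, mul_pow]

lemma norm_rS (q : 𝓢(ℝ, ℂ)) (x : ℝ) : ‖rS q x‖ = ‖q x‖ := by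
  rw [rS_apply, rOf, norm_neg, RCLike.norm_conj]

/-- The potentials carry a factor κ with |κ|² = h, the same h against which smallness is measured,
so the condition on q does not depend on κ. -/
lemma small_of_norm_sq (hq : ∫ x, ‖q x‖ ^ 2 ≤ 1 / 4) (hκ : ‖κ‖ ^ 2 = h) :
    Small h (κ • q) (κ • rS q) := by
  have h0 : 0 ≤ h := hκ ▸ sq_nonneg _
  refine ⟨?_, ?_⟩
  · rw [norm_toLp_smul_sq, hκ]
    nlinarith
  · rw [norm_toLp_smul_sq, hκ]
    simp only [norm_rS]
    nlinarith

lemma Small.symm {Q R : 𝓢(ℝ, ℂ)} (hs : Small h Q R) : Small h R Q := ⟨hs.right, hs.left⟩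

lemma norm_sq_eq_pos (hh : 0 < h) (hκ : I * κ ^ 2 = (h : ℝ)) : ‖κ‖ ^ 2 = h := by
  have := congrArg norm hκ
  rwa [norm_mul, norm_I, one_mul, norm_pow, norm_real, Real.norm_of_nonneg hh.le] at this

lemma norm_sq_eq_neg (hh : 0 < h) (hκ : I * κ ^ 2 = ((-h : ℝ) : ℂ)) : ‖κ‖ ^ 2 = h := by
  have := congrArg norm hκ
  rwa [norm_mul, norm_I, one_mul, norm_pow, norm_real, norm_neg, Real.norm_of_nonneg hh.le] at this

lemma Lam_eq {z : ℝ} (hκ : I * κ ^ 2 = (z : ℝ)) (q : 𝓢(ℝ, ℂ)) : Lam κ q = sandwich z (κ • q) := by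
  have h1 : invSqrtD (z : ℂ) = fourierMult (sqrtSymbol z) := rfl
  have h2 : invSqrtD (-(z : ℂ)) = fourierMult (sqrtSymbol (-z)) := by
    rw [← ofReal_neg]
    rfl
  rw [Lam, hκ, h1, h2, sandwich]
  rfl

lemma Gam_eq {z : ℝ} (hκ : I * κ ^ 2 = (z : ℝ)) (q : 𝓢(ℝ, ℂ)) :
    Gam κ q = sandwich (-z) (κ • rS q) := by
  have h1 : invSqrtD (z : ℂ) = fourierMult (sqrtSymbol z) := rfl
  have h2 : invSqrtD (-(z : ℂ)) = fourierMult (sqrtSymbol (-z)) := by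
    rw [← ofReal_neg]
    rfl
  have h3 : (fun x => κ * rOf q x) = (κ • rS q : 𝓢(ℝ, ℂ)) := by
    funext x
    rw [_root_.smul_apply, rS_apply, smul_eq_mul]
  rw [Gam, hκ, h1, h2, h3, sandwich, neg_neg]

lemma detTerm_pos (hh : 0 < h) (hκ : I * κ ^ 2 = (h : ℝ)) (q : 𝓢(ℝ, ℂ)) (m : ℕ) :
    detTerm κ q (m + 1) =
      1 / ((m + 1 : ℕ) : ℂ) * trace (birman h (κ • q) (κ • rS q) ^ (m + 1)) := by
  rw [detTerm, Lam_eq hκ, Gam_eq hκ, trace_sandwich_pow hh.ne']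

lemma detTerm_neg (hh : 0 < h) (hκ : I * κ ^ 2 = ((-h : ℝ) : ℂ)) (q : 𝓢(ℝ, ℂ)) (m : ℕ) :
    detTerm κ q (m + 1) =
      1 / ((m + 1 : ℕ) : ℂ) * trace (birman h (κ • rS q) (κ • q) ^ (m + 1)) := by
  rw [detTerm, Lam_eq hκ, Gam_eq hκ, trace_sandwich_pow (neg_ne_zero.2 hh.ne'),
    trace_birman_neg_pow hh.ne']

lemma logDet_pos (hh : 0 < h) (hκ : I * κ ^ 2 = (h : ℝ)) (hs : Small h (κ • q) (κ • rS q)) :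
    logDet κ q = Complex.log (ja hh (κ • q) (κ • rS q)) := by
  simp only [logDet, detTerm_pos hh hκ, sgn_eq_one hh hκ, tsum_trace_birman hh hs]
  ring

lemma logDet_neg (hh : 0 < h) (hκ : I * κ ^ 2 = ((-h : ℝ) : ℂ))
    (hs : Small h (κ • rS q) (κ • q)) :
    logDet κ q = -Complex.log (ja hh (κ • rS q) (κ • q)) := by
  simp only [logDet, detTerm_neg hh hκ, sgn_eq_neg_one hh hκ, tsum_trace_birman hh hs]
  ring

lemma summable_of_norm_trace_le {c : ℕ → ℂ} (hc : ∀ m, ‖c m‖ ≤ (1 / 4 : ℝ) ^ (m + 1)) :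
    Summable fun m : ℕ => ‖1 / ((m + 1 : ℕ) : ℂ) * c m‖ := by
  refine Summable.of_nonneg_of_le (fun _ => norm_nonneg _) (fun m => ?_)
    ((summable_geometric_of_lt_one (by norm_num : (0 : ℝ) ≤ 1 / 4) (by norm_num)).mul_right (1 / 4))
  rw [norm_mul, ← pow_succ]
  refine (mul_le_of_le_one_left (norm_nonneg _) ?_).trans (hc m)
  rw [norm_div, norm_one, Complex.norm_natCast, div_le_one (by positivity)]
  exact_mod_cast Nat.succ_le_succ (Nat.zero_le m)

lemma isTraceClass_Lam_mul_Gam_pow {z : ℝ} (hz : z ≠ 0) (hκ : I * κ ^ 2 = (z : ℝ))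
    (q : 𝓢(ℝ, ℂ)) {m : ℕ} (hm : 1 ≤ m) : IsTraceClass ((Lam κ q * Gam κ q) ^ m) := by
  obtain ⟨n, rfl⟩ := Nat.exists_eq_add_of_le' hm
  rw [Lam_eq hκ, Gam_eq hκ]
  exact isTraceClass_sandwich_pow hz _ _ n

lemma log_ja_conjS (hh : 0 < h) {Q R : 𝓢(ℝ, ℂ)} (hs : Small h Q R) :
    Complex.log (ja hh (conjS Q) (conjS R)) = conj (Complex.log (ja hh Q R)) := by
  rw [ja_conjS hh hs, Complex.log_conj _ (slitPlane_arg_ne_pi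
    (mem_slitPlane_of_norm_sub_one_le (norm_ja_sub_one_le hh hs)))]

/-- The source of the symmetry of A: as r = -q̄, passing to -κ̄ and conjugating exchanges the
potentials κq and κr, which is the exchange between the two signs of iκ². -/
lemma conjS_smul_q (κ : ℂ) (q : 𝓢(ℝ, ℂ)) : conjS (-conj κ • q) = κ • rS q := by
  ext x
  simp only [conjS_apply, _root_.smul_apply, smul_eq_mul, rS_apply, rOf, map_mul, map_neg,
    Complex.conj_conj]
  ring

lemma conjS_smul_rS (κ : ℂ) (q : 𝓢(ℝ, ℂ)) : conjS (-conj κ • rS q) = κ • q := by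
  ext x
  simp only [conjS_apply, _root_.smul_apply, smul_eq_mul, rS_apply, rOf, map_mul, map_neg,
    Complex.conj_conj]
  ring

lemma logDet_symm_pos (hh : 0 < h) (hκ : I * κ ^ 2 = (h : ℝ)) (hq : ∫ x, ‖q x‖ ^ 2 ≤ 1 / 4) :
    logDet κ q = -conj (logDet (-conj κ) q) := by
  have hκ' : I * (-conj κ) ^ 2 = ((-h : ℝ) : ℂ) := by
    rw [I_mul_neg_conj_sq, hκ, conj_ofReal, ofReal_neg]
  have hs' := (small_of_norm_sq hq (norm_sq_eq_neg hh hκ')).symm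
  rw [logDet_pos hh hκ (small_of_norm_sq hq (norm_sq_eq_pos hh hκ)), logDet_neg hh hκ' hs',
    map_neg, neg_neg, ← log_ja_conjS hh hs', conjS_smul_q κ q, conjS_smul_rS κ q]

lemma logDet_symm_neg (hh : 0 < h) (hκ : I * κ ^ 2 = ((-h : ℝ) : ℂ))
    (hq : ∫ x, ‖q x‖ ^ 2 ≤ 1 / 4) : logDet κ q = -conj (logDet (-conj κ) q) := by
  have hκ' : I * (-conj κ) ^ 2 = (h : ℝ) := by
    rw [I_mul_neg_conj_sq, hκ, conj_ofReal, ofReal_neg, neg_neg]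
  have hs' := small_of_norm_sq hq (norm_sq_eq_pos hh hκ')
  rw [logDet_neg hh hκ (small_of_norm_sq hq (norm_sq_eq_neg hh hκ)).symm, logDet_pos hh hκ' hs',
    ← log_ja_conjS hh hs', conjS_smul_q κ q, conjS_smul_rS κ q]

/-- The derivative of the inverse transmission coefficient in the spectral parameter, divided by
the coefficient, as the integral of a combination of diagonal Green's functions. -/
lemma integral_diag (hh : 0 < h) {Q₀ R₀ Q R : 𝓢(ℝ, ℂ)} (c : ℂ) :
    Integrable (fun x => c * diagGam hh Q R x -
      (Q₀ x * jb hh Q R x * rs hh Q R x - R₀ x * jc hh Q R x * rb hh Q R x) / ja hh Q R) ∧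
    ∫ x, (c * diagGam hh Q R x -
      (Q₀ x * jb hh Q R x * rs hh Q R x - R₀ x * jc hh Q R x * rb hh Q R x) / ja hh Q R) =
      ((∫ x, jc hh Q R x * (R₀ x * rb hh Q R x)) - (∫ x, jb hh Q R x * (Q₀ x * rs hh Q R x))
        + 2 * c * ∫ x, jc hh Q R x * rs hh Q R x) / ja hh Q R := by
  have i1 : Integrable fun x => jc hh Q R x * (R₀ x * rb hh Q R x) :=
    (integrable_R_jc_rb hh (Q := Q) (R := R) R₀ (jc hh Q R)).congr
      (.of_forall fun x => by simp only; ring)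
  have i2 : Integrable fun x => jb hh Q R x * (Q₀ x * rs hh Q R x) :=
    (integrable_Q_jb_rs hh (Q := Q) (R := R) Q₀ (jb hh Q R)).congr
      (.of_forall fun x => by simp only; ring)
  have i3 := (integrable_jc_rs hh (Q := Q) (R := R) (jc hh Q R)).const_mul (2 * c)
  have i12 : Integrable fun x => jc hh Q R x * (R₀ x * rb hh Q R x)
    - jb hh Q R x * (Q₀ x * rs hh Q R x) := i1.sub i2
  have e : (fun x => c * diagGam hh Q R x -
      (Q₀ x * jb hh Q R x * rs hh Q R x - R₀ x * jc hh Q R x * rb hh Q R x) / ja hh Q R) =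
      fun x => (jc hh Q R x * (R₀ x * rb hh Q R x) - jb hh Q R x * (Q₀ x * rs hh Q R x)
        + 2 * c * (jc hh Q R x * rs hh Q R x)) / ja hh Q R := by
    funext x
    rw [diagGam]
    ring
  rw [e]
  refine ⟨(i12.add i3).div_const _, ?_⟩
  rw [integral_div, integral_add i12 i3, integral_sub i1 i2, integral_const_mul]

lemma ne_zero_of_sq {z : ℝ} (hz : z ≠ 0) (hκ : I * κ ^ 2 = (z : ℝ)) : κ ≠ 0 := by
  rintro rfl
  rw [zero_pow two_ne_zero, mul_zero] at hκ
  exact hz (ofReal_eq_zero.1 hκ.symm)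

/-- The derivative of `log a` along the set of admissible spectral parameters. -/
lemma hasDerivWithinAt_log_ja_spectral (hh : 0 < h) {e : ℝ} {Q R : 𝓢(ℝ, ℂ)}
    (hκ : (e : ℂ) * (I * κ ^ 2) = (h : ℝ))
    (hsm : ∀ (k : ℂ) (h' : ℝ), 0 < h' → (e : ℂ) * (I * k ^ 2) = (h' : ℝ) → Small h' (k • Q) (k • R)) :
    ∃ η : ℂ → ℝ, ∃ hpos : ∀ k, 0 < η k, η κ = h ∧
      (∀ᶠ k in 𝓝[{k : ℂ | (I * k ^ 2).im = 0}] κ, (e : ℂ) * (I * k ^ 2) = (η k : ℝ)) ∧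
      HasDerivWithinAt (fun k => Complex.log (ja (hpos k) (k • Q) (k • R)))
        (((∫ x, jc hh (κ • Q) (κ • R) x * (R x * rb hh (κ • Q) (κ • R) x))
          - (∫ x, jb hh (κ • Q) (κ • R) x * (Q x * rs hh (κ • Q) (κ • R) x))
          + 2 * (e * (2 * I * κ)) * ∫ x, jc hh (κ • Q) (κ • R) x * rs hh (κ • Q) (κ • R) x)
          / ja hh (κ • Q) (κ • R)) {k : ℂ | (I * k ^ 2).im = 0} κ := by
  set S : Set ℂ := {k : ℂ | (I * k ^ 2).im = 0} with hS
  -- `ja` needs a positive parameter at every k, so e·ik² is truncated below at h/2. At points of S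
  -- near κ the truncation is inactive and e·ik² is real. The number e = ±1 in the applications is
  -- the sign of iκ².
  let η : ℂ → ℝ := fun k => max ((e : ℂ) * (I * k ^ 2)).re (h / 2)
  have hpos : ∀ k, 0 < η k := fun k => lt_max_of_lt_right (half_pos hh)
  have hηκ : η κ = h := by
    simp only [η, hκ, ofReal_re]
    exact max_eq_left (by linarith)
  have hev : ∀ᶠ k in 𝓝[S] κ, (e : ℂ) * (I * k ^ 2) = (η k : ℝ) := by
    have hc : Continuous fun k : ℂ => ((e : ℂ) * (I * k ^ 2)).re := by fun_prop
    have h1 : ∀ᶠ k in 𝓝 κ, h / 2 < ((e : ℂ) * (I * k ^ 2)).re :=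
      hc.continuousAt.eventually (lt_mem_nhds (by
        change h / 2 < ((e : ℂ) * (I * κ ^ 2)).re
        rw [hκ, ofReal_re]
        linarith))
    filter_upwards [nhdsWithin_le_nhds h1, self_mem_nhdsWithin] with k hk hkS
    have hkS' : (I * k ^ 2).im = 0 := hkS
    have h2 : η k = ((e : ℂ) * (I * k ^ 2)).re := max_eq_left hk.le
    rw [h2]
    refine Complex.ext rfl ?_
    rw [ofReal_im, im_ofReal_mul, hkS', mul_zero]
  have hη : HasDerivWithinAt (fun k => (η k : ℂ)) (e * (2 * I * κ)) S κ := by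
    have h1 : HasDerivWithinAt (fun k : ℂ => (e : ℂ) * (I * k ^ 2)) (e * (2 * I * κ)) S κ := by
      refine (((hasDerivAt_pow 2 κ).const_mul I).const_mul (e : ℂ)).hasDerivWithinAt.congr_deriv ?_
      push_cast
      ring
    refine h1.congr_of_eventuallyEq ?_ (by rw [hηκ, hκ])
    filter_upwards [hev] with k hk
    rw [hk]
  have hsmκ : Small (η κ) (κ • Q) (κ • R) := by
    rw [hηκ]
    exact hsm κ h hh hκ
  have h1 := hasDerivWithinAt_ja (Q := Q) (R := R) hpos hη (hasDerivWithinAt_id κ S)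
    (hasDerivWithinAt_id κ S) hsmκ (by
      filter_upwards [nhdsWithin_mono κ sdiff_subset hev] with k hk
      exact hsm k _ (hpos k) hk)
  refine ⟨η, hpos, hηκ, hev, ?_⟩
  have h2 := h1.clog (mem_slitPlane_of_norm_sub_one_le (norm_ja_sub_one_le (hpos κ) hsmκ))
  simp only [one_mul, id_eq] at h2
  -- η κ and h are equal only propositionally, and the Jost data depend on the parameter through a
  -- positivity proof.
  convert h2 using 1
  congr!
  all_goals exact hηκ.symm

end Assembly

/-! ### All assertions at a single spectral parameter -/

section MainResult

open Set Filter Topology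

variable {q : 𝓢(ℝ, ℂ)} {κ : ℂ} {h : ℝ}

/-- All assertions about a single admissible spectral parameter. -/
structure DensityAt (κ : ℂ) (q : 𝓢(ℝ, ℂ)) : Prop where
  existsUnique_green : ∃! G, IsGreen κ q G
  summable : Summable fun m : ℕ => ‖detTerm κ q (m + 1)‖
  symm : logDet κ q = -conj (logDet (-conj κ) q)
  integrable_deriv : Integrable fun x : ℝ =>
    2 * I * κ * gam κ q x - (q x * g21 κ q x + rOf q x * g12 κ q x)
  hasDerivWithinAt : HasDerivWithinAt (fun k : ℂ => logDet k q)
    (∫ x : ℝ, (2 * I * κ * gam κ q x - (q x * g21 κ q x + rOf q x * g12 κ q x)))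
    {k : ℂ | (I * k ^ 2).im = 0} κ
  two_add_gam_ne_zero : ∀ x : ℝ, 2 + gam κ q x ≠ 0
  integrable_rho : Integrable (rho κ q)
  logDet_eq : logDet κ q = ∫ x : ℝ, rho κ q x

lemma densityAt_pos (hh : 0 < h) (hκ : I * κ ^ 2 = (h : ℝ)) (hq : ∫ x, ‖q x‖ ^ 2 ≤ 1 / 4) :
    DensityAt κ q := by
  have hκ0 := ne_zero_of_sq hh.ne' hκ
  have hs := small_of_norm_sq hq (norm_sq_eq_pos hh hκ)
  have ha := ja_ne_zero hh hs
  have hG := isGreen_pos hh hκ hs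
  have hgam := gam_eq_pos hh hκ hs
  have hpair := pair_eq_pos hh hκ hs
  have hfun : (fun x : ℝ => 2 * I * κ * gam κ q x - (q x * g21 κ q x + rOf q x * g12 κ q x)) =
      fun x => 2 * I * κ * diagGam hh (κ • q) (κ • rS q) x -
        (q x * jb hh (κ • q) (κ • rS q) x * rs hh (κ • q) (κ • rS q) x
          - rS q x * jc hh (κ • q) (κ • rS q) x * rb hh (κ • q) (κ • rS q) x)
          / ja hh (κ • q) (κ • rS q) := by
    funext x
    rw [hgam x]
    congr 1
    -- The diagonal formula is known for κ times the pair, since the potentials are κq and κr;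
    -- dividing by κ ≠ 0 leaves q and r as weights.
    refine mul_left_cancel₀ hκ0 ?_
    rw [hpair x, diagPair]
    simp only [_root_.smul_apply, smul_eq_mul]
    ring
  have hrho : rho κ q = fun x => -(diagPair hh (κ • q) (κ • rS q) x
      / (2 + diagGam hh (κ • q) (κ • rS q) x)) := by
    funext x
    rw [rho, hgam x, ← hpair x]
    ring
  obtain ⟨i1, e1⟩ := integral_diag hh (Q₀ := q) (R₀ := rS q) (Q := κ • q) (R := κ • rS q)
    (2 * I * κ)
  obtain ⟨i2, e2⟩ := integral_density hh hs
  refine ⟨⟨_, hG, fun G' hG' => hG'.unique hG⟩, ?_, logDet_symm_pos hh hκ hq, hfun ▸ i1, ?_,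
    fun x => ?_, hrho ▸ i2, ?_⟩
  · simp only [detTerm_pos hh hκ]
    exact summable_of_norm_trace_le (hs.norm_trace_birman_pow_le hh)
  · rw [hfun, e1]
    obtain ⟨η, hpos, hηκ, hev, hd⟩ := hasDerivWithinAt_log_ja_spectral hh (e := 1) (Q := q)
      (R := rS q) (by rw [hκ, ofReal_one, one_mul]) fun k h' hh' hk =>
        small_of_norm_sq hq (norm_sq_eq_pos hh' (by rwa [ofReal_one, one_mul] at hk))
    have hlog : ∀ k : ℂ, ((1 : ℝ) : ℂ) * (I * k ^ 2) = (η k : ℝ) →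
        logDet k q = Complex.log (ja (hpos k) (k • q) (k • rS q)) := fun k hk => by
      rw [ofReal_one, one_mul] at hk
      exact logDet_pos (hpos k) hk (small_of_norm_sq hq (norm_sq_eq_pos (hpos k) hk))
    refine (hd.congr_of_eventuallyEq (hev.mono hlog) (hlog κ ?_)).congr_deriv ?_
    · rw [hηκ, hκ, ofReal_one, one_mul]
    · push_cast
      ring
  · rw [hgam x]
    exact two_add_diagGam_ne_zero hh hs x
  · rw [hrho, e2, logDet_pos hh hκ hs]

lemma densityAt_neg (hh : 0 < h) (hκ : I * κ ^ 2 = ((-h : ℝ) : ℂ))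
    (hq : ∫ x, ‖q x‖ ^ 2 ≤ 1 / 4) : DensityAt κ q := by
  have hκ0 := ne_zero_of_sq (neg_ne_zero.2 hh.ne') hκ
  have hs := (small_of_norm_sq hq (norm_sq_eq_neg hh hκ)).symm
  have ha := ja_ne_zero hh hs
  have hG := isGreen_neg hh hκ hs
  have hgam := gam_eq_neg hh hκ hs
  have hpair := pair_eq_neg hh hκ hs
  have hfun : (fun x : ℝ => 2 * I * κ * gam κ q x - (q x * g21 κ q x + rOf q x * g12 κ q x)) =
      fun x => -(-(2 * I * κ) * diagGam hh (κ • rS q) (κ • q) x -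
        (rS q x * jb hh (κ • rS q) (κ • q) x * rs hh (κ • rS q) (κ • q) x
          - q x * jc hh (κ • rS q) (κ • q) x * rb hh (κ • rS q) (κ • q) x)
          / ja hh (κ • rS q) (κ • q)) := by
    funext x
    have hp : q x * g21 κ q x + rOf q x * g12 κ q x =
        -((rS q x * jb hh (κ • rS q) (κ • q) x * rs hh (κ • rS q) (κ • q) x
          - q x * jc hh (κ • rS q) (κ • q) x * rb hh (κ • rS q) (κ • q) x)
          / ja hh (κ • rS q) (κ • q)) := by
      refine mul_left_cancel₀ hκ0 ?_
      rw [hpair x, diagPair]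
      simp only [_root_.smul_apply, smul_eq_mul]
      ring
    rw [hgam x, hp]
    ring
  have hrho : rho κ q = fun x => -(-(diagPair hh (κ • rS q) (κ • q) x
      / (2 + diagGam hh (κ • rS q) (κ • q) x))) := by
    funext x
    have hp := hpair x
    rw [rho, hgam x, neg_neg, ← mul_div_assoc, neg_mul, hp, neg_neg]
  obtain ⟨i1, e1⟩ := integral_diag hh (Q₀ := rS q) (R₀ := q) (Q := κ • rS q) (R := κ • q)
    (-(2 * I * κ))
  obtain ⟨i2, e2⟩ := integral_density hh hs
  refine ⟨⟨_, hG, fun G' hG' => hG'.unique hG⟩, ?_, logDet_symm_neg hh hκ hq, hfun ▸ i1.neg, ?_,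
    fun x => ?_, hrho ▸ i2.neg, ?_⟩
  · simp only [detTerm_neg hh hκ]
    exact summable_of_norm_trace_le (hs.norm_trace_birman_pow_le hh)
  · rw [hfun, integral_neg, e1]
    obtain ⟨η, hpos, hηκ, hev, hd⟩ := hasDerivWithinAt_log_ja_spectral hh (e := -1) (Q := rS q)
      (R := q) (by rw [hκ]; push_cast; ring) fun k h' hh' hk =>
        (small_of_norm_sq hq (norm_sq_eq_neg hh' (by
          rw [ofReal_neg, ← hk]; push_cast; ring))).symm
    have hlog : ∀ k : ℂ, ((-1 : ℝ) : ℂ) * (I * k ^ 2) = (η k : ℝ) →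
        logDet k q = -Complex.log (ja (hpos k) (k • rS q) (k • q)) := fun k hk => by
      have hk' : I * k ^ 2 = ((-η k : ℝ) : ℂ) := by
        rw [ofReal_neg, ← hk]
        push_cast
        ring
      exact logDet_neg (hpos k) hk' (small_of_norm_sq hq (norm_sq_eq_neg (hpos k) hk')).symm
    refine (hd.fun_neg.congr_of_eventuallyEq (hev.mono hlog) (hlog κ ?_)).congr_deriv ?_
    · rw [hηκ, hκ]
      push_cast
      ring
    · push_cast
      ring
  · rw [hgam x]
    exact two_add_diagGam_ne_zero hh hs x
  · rw [hrho, integral_neg, e2, logDet_neg hh hκ hs]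

lemma densityAt (hκ : (I * κ ^ 2).im = 0) (hκ1 : 1 ≤ ‖κ‖) (hq : ∫ x, ‖q x‖ ^ 2 ≤ 1 / 4) :
    DensityAt κ q ∧ ∀ m : ℕ, 1 ≤ m → IsTraceClass ((Lam κ q * Gam κ q) ^ m) := by
  obtain ⟨z, hz⟩ : ∃ z : ℝ, I * κ ^ 2 = (z : ℝ) := ⟨_, Complex.ext rfl hκ⟩
  have hz0 : z ≠ 0 := by
    rintro rfl
    have := congrArg norm hz
    rw [norm_mul, norm_I, one_mul, norm_pow, ofReal_zero, norm_zero] at this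
    nlinarith
  refine ⟨?_, fun m hm => isTraceClass_Lam_mul_Gam_pow hz0 hz q hm⟩
  rcases lt_or_gt_of_ne hz0 with hz1 | hz1
  · exact densityAt_neg (neg_pos.2 hz1) (by rw [neg_neg, hz]) hq
  · exact densityAt_pos hz1 hz hq

end MainResult

end DNLS

end

theorem mainTheorem3 (s : ℝ) (hs0 : 0 < s) (hs1 : s < 1 / 2) :
    ∃ δ : ℝ, 0 < δ ∧ ∀ q : SchwartzMap ℝ ℂ, DNLS.sobolevNorm s q ≤ δ →
      ∀ κ : ℂ, (Complex.I * κ ^ 2).im = 0 → 1 ≤ ‖κ‖ →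
        -- the objects are well defined
        ((∃! G, DNLS.IsGreen κ q G) ∧
          (∀ m : ℕ, 1 ≤ m → DNLS.IsTraceClass ((DNLS.Lam κ q * DNLS.Gam κ q) ^ m)) ∧
          Summable (fun m : ℕ => ‖DNLS.detTerm κ q (m + 1)‖)) ∧
        -- symmetry
        DNLS.logDet κ q = -(starRingEnd ℂ) (DNLS.logDet (-(starRingEnd ℂ) κ) q) ∧
        -- the derivative with respect to `κ`
        (MeasureTheory.Integrable (fun x : ℝ =>
            2 * Complex.I * κ * DNLS.gam κ q x
              - (q x * DNLS.g21 κ q x + DNLS.rOf q x * DNLS.g12 κ q x)) ∧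
          HasDerivWithinAt (fun k : ℂ => DNLS.logDet k q)
            (∫ x : ℝ, (2 * Complex.I * κ * DNLS.gam κ q x
              - (q x * DNLS.g21 κ q x + DNLS.rOf q x * DNLS.g12 κ q x)))
            {k : ℂ | (Complex.I * k ^ 2).im = 0} κ) ∧
        -- the density
        ((∀ x : ℝ, 2 + DNLS.gam κ q x ≠ 0) ∧
          MeasureTheory.Integrable (DNLS.rho κ q) ∧
          DNLS.logDet κ q = ∫ x : ℝ, DNLS.rho κ q x) := by
  -- δ² = 1/4 is the bound on ‖q‖² in L² under which `Small` holds.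
  refine ⟨1 / 2, by norm_num, fun q hq κ hκ hκ1 => ?_⟩
  have hq' := DNLS.integral_norm_sq_le_of_sobolevNorm_le hs0.le (by linarith) (by norm_num) hq
  obtain ⟨h, ht⟩ := DNLS.densityAt hκ hκ1 (hq'.trans (by norm_num))
  exact ⟨⟨h.existsUnique_green, ht, h.summable⟩, h.symm,
    ⟨h.integrable_deriv, h.hasDerivWithinAt⟩, h.two_add_gam_ne_zero, h.integrable_rho, h.logDet_eq⟩
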